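/- Let $a>b>c>0$ and $\lambda>0$ be real numbers, and put $k=\sqrt{(a^2-b^2)/(a^2-c^2)}\in(0,1)$, $K=\int_0^{\pi/2}(1-k^2\sin^2\phi)^{-1/2}\,d\phi$. Let $\operatorname{sn},\operatorname{cn}$ be the Jacobian elliptic functions and $q(t)=\bigl(a^2\operatorname{cn}^2(t,k)+b^2\operatorname{sn}^2(t,k)\bigr)^{1/2}$. Let $h_0(\lambda)<h_1(\lambda)<h_2(\lambda)<\cdots$ be the eigenvalues $h$ (an infinite sequence diverging to $\infty$) of the regular Sturm–Liouville problem \[ \frac{d}{dt}\Bigl(\frac1{q(t)}\frac{dw}{dt}\Bigr)+q(t)\bigl(h-\lambda k^2\operatorname{sn}^2(t,k)\bigr)w=0,\quad 0\le t\le K,\qquad w'(0)=w'(K)=0; \] that is, $h_n(\lambda)=h_{n,(0,0,0)}(\lambda;a,b,c)$. For $N\in\mathbb{N}_0$ let $D_N,C_N,B_N$ be the $(N+1)\times(N+1)$ matrices whose entry in row $j$ and column $n$ ($j,n=0,\dots,N$) is the coefficient of $\cos(2j\tau)$ (where $\cos(-2m\tau)$ is identified with $\cos(2m\tau)$) in,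 respectively, \begin{align*} D\cos(2n\tau)={}&n^2\bigl(2(a^2+b^2)-\tfrac12k^2(a^2+3b^2)\bigr)\cos(2n\tau)+n^2(b^2-a^2-b^2k^2)\bigl(\cos((2n-2)\tau)+\cos((2n+2)\tau)\bigr)\\ &+\tfrac14n^2k^2(a^2-b^2)\bigl(\cos((2n-4)\tau)+\cos((2n+4)\tau)\bigr)+\tfrac12nc^2k^2\bigl(\cos((2n-2)\tau)-\cos((2n+2)\tau)\bigr),\\ C\cos(2n\tau)={}&\tfrac1{16}k^2(a^4+2a^2b^2+5b^4)\cos(2n\tau)+\tfrac1{64}k^2(15b^4+2a^2b^2-a^4)\bigl(\cos((2n-2)\tau)+\cos((2n+2)\tau)\bigr)\\ &+\tfrac1{32}k^2(b^2-a^2)(a^2+3b^2)\bigl(\cos((2n-4)\tau)+\cos((2n+4)\tau)\bigr)+\tfrac1{64}k^2(a^2-b^2)^2\bigl(\cos((2n-6)\tau)+\cos((2n+6)\tau)\bigr),\\ B\cos(2n\tau)={}&\tfrac18(3a^4+2a^2b^2+3b^4)\cos(2n\tau)+\tfrac14(b^4-a^4)\bigl(\cos((2n-2)\tau)+\cos((2n+2)\tau)\bigr)\\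 &+\tfrac1{16}(a^2-b^2)^2\bigl(\cos((2n-4)\tau)+\cos((2n+4)\tau)\bigr). \end{align*} These are the cosine expansions of $Dw=-(a^2\sin^2\tau+b^2\cos^2\tau)(1-k^2\cos^2\tau)w''-c^2k^2\cos\tau\sin\tau\,w'$, $Cw=k^2\cos^2\tau\,(a^2\sin^2\tau+b^2\cos^2\tau)^2w$, $Bw=(a^2\sin^2\tau+b^2\cos^2\tau)^2w$ at $w=\cos(2n\tau)$. Then the generalized matrix eigenvalue problem $D_Nu+\lambda C_Nu=hB_Nu$ has exactly $N+1$ complex eigenvalues, counted with algebraic multiplicity as zeros of $\det(hB_N-D_N-\lambda C_N)$. If $\hat h_{0,N}(\lambda),\dots,\hat h_{N,N}(\lambda)$ denote these eigenvalues, arranged in increasing order of their real parts (with ties ordered arbitrarily), then for every $n\in\mathbb{N}_0$ \[ \lim_{N\to\infty}\hat h_{n,N}(\lambda)=h_n(\lambda). \] -/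

import Mathlib

open Filter Topology

noncomputable section

namespace EllipsoidSL

/-- The square `k ^ 2 = (a ^ 2 - b ^ 2) / (a ^ 2 - c ^ 2)` of the modulus. -/
def kSq (a b c : ℝ) : ℝ := (a ^ 2 - b ^ 2) / (a ^ 2 - c ^ 2)

/-- The modulus `k`; for `a > b > c > 0` it lies in `(0, 1)`. -/
def modulus (a b c : ℝ) : ℝ := Real.sqrt (kSq a b c)

/-! ### Jacobian elliptic functions of a real argument, with modulus `k ∈ (0, 1)` -/

/-- The incomplete elliptic integral of the first kind. -/
def ellipticF (k φ : ℝ) : ℝ := ∫ θ in (0 : ℝ)..φ, 1 / Real.sqrt (1 - k ^ 2 * Real.sin θ ^ 2)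

/-- The complete elliptic integral `K(k)`. -/
def ellipticK (k : ℝ) : ℝ := ellipticF k (Real.pi / 2)

/-- The Jacobian amplitude `am(t, k)`: the inverse function of `φ ↦ F(φ, k)`, which for
`0 < k < 1` is a bijection of `ℝ` onto itself. -/
def jacobiAm (t k : ℝ) : ℝ := Function.invFun (ellipticF k) t

/-- `sn(t, k)`. -/
def jacobiSn (t k : ℝ) : ℝ := Real.sin (jacobiAm t k)

/-- `cn(t, k)`. -/
def jacobiCn (t k : ℝ) : ℝ := Real.cos (jacobiAm t k)

/-! ### The Sturm–Liouville problem -/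

/-- The coefficient `q(t) = (a ^ 2 cn ^ 2 (t, k) + b ^ 2 sn ^ 2 (t, k)) ^ (1 / 2)`. -/
def q (a b c t : ℝ) : ℝ :=
  Real.sqrt (a ^ 2 * jacobiCn t (modulus a b c) ^ 2 + b ^ 2 * jacobiSn t (modulus a b c) ^ 2)

/-- `h` is an eigenvalue of the regular Sturm–Liouville problem
`(w' / q)' + q (h - lam k ^ 2 sn ^ 2 (t, k)) w = 0` on `[0, K]`, `w'(0) = w'(K) = 0`:
there is a solution `w` (with derivative `w'`) that is not identically zero on `[0, K]`. -/
def IsSLEigenvalue (a b c lam h : ℝ) : Prop :=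
  ∃ w w' : ℝ → ℝ,
    (∀ t ∈ Set.Icc 0 (ellipticK (modulus a b c)),
      HasDerivWithinAt w (w' t) (Set.Icc 0 (ellipticK (modulus a b c))) t) ∧
    (∀ t ∈ Set.Icc 0 (ellipticK (modulus a b c)),
      HasDerivWithinAt (fun x => 1 / q a b c x * w' x)
        (-(q a b c t *
          (h - lam * modulus a b c ^ 2 * jacobiSn t (modulus a b c) ^ 2) * w t))
        (Set.Icc 0 (ellipticK (modulus a b c))) t) ∧
    w' 0 = 0 ∧ w' (ellipticK (modulus a b c)) = 0 ∧
    ∃ t ∈ Set.Icc 0 (ellipticK (modulus a b c)), w t ≠ 0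

/-- `h 0 < h 1 < h 2 < ⋯` are all the eigenvalues of the Sturm–Liouville problem, and they
diverge to `∞`. There is at most one such sequence `h`. -/
def IsSLEigenvalueSequence (a b c lam : ℝ) (h : ℕ → ℝ) : Prop :=
  StrictMono h ∧ Set.range h = {x | IsSLEigenvalue a b c lam x} ∧ Tendsto h atTop atTop

/-! ### The truncated matrices -/

/-- The coefficient of `cos (2 j τ)`, `j ≥ 0`, in `cos (2 m τ)`, where `m` is an integer and
`cos (2 m τ) = cos (2 |m| τ)`. -/
def cosCoeff (m : ℤ) (j : ℕ) : ℝ := if m.natAbs = j then 1 else 0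

/-- The matrix `D_N`: column `n` holds the coefficients of `D cos (2 n τ)`, where
`D w = -(a² sin² τ + b² cos² τ) (1 - k² cos² τ) w'' - c² k² cos τ sin τ w'`. -/
def matD (a b c : ℝ) (N : ℕ) : Matrix (Fin (N + 1)) (Fin (N + 1)) ℝ :=
  Matrix.of fun j n =>
    (n : ℝ) ^ 2 * (2 * (a ^ 2 + b ^ 2) - 1 / 2 * kSq a b c * (a ^ 2 + 3 * b ^ 2)) * cosCoeff n j
    + (n : ℝ) ^ 2 * (b ^ 2 - a ^ 2 - b ^ 2 * kSq a b c) *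
        (cosCoeff (n - 1) j + cosCoeff (n + 1) j)
    + 1 / 4 * (n : ℝ) ^ 2 * kSq a b c * (a ^ 2 - b ^ 2) *
        (cosCoeff (n - 2) j + cosCoeff (n + 2) j)
    + 1 / 2 * (n : ℝ) * c ^ 2 * kSq a b c * (cosCoeff (n - 1) j - cosCoeff (n + 1) j)

/-- The matrix `C_N`: column `n` holds the coefficients of
`k² cos² τ (a² sin² τ + b² cos² τ)² cos (2 n τ)`. -/
def matC (a b c : ℝ) (N : ℕ) : Matrix (Fin (N + 1)) (Fin (N + 1)) ℝ :=
  Matrix.of fun j n =>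
    1 / 16 * kSq a b c * (a ^ 4 + 2 * a ^ 2 * b ^ 2 + 5 * b ^ 4) * cosCoeff n j
    + 1 / 64 * kSq a b c * (15 * b ^ 4 + 2 * a ^ 2 * b ^ 2 - a ^ 4) *
        (cosCoeff (n - 1) j + cosCoeff (n + 1) j)
    + 1 / 32 * kSq a b c * (b ^ 2 - a ^ 2) * (a ^ 2 + 3 * b ^ 2) *
        (cosCoeff (n - 2) j + cosCoeff (n + 2) j)
    + 1 / 64 * kSq a b c * (a ^ 2 - b ^ 2) ^ 2 *
        (cosCoeff (n - 3) j + cosCoeff (n + 3) j)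

/-- The matrix `B_N`: column `n` holds the coefficients of
`(a² sin² τ + b² cos² τ)² cos (2 n τ)`. -/
def matB (a b : ℝ) (N : ℕ) : Matrix (Fin (N + 1)) (Fin (N + 1)) ℝ :=
  Matrix.of fun j n =>
    1 / 8 * (3 * a ^ 4 + 2 * a ^ 2 * b ^ 2 + 3 * b ^ 4) * cosCoeff n j
    + 1 / 4 * (b ^ 4 - a ^ 4) * (cosCoeff (n - 1) j + cosCoeff (n + 1) j)
    + 1 / 16 * (a ^ 2 - b ^ 2) ^ 2 * (cosCoeff (n - 2) j + cosCoeff (n + 2) j)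

/-! ### The generalized matrix eigenvalue problem -/

/-- The characteristic polynomial `det (h B_N - (D_N + lam C_N))` in the variable `h` of the
problem `D_N u + lam C_N u = h B_N u`, with complex coefficients. -/
def pencilPoly (a b c lam : ℝ) (N : ℕ) : Polynomial ℂ :=
  Matrix.det
    ((Polynomial.X : Polynomial ℂ) •
        (matB a b N).map (fun x : ℝ => Polynomial.C (x : ℂ))
      - (matD a b c N + lam • matC a b c N).map (fun x : ℝ => Polynomial.C (x : ℂ)))

/-- `g 0, …, g N` are the complex eigenvalues of `D_N u + lam C_N u = h B_N u`, repeated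
according to their algebraic multiplicities and arranged in increasing order of their real parts.
(The values `g n` with `n > N` are irrelevant.) -/
def IsPencilEigenvalueList (a b c lam : ℝ) (N : ℕ) (g : ℕ → ℂ) : Prop :=
  (Multiset.range (N + 1)).map g = (pencilPoly a b c lam N).roots ∧
  ∀ m n : ℕ, m ≤ n → n ≤ N → (g m).re ≤ (g n).re

end EllipsoidSL

end

/-! The substitution τ = π/2 - am t turns the Sturm–Liouville problem into an equation p w'' + r w'
+ s (h - λκ) w = 0 on [0, π/2] with trigonometric polynomial coefficients and Neumann conditions.
Its solutions are cosine series in cos 2nτ, and D_N, C_N, B_N are the compressions of the equation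
to the span of cos 2nτ, n ≤ N. The theorem thus asserts the convergence of a Galerkin method for a
pencil that is not self-adjoint.

Let u be the Fourier coefficients of w and take v n = (1 + n²) u n as unknown. The equation becomes
(P + G - h S) v = 0 on the even sequences of ℓ²(ℤ), where P, multiplication by 4 (A - B cos 2τ)(C -
E cos 2τ), is bounded, coercive and onto, and G and S are compact. Coercivity and compactness make
bounded solutions of the projected equations subsequentially convergent
(`CompactPencil.exists_subseq_tendsto`). Three facts follow: limits of truncated eigenvalues are
eigenvalues; every isolated eigenvalue is approached by truncated eigenvalues, by the maximum
principle for the resolvent (`CompactPencil.eventually_exists_isProjEigenvalue`); near a simple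
point a fine truncation has at most one eigenvalue, algebraic multiplicity included
(`CompactPencil.IsSimpleAt.exists_ball`).

Simplicity holds at every point (`Coeffs.isSimpleAt`): in divergence form the equation is
self-adjoint, so Lagrange identities exclude nonreal eigenvalues and Jordan chains, and the initial
condition fixes the eigenfunction up to a factor. The truncated problems lack this symmetry, but
their eigenvalues lie in one common sector (`Coeffs.exists_sector`), so an upper bound on the real
part confines them to a bounded set.

These facts combine by induction on n (`tendsto_of_ordered_lists`). The eigenvalues do form an
infinite sequence tending to ∞: the Prüfer angle yields infinitely many, the sector bounds them
below, and two close eigenvalues near an accumulation point would produce two truncated eigenvalues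
near a simple point. -/

noncomputable section

namespace EllipsoidSL

/-! ### Projection methods for linear operator pencils with compact lower order terms -/

section Abstract

variable {H : Type*} [NormedAddCommGroup H] [InnerProductSpace ℂ H]

/-- The pencil `h ↦ P + G - h S`, where `P` is coercive and onto and `G`, `S` are compact, considered
on an invariant closed subspace `E`. -/
structure CompactPencil (H : Type*) [NormedAddCommGroup H] [InnerProductSpace ℂ H] where
  P : H →L[ℂ] H
  G : H →L[ℂ] H
  S : H →L[ℂ] H
  E : Submodule ℂ H
  isClosed_E : IsClosed (E : Set H)
  c : ℝ
  c_pos : 0 < c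
  coercive : ∀ v, c * ‖v‖ ^ 2 ≤ (inner ℂ v (P v)).re
  surjective : Function.Surjective P
  compact_G : IsCompactOperator G
  compact_S : IsCompactOperator S
  P_mem_iff : ∀ v, P v ∈ E ↔ v ∈ E
  G_mem : ∀ v ∈ E, G v ∈ E
  S_mem : ∀ v ∈ E, S v ∈ E

/-- The operator `P + G - h S`. -/
def CompactPencil.T (A : CompactPencil H) (h : ℂ) : H →L[ℂ] H := A.P + A.G - h • A.S

theorem CompactPencil.T_apply (A : CompactPencil H) (h : ℂ) (v : H) :
    A.T h v = A.P v + A.G v - h • A.S v := rfl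

theorem CompactPencil.T_mem (A : CompactPencil H) (h : ℂ) {v : H} (hv : v ∈ A.E) :
    A.T h v ∈ A.E := by
  rw [A.T_apply]
  exact A.E.sub_mem (A.E.add_mem ((A.P_mem_iff v).2 hv) (A.G_mem v hv))
    (A.E.smul_mem _ (A.S_mem v hv))

theorem CompactPencil.T_sub_T (A : CompactPencil H) (h h' : ℂ) (v : H) :
    A.T h' v = A.T h v + (h - h') • A.S v := by
  simp only [A.T_apply, sub_smul]; abel

/-- The subspaces `V N` of `E` are asymptotically dense in `E`. -/
structure IsApproximating (E : Submodule ℂ H) (V : ℕ → Submodule ℂ H)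
    [∀ N, (V N).HasOrthogonalProjection] : Prop where
  le : ∀ N, V N ≤ E
  tendsto : ∀ x ∈ E, Tendsto (fun N => (V N).starProjection x) atTop (𝓝 x)

variable {V : ℕ → Submodule ℂ H} [∀ N, (V N).HasOrthogonalProjection]

/-- Orthogonal projections are contractions, so pointwise convergence survives when the vector moves
as well. -/
theorem IsApproximating.tendsto_of_tendsto {E : Submodule ℂ H} (hV : IsApproximating E V)
    {N : ℕ → ℕ} (hN : Tendsto N atTop atTop) {F : ℕ → H} {f : H} (hf : f ∈ E)
    (hF : Tendsto F atTop (𝓝 f)) :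
    Tendsto (fun i => (V (N i)).starProjection (F i)) atTop (𝓝 f) := by
  have h1 : Tendsto (fun i => (V (N i)).starProjection f) atTop (𝓝 f) := (hV.tendsto f hf).comp hN
  have h2 : Tendsto (fun i => (V (N i)).starProjection (F i - f)) atTop (𝓝 0) := by
    refine squeeze_zero_norm (fun i => (V (N i)).norm_starProjection_apply_le _) ?_
    have := (hF.sub_const f).norm
    simpa using this
  simpa using h1.add h2

/-- Bounded solutions of the projected equations have convergent subsequences. -/
theorem CompactPencil.exists_subseq_tendsto (A : CompactPencil H) (hV : IsApproximating A.E V)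
    {N : ℕ → ℕ} (hN : Tendsto N atTop atTop) {μ : ℕ → ℂ} {h : ℂ} (hμ : Tendsto μ atTop (𝓝 h))
    {v : ℕ → H} (hv : ∀ i, v i ∈ V (N i)) {R : ℝ} (hR : ∀ i, ‖v i‖ ≤ R)
    {F : ℕ → H} {f : H} (hf : f ∈ A.E) (hF : Tendsto F atTop (𝓝 f))
    (heq : ∀ i, (V (N i)).starProjection (A.T (μ i) (v i)) = (V (N i)).starProjection (F i)) :
    ∃ φ : ℕ → ℕ, StrictMono φ ∧ ∃ w ∈ A.E, Tendsto (v ∘ φ) atTop (𝓝 w) ∧ A.T h w = f := by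
  obtain ⟨K₁, hK₁, hK₁'⟩ := IsCompactOperator.image_closedBall_subset_compact
    (f := (A.G : H →ₗ[ℂ] H)) A.compact_G R
  obtain ⟨K₂, hK₂, hK₂'⟩ := IsCompactOperator.image_closedBall_subset_compact
    (f := (A.S : H →ₗ[ℂ] H)) A.compact_S R
  have hmem : ∀ i, v i ∈ Metric.closedBall (0 : H) R := fun i => by simpa using hR i
  obtain ⟨g₁, -, φ₁, hφ₁, hg₁⟩ := hK₁.tendsto_subseq (x := fun i => A.G (v i))
    (fun i => hK₁' ⟨v i, hmem i, rfl⟩)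
  obtain ⟨g₂, -, φ₂, hφ₂, hg₂⟩ := hK₂.tendsto_subseq (x := fun i => A.S (v (φ₁ i)))
    (fun i => hK₂' ⟨v (φ₁ i), hmem _, rfl⟩)
  set φ := φ₁ ∘ φ₂ with hφdef
  have hφ : StrictMono φ := hφ₁.comp hφ₂
  have hG : Tendsto (fun i => A.G (v (φ i))) atTop (𝓝 g₁) := hg₁.comp hφ₂.tendsto_atTop
  have hS : Tendsto (fun i => A.S (v (φ i))) atTop (𝓝 g₂) := hg₂
  have hvE : ∀ i, v i ∈ A.E := fun i => hV.le _ (hv i)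
  have hg₁E : g₁ ∈ A.E := A.isClosed_E.mem_of_tendsto hG
    (Eventually.of_forall fun i => A.G_mem _ (hvE _))
  have hg₂E : g₂ ∈ A.E := A.isClosed_E.mem_of_tendsto hS
    (Eventually.of_forall fun i => A.S_mem _ (hvE _))
  have hNφ : Tendsto (N ∘ φ) atTop atTop := hN.comp hφ.tendsto_atTop
  -- With G v and S v convergent along the subsequence, the limit of v can only be the solution w of
  -- P w = g.
  set g := f - g₁ + h • g₂ with hg
  have hgE : g ∈ A.E := A.E.add_mem (A.E.sub_mem hf hg₁E) (A.E.smul_mem _ hg₂E)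
  obtain ⟨w, hw⟩ := A.surjective g
  have hwE : w ∈ A.E := (A.P_mem_iff w).1 (hw ▸ hgE)
  have hlim : Tendsto (fun i => F (φ i) - A.G (v (φ i)) + μ (φ i) • A.S (v (φ i))) atTop (𝓝 g) :=
    ((hF.comp hφ.tendsto_atTop).sub hG).add ((hμ.comp hφ.tendsto_atTop).smul hS)
  have hPv : ∀ i, (V (N (φ i))).starProjection (A.P (v (φ i))) =
      (V (N (φ i))).starProjection (F (φ i) - A.G (v (φ i)) + μ (φ i) • A.S (v (φ i))) := by
    intro i
    have := heq (φ i)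
    rw [A.T_apply] at this
    simp only [map_add, map_sub] at this ⊢
    rw [← this]; abel
  set Qw : ℕ → H := fun i => (V (N (φ i))).starProjection w with hQw
  have hQwlim : Tendsto Qw atTop (𝓝 w) := (hV.tendsto w hwE).comp hNφ
  have hdiff : Tendsto (fun i => (V (N (φ i))).starProjection (A.P (v (φ i))) -
      (V (N (φ i))).starProjection (A.P (Qw i))) atTop (𝓝 0) := by
    have h1 := hV.tendsto_of_tendsto hNφ hgE hlim
    have h2 := hV.tendsto_of_tendsto hNφ (hw ▸ hgE : A.P w ∈ A.E)
      ((A.P.continuous.tendsto w).comp hQwlim)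
    rw [hw] at h2
    have h3 := h1.sub h2
    rw [sub_self] at h3
    refine h3.congr fun i => ?_
    simp only [Function.comp_apply, hPv]
  -- Céa's argument: v and the projection of w both lie in the subspace, so their difference may be
  -- used as its own test vector in the coercivity estimate.
  have hbound : ∀ i, ‖v (φ i) - Qw i‖ ≤ A.c⁻¹ * ‖(V (N (φ i))).starProjection (A.P (v (φ i))) -
      (V (N (φ i))).starProjection (A.P (Qw i))‖ := by
    intro i
    set U := V (N (φ i))
    set d := v (φ i) - Qw i with hd
    have hdU : d ∈ U := U.sub_mem (hv _) (Submodule.starProjection_apply_mem _ _)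
    have h1 := A.coercive d
    have h2 : inner ℂ d (A.P d) =
        inner ℂ d (U.starProjection (A.P (v (φ i))) - U.starProjection (A.P (Qw i))) := by
      rw [← map_sub, ← map_sub, ← Submodule.inner_starProjection_left_eq_right,
        Submodule.starProjection_eq_self_iff.2 hdU]
    have h3 : (inner ℂ d (A.P d)).re ≤ ‖d‖ *
        ‖U.starProjection (A.P (v (φ i))) - U.starProjection (A.P (Qw i))‖ := by
      rw [h2]
      exact (Complex.re_le_norm _).trans (norm_inner_le_norm _ _)
    rw [inv_mul_eq_div, le_div_iff₀ A.c_pos]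
    rcases (norm_nonneg d).eq_or_lt with h0 | h0
    · rw [← h0, zero_mul]; exact norm_nonneg _
    · nlinarith
  have hconv : Tendsto (fun i => v (φ i) - Qw i) atTop (𝓝 0) := by
    refine squeeze_zero_norm hbound ?_
    have := hdiff.norm.const_mul A.c⁻¹
    simpa using this
  have hvlim : Tendsto (v ∘ φ) atTop (𝓝 w) := by
    have := hconv.add hQwlim
    simpa [Function.comp_def] using this
  refine ⟨φ, hφ, w, hwE, hvlim, ?_⟩
  have e1 : A.G w = g₁ := tendsto_nhds_unique ((A.G.continuous.tendsto w).comp hvlim) hG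
  have e2 : A.S w = g₂ := tendsto_nhds_unique ((A.S.continuous.tendsto w).comp hvlim) hS
  rw [A.T_apply, hw, e1, e2, hg]; abel

/-- `h` is an eigenvalue of the pencil on `E`. -/
def CompactPencil.IsEigenvalue (A : CompactPencil H) (h : ℂ) : Prop :=
  ∃ v ∈ A.E, v ≠ 0 ∧ A.T h v = 0

/-- `h` is an eigenvalue of the pencil projected to the subspace `U`. -/
def CompactPencil.IsProjEigenvalue (A : CompactPencil H) (U : Submodule ℂ H)
    [U.HasOrthogonalProjection] (h : ℂ) : Prop :=
  ∃ v ∈ U, v ≠ 0 ∧ U.starProjection (A.T h v) = 0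

/-- If the projected equations are not uniformly solvable along a sequence of parameters converging
to `h`, then `h` is an eigenvalue. -/
theorem CompactPencil.isEigenvalue_of_tendsto (A : CompactPencil H) (hV : IsApproximating A.E V)
    {N : ℕ → ℕ} (hN : Tendsto N atTop atTop) {μ : ℕ → ℂ} {h : ℂ} (hμ : Tendsto μ atTop (𝓝 h))
    {v : ℕ → H} (hv : ∀ i, v i ∈ V (N i)) (hv1 : ∀ i, ‖v i‖ = 1)
    (heq : Tendsto (fun i => (V (N i)).starProjection (A.T (μ i) (v i))) atTop (𝓝 0)) :
    A.IsEigenvalue h := by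
  obtain ⟨φ, -, w, hwE, hw, hTw⟩ := A.exists_subseq_tendsto hV hN hμ hv (R := 1)
    (fun i => (hv1 i).le) A.E.zero_mem heq
    (fun i => (Submodule.starProjection_eq_self_iff.2 (Submodule.starProjection_apply_mem _ _)).symm)
  refine ⟨w, hwE, ?_, hTw⟩
  have : Tendsto (fun i => ‖v (φ i)‖) atTop (𝓝 ‖w‖) := hw.norm
  simp only [hv1] at this
  have := tendsto_nhds_unique this tendsto_const_nhds
  intro h0
  simp [h0] at this

/-- Limits of eigenvalues of the projected pencils are eigenvalues. -/
theorem CompactPencil.isEigenvalue_of_tendsto_isProjEigenvalue (A : CompactPencil H)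
    (hV : IsApproximating A.E V) {N : ℕ → ℕ} (hN : Tendsto N atTop atTop) {μ : ℕ → ℂ} {h : ℂ}
    (hμ : Tendsto μ atTop (𝓝 h)) (hev : ∀ i, A.IsProjEigenvalue (V (N i)) (μ i)) :
    A.IsEigenvalue h := by
  choose v hv hv0 hTv using hev
  refine A.isEigenvalue_of_tendsto hV hN hμ (v := fun i => ((‖v i‖⁻¹ : ℝ) : ℂ) • v i)
    (fun i => (V (N i)).smul_mem _ (hv i)) (fun i => ?_) ?_
  · rw [norm_smul, Complex.norm_real, norm_inv, norm_norm, inv_mul_cancel₀ (norm_ne_zero_iff.2 (hv0 i))]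
  · simp only [map_smul, hTv, smul_zero]
    exact tendsto_const_nhds

/-- The pencil has no generalized eigenvectors at `h` beyond a single eigenvector. -/
def CompactPencil.IsSimpleAt (A : CompactPencil H) (h : ℂ) : Prop :=
  ∀ v₁ ∈ A.E, ∀ v₂ ∈ A.E, ∀ κ : ℂ, v₁ ≠ 0 → A.T h v₁ = 0 → A.T h v₂ = κ • A.S v₁ →
    κ = 0 ∧ ∃ r : ℂ, v₂ = r • v₁

/-- There is no sequence of orthonormal chains of the projected pencils at parameters converging
to a simple point. -/
theorem CompactPencil.IsSimpleAt.false_of_orthonormal {A : CompactPencil H} {h : ℂ}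
    (hs : A.IsSimpleAt h) (hV : IsApproximating A.E V)
    {N : ℕ → ℕ} (hN : Tendsto N atTop atTop) {μ ν : ℕ → ℂ} (hμ : Tendsto μ atTop (𝓝 h))
    (hν : Tendsto ν atTop (𝓝 h)) {v w : ℕ → H} (hv : ∀ i, v i ∈ V (N i)) (hw : ∀ i, w i ∈ V (N i))
    (hv1 : ∀ i, ‖v i‖ = 1) (hw1 : ∀ i, ‖w i‖ = 1) (hvw : ∀ i, inner ℂ (v i) (w i) = 0)
    (hTv : ∀ i, (V (N i)).starProjection (A.T (μ i) (v i)) = 0) {κ : ℕ → ℂ}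
    (hTw : ∀ i, (V (N i)).starProjection (A.T (ν i) (w i)) =
      κ i • (V (N i)).starProjection (A.S (v i))) : False := by
  obtain ⟨φ, hφ, v', hv'E, hv', hTv'⟩ := A.exists_subseq_tendsto hV hN hμ hv (R := 1)
    (fun i => (hv1 i).le) A.E.zero_mem (F := fun _ => 0) tendsto_const_nhds (by simpa using hTv)
  have hv'0 : v' ≠ 0 := by
    have : Tendsto (fun i => ‖v (φ i)‖) atTop (𝓝 ‖v'‖) := hv'.norm
    simp only [hv1] at this
    have := tendsto_nhds_unique this tendsto_const_nhds
    intro h0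
    simp [h0] at this
  have hNφ := hN.comp hφ.tendsto_atTop
  have hSv : Tendsto (fun i => A.S (v (φ i))) atTop (𝓝 (A.S v')) :=
    (A.S.continuous.tendsto v').comp hv'
  -- The multipliers κ need not be bounded. If they are bounded infinitely often, a limit chain
  -- exists at h: simplicity makes the limit of w a multiple of that of v, which contradicts
  -- orthogonality. Otherwise w is divided by κ, and the limit solves T w' = S v', a chain with
  -- multiplier 1, which simplicity forbids.
  by_cases hκ : ∃ᶠ i in atTop, ‖κ (φ i)‖ ≤ 1
  · obtain ⟨κ', -, ψ₀, hψ₀, hκ'⟩ := tendsto_subseq_of_frequently_bounded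
      (Metric.isBounded_closedBall (x := (0 : ℂ)) (r := 1)) (x := fun i => κ (φ i))
      (by simpa using hκ)
    obtain ⟨ψ, hψ, w', hw'E, hw', hTw'⟩ := A.exists_subseq_tendsto hV
      (hNφ.comp hψ₀.tendsto_atTop) ((hν.comp hφ.tendsto_atTop).comp hψ₀.tendsto_atTop)
      (v := fun i => w (φ (ψ₀ i))) (fun i => hw _) (R := 1) (fun i => (hw1 _).le)
      (F := fun i => κ (φ (ψ₀ i)) • A.S (v (φ (ψ₀ i)))) (f := κ' • A.S v')
      (A.E.smul_mem _ (A.S_mem _ hv'E)) (hκ'.smul (hSv.comp hψ₀.tendsto_atTop))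
      (fun i => by simp [hTw])
    obtain ⟨-, r, hr⟩ := hs v' hv'E w' hw'E κ' hv'0 hTv' hTw'
    have h1 : Tendsto (fun i => inner ℂ (v (φ (ψ₀ (ψ i)))) (w (φ (ψ₀ (ψ i))))) atTop
        (𝓝 (inner ℂ v' w')) :=
      ((hv'.comp hψ₀.tendsto_atTop).comp hψ.tendsto_atTop).inner hw'
    simp only [hvw] at h1
    have h2 := tendsto_nhds_unique h1 tendsto_const_nhds
    rw [hr, inner_smul_right, mul_eq_zero, inner_self_eq_zero] at h2
    have h3 : w' = 0 := by
      rcases h2 with h2 | h2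
      · simp [hr, h2]
      · exact absurd h2 hv'0
    have h4 : Tendsto (fun i => ‖w (φ (ψ₀ (ψ i)))‖) atTop (𝓝 ‖w'‖) := hw'.norm
    simp only [hw1, h3, norm_zero] at h4
    exact one_ne_zero (tendsto_nhds_unique h4 tendsto_const_nhds).symm
  · rw [not_frequently] at hκ
    obtain ⟨i₀, hi₀⟩ := eventually_atTop.1 hκ
    have hκ1 : ∀ i, 1 < ‖κ (φ (i + i₀))‖ := fun i => not_le.1 (hi₀ _ (Nat.le_add_left _ _))
    have hsh : Tendsto (fun i : ℕ => i + i₀) atTop atTop := tendsto_add_atTop_nat i₀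
    obtain ⟨ψ, hψ, w', hw'E, hw', hTw'⟩ := A.exists_subseq_tendsto hV
      (hNφ.comp hsh) ((hν.comp hφ.tendsto_atTop).comp hsh)
      (v := fun i => (κ (φ (i + i₀)))⁻¹ • w (φ (i + i₀)))
      (fun i => (V _).smul_mem _ (hw _)) (R := 1)
      (fun i => by
        rw [norm_smul, hw1, mul_one, norm_inv]
        exact inv_le_one_of_one_le₀ (hκ1 i).le)
      (F := fun i => A.S (v (φ (i + i₀)))) (f := A.S v')
      (A.S_mem _ hv'E) (hSv.comp hsh)
      (fun i => by
        have : κ (φ (i + i₀)) ≠ 0 := norm_pos_iff.1 (zero_lt_one.trans (hκ1 i))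
        simp [hTw, smul_smul, this])
    have := (hs v' hv'E w' hw'E 1 hv'0 hTv' (by rw [hTw', one_smul])).1
    exact one_ne_zero this

/-- Near a simple point the projected pencils have no chains of two independent vectors. -/
theorem CompactPencil.IsSimpleAt.exists_ball {A : CompactPencil H} {h : ℂ}
    (hs : A.IsSimpleAt h) (hV : IsApproximating A.E V) :
    ∃ ε > 0, ∃ N₀, ∀ N ≥ N₀, ∀ μ ∈ Metric.ball h ε, ∀ ν ∈ Metric.ball h ε,
      ∀ v ∈ V N, ∀ w ∈ V N, ∀ κ : ℂ, v ≠ 0 → (V N).starProjection (A.T μ v) = 0 →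
      (V N).starProjection (A.T ν w) = κ • (V N).starProjection (A.S v) → ∃ r : ℂ, w = r • v := by
  by_contra hcon
  push Not at hcon
  choose N hN μ hμ ν hν v hv w hw κ hv0 hTv hTw hindep using
    fun i : ℕ => hcon (1 / ((i : ℝ) + 1)) (by positivity) i
  have hlim : ∀ {μ : ℕ → ℂ}, (∀ i : ℕ, μ i ∈ Metric.ball h (1 / ((i : ℝ) + 1))) →
      Tendsto μ atTop (𝓝 h) := fun hμ => by
    rw [tendsto_iff_dist_tendsto_zero]
    exact squeeze_zero (fun _ => dist_nonneg) (fun i => (Metric.mem_ball.1 (hμ i)).le)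
      tendsto_one_div_add_atTop_nhds_zero_nat
  set v' : ℕ → H := fun i => ((‖v i‖⁻¹ : ℝ) : ℂ) • v i with hv'
  -- A Gram–Schmidt step. Moving the parameter from μ to ν changes T v' only by (μ - ν) S v', so
  -- subtracting a multiple of v' from w alters nothing but the multiplier.
  set w' : ℕ → H := fun i => w i - inner ℂ (v' i) (w i) • v' i with hw'
  have hnv' : ∀ i, ‖v' i‖ = 1 := fun i => by
    rw [hv', norm_smul, Complex.norm_real, norm_inv, norm_norm,
      inv_mul_cancel₀ (norm_ne_zero_iff.2 (hv0 i))]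
  have hw'0 : ∀ i, w' i ≠ 0 := fun i h0 => by
    refine hindep i (inner ℂ (v' i) (w i) * ((‖v i‖⁻¹ : ℝ) : ℂ)) ?_
    rw [mul_smul]
    exact sub_eq_zero.1 h0
  have hTv' : ∀ i, (V (N i)).starProjection (A.T (μ i) (v' i)) = 0 := fun i => by
    simp [hv', hTv]
  have hSv : ∀ i, A.S (v i) = (‖v i‖ : ℂ) • A.S (v' i) := fun i => by
    have : (‖v i‖ : ℂ) ≠ 0 := by exact_mod_cast norm_ne_zero_iff.2 (hv0 i)
    simp [hv', smul_smul, this]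
  set κ' : ℕ → ℂ := fun i => κ i * ‖v i‖ - inner ℂ (v' i) (w i) * (μ i - ν i) with hκ'
  have hTw' : ∀ i, (V (N i)).starProjection (A.T (ν i) (w' i)) =
      κ' i • (V (N i)).starProjection (A.S (v' i)) := fun i => by
    simp only [hw', map_sub, map_smul, hTw, hSv, A.T_sub_T (μ i) (ν i) (v' i), map_add, hTv',
      zero_add, smul_smul, hκ', sub_smul, mul_sub, smul_sub]
  refine hs.false_of_orthonormal hV (N := N) (tendsto_atTop_mono hN tendsto_id) (hlim hμ) (hlim hν)
    (v := v') (w := fun i => ((‖w' i‖⁻¹ : ℝ) : ℂ) • w' i) (fun i => (V _).smul_mem _ (hv i))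
    (fun i => (V _).smul_mem _ ((V _).sub_mem (hw i) ((V _).smul_mem _ ((V _).smul_mem _ (hv i)))))
    hnv' (fun i => ?_) (fun i => ?_) hTv' (κ := fun i => ((‖w' i‖⁻¹ : ℝ) : ℂ) * κ' i) (fun i => ?_)
  · rw [norm_smul, Complex.norm_real, norm_inv, norm_norm,
      inv_mul_cancel₀ (norm_ne_zero_iff.2 (hw'0 i))]
  · rw [inner_smul_right, hw', inner_sub_right, inner_smul_right, inner_self_eq_norm_sq_to_K, hnv']
    simp
  · rw [map_smul, map_smul, hTw', mul_smul]

/-- Eigenvalues that are simple points are isolated. -/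
theorem CompactPencil.IsSimpleAt.exists_isolating [CompleteSpace H] {A : CompactPencil H} {h : ℂ}
    (hs : A.IsSimpleAt h) (hh : A.IsEigenvalue h) :
    ∃ ε > 0, ∀ μ ∈ Metric.ball h ε, A.IsEigenvalue μ → μ = h := by
  have : CompleteSpace A.E := A.isClosed_E.completeSpace_coe
  -- The constant family E is itself approximating, which turns the statement on projected pencils
  -- into one on the pencil.
  have hV : IsApproximating A.E (fun _ : ℕ => A.E) :=
    ⟨fun _ => le_rfl, fun x hx => by
      simp only [Submodule.starProjection_eq_self_iff.2 hx]; exact tendsto_const_nhds⟩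
  obtain ⟨ε, hε, N₀, hN₀⟩ := hs.exists_ball hV
  refine ⟨ε, hε, fun μ hμ ⟨w, hw, hw0, hTw⟩ => ?_⟩
  obtain ⟨v, hv, hv0, hTv⟩ := hh
  obtain ⟨r, hr⟩ := hN₀ N₀ le_rfl h (Metric.mem_ball_self hε) μ hμ v hv w hw 0 hv0
    (by rw [hTv, map_zero]) (by rw [hTw, map_zero, zero_smul])
  by_contra hne
  have hr0 : r ≠ 0 := fun h0 => hw0 (by rw [hr, h0, zero_smul])
  rw [hr, map_smul, smul_eq_zero, A.T_sub_T h μ v, hTv, zero_add, smul_eq_zero, sub_eq_zero] at hTw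
  rcases hTw with h1 | h1 | h1
  · exact hr0 h1
  · exact hne h1.symm
  · have := (hs v hv 0 A.E.zero_mem 1 hv0 hTv (by rw [map_zero, h1, smul_zero])).1
    exact one_ne_zero this

/-- Uniform solvability of the projected equations on compact sets free of eigenvalues. -/
theorem CompactPencil.exists_uniform_bound (A : CompactPencil H) (hV : IsApproximating A.E V)
    {K : Set ℂ} (hK : IsCompact K) (hKe : ∀ h ∈ K, ¬ A.IsEigenvalue h) :
    ∃ C : ℝ, ∃ N₀, ∀ N ≥ N₀, ∀ h ∈ K, ∀ v ∈ V N,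
      ‖v‖ ≤ C * ‖(V N).starProjection (A.T h v)‖ := by
  by_contra hcon
  push Not at hcon
  choose N hN μ hμ v hv hlt using fun i : ℕ => hcon ((i : ℝ) + 1) i
  obtain ⟨h, hhK, φ, hφ, hlim⟩ := hK.tendsto_subseq hμ
  have hv0 : ∀ i, 0 < ‖v i‖ := fun i => lt_of_le_of_lt (by positivity) (hlt i)
  refine hKe h hhK (A.isEigenvalue_of_tendsto hV
    ((tendsto_atTop_mono hN tendsto_id).comp hφ.tendsto_atTop) hlim
    (v := fun i => ((‖v (φ i)‖⁻¹ : ℝ) : ℂ) • v (φ i)) (fun i => (V _).smul_mem _ (hv _))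
    (fun i => ?_) ?_)
  · rw [norm_smul, Complex.norm_real, norm_inv, norm_norm, inv_mul_cancel₀ (hv0 _).ne']
  · refine squeeze_zero_norm (fun i => ?_)
      ((tendsto_one_div_add_atTop_nhds_zero_nat (𝕜 := ℝ)).comp hφ.tendsto_atTop)
    simp only [map_smul, norm_smul, Complex.norm_real, norm_inv, norm_norm, Function.comp_apply]
    rw [inv_mul_le_iff₀ (hv0 _), mul_one_div, le_div_iff₀ (by positivity), mul_comm]
    exact (hlt _).le

/-- If a pencil of operators on a finite-dimensional space is invertible on a disk, then a bound for
the inverses on a concentric circle holds at the center. -/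
theorem norm_le_of_forall_sphere {U : Type*} [NormedAddCommGroup U] [NormedSpace ℂ U]
    [FiniteDimensional ℂ U] (X Y : U →L[ℂ] U) {h : ℂ} {ρ ε : ℝ} (hρ : 0 < ρ) (hρε : ρ < ε)
    (hinj : ∀ μ ∈ Metric.ball h ε, ∀ x, X x - μ • Y x = 0 → x = 0) {C : ℝ}
    (hC : ∀ μ ∈ Metric.sphere h ρ, ∀ x, ‖x‖ ≤ C * ‖X x - μ • Y x‖) (x₀ : U) :
    ‖x₀‖ ≤ C * ‖X x₀ - h • Y x₀‖ := by
  have : CompleteSpace U := FiniteDimensional.complete ℂ U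
  let M : ℂ → (U →L[ℂ] U) := fun μ => X - μ • Y
  have hunit : ∀ μ ∈ Metric.ball h ε, IsUnit (M μ) := fun μ hμ => by
    rw [ContinuousLinearMap.isUnit_iff_bijective]
    have hinj' : Function.Injective (M μ) := by
      rw [injective_iff_map_eq_zero]
      exact fun x hx => hinj μ hμ x hx
    exact ⟨hinj', LinearMap.injective_iff_surjective (f := (M μ : U →ₗ[ℂ] U)).1 hinj'⟩
  have hMd : Differentiable ℂ M :=
    (differentiable_const _).sub (differentiable_id.smul_const Y)
  -- The curve M(μ)⁻¹ M(h) x₀ is holomorphic and passes through x₀ at μ = h; the maximum principle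
  -- bounds this value by those on the circle.
  let y : ℂ → U := fun μ => Ring.inverse (M μ) (M h x₀)
  have hMy : ∀ μ ∈ Metric.ball h ε, M μ (y μ) = M h x₀ := fun μ hμ => by
    change (M μ * Ring.inverse (M μ)) (M h x₀) = M h x₀
    rw [Ring.mul_inverse_cancel _ (hunit μ hμ)]; rfl
  have hyh : y h = x₀ := by
    change (Ring.inverse (M h) * M h) x₀ = x₀
    rw [Ring.inverse_mul_cancel _ (hunit h (Metric.mem_ball_self (hρ.trans hρε)))]; rfl
  have hsub : Metric.closedBall h ρ ⊆ Metric.ball h ε := Metric.closedBall_subset_ball hρε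
  have hyd : DiffContOnCl ℂ y (Metric.ball h ρ) := by
    refine DifferentiableOn.diffContOnCl fun μ hμ => ?_
    rw [closure_ball h hρ.ne'] at hμ
    have h1 : DifferentiableAt ℂ (fun μ => Ring.inverse (M μ)) μ :=
      (differentiableAt_inverse (𝕜 := ℂ) (hunit μ (hsub hμ))).comp μ (hMd μ)
    exact (h1.clm_apply (differentiableAt_const _)).differentiableWithinAt
  have hfin := Complex.norm_le_of_forall_mem_frontier_norm_le Metric.isBounded_ball hyd
    (C := C * ‖M h x₀‖) (fun z hz => by
      rw [frontier_ball h hρ.ne'] at hz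
      have h1 := hC z hz (y z)
      rw [show X (y z) - z • Y (y z) = M h x₀ from
        hMy z (hsub (Metric.sphere_subset_closedBall hz))] at h1
      exact h1) (subset_closure (Metric.mem_ball_self hρ))
  rwa [hyh] at hfin

/-- Every eigenvalue that is isolated is approximated by eigenvalues of the projected pencils. -/
theorem CompactPencil.eventually_exists_isProjEigenvalue (A : CompactPencil H)
    [∀ N, FiniteDimensional ℂ (V N)] (hV : IsApproximating A.E V) {h : ℂ} (hh : A.IsEigenvalue h)
    {r : ℝ} (hr : 0 < r) (hiso : ∀ μ ∈ Metric.ball h r, A.IsEigenvalue μ → μ = h)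
    {ε : ℝ} (hε : 0 < ε) :
    ∀ᶠ N in atTop, ∃ μ ∈ Metric.ball h ε, A.IsProjEigenvalue (V N) μ := by
  by_contra hcon
  rw [not_eventually] at hcon
  -- The radius lies below r, so the circle is free of eigenvalues, and below ε, so the assumed
  -- absence of projected eigenvalues covers the closed disk.
  obtain ⟨ρ, hρ, hρr⟩ := exists_between (lt_min hr hε)
  obtain ⟨w, hwE, hw0, hTw⟩ := hh
  obtain ⟨C, N₀, hC⟩ := A.exists_uniform_bound hV (isCompact_sphere h ρ) (fun μ hμ hev => by
    have h1 : dist μ h = ρ := hμ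
    have := hiso μ (by rw [Metric.mem_ball, h1]; exact hρr.trans_le (min_le_left _ _)) hev
    rw [this, dist_self] at h1
    exact hρ.ne h1)
  -- Without projected eigenvalues in the disk, the resolvent bound on the circle extends to the
  -- centre h. Applied to the projections of the eigenvector w it fails in the limit: the left side
  -- tends to ‖w‖ > 0, the right side to 0.
  have hstep : ∃ᶠ N in atTop, ‖(V N).starProjection w‖ ≤
      C * ‖(V N).starProjection (A.T h ((V N).starProjection w))‖ := by
    refine (hcon.and_eventually (eventually_ge_atTop N₀)).mono fun N ⟨hN, hNN⟩ => ?_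
    push Not at hN
    set U := V N with hU
    let comp : (H →L[ℂ] H) → (U →L[ℂ] U) := fun X => U.orthogonalProjectionOnto ∘L X ∘L U.subtypeL
    have hcomp : ∀ X x, ((comp X x : U) : H) = U.starProjection (X x) := fun X x => rfl
    have hM : ∀ μ (x : U), ((comp (A.P + A.G) x - μ • comp A.S x : U) : H) =
        U.starProjection (A.T μ x) := fun μ x => by simp [hcomp, A.T_apply]
    have hMn : ∀ μ (x : U), ‖comp (A.P + A.G) x - μ • comp A.S x‖ =
        ‖U.starProjection (A.T μ x)‖ := fun μ x => by rw [← hM]; rfl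
    have := norm_le_of_forall_sphere (comp (A.P + A.G)) (comp A.S) hρ
      (hρr.trans_le (min_le_right _ _)) (h := h) (C := C)
      (fun μ hμ x hx => by
        by_contra hx0
        refine hN μ hμ ⟨x, x.2, fun h0 => hx0 (Subtype.ext h0), ?_⟩
        rw [← hM, hx]; rfl)
      (fun μ hμ x => by rw [hMn]; exact hC N hNN μ hμ x x.2) (U.orthogonalProjectionOnto w)
    rw [hMn] at this
    exact this
  have hQw := hV.tendsto w hwE
  have hlim := hV.tendsto_of_tendsto tendsto_id (hTw ▸ A.T_mem h hwE : A.T h w ∈ A.E)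
    (((A.T h).continuous.tendsto w).comp hQw)
  rw [hTw] at hlim
  have hpos : 0 < ‖w‖ := norm_pos_iff.2 hw0
  have hev : ∀ᶠ N in atTop, C * ‖(V N).starProjection (A.T h ((V N).starProjection w))‖ <
      ‖(V N).starProjection w‖ := by
    have h1 := hlim.norm.const_mul C
    rw [norm_zero, mul_zero] at h1
    exact h1.eventually_lt hQw.norm hpos
  obtain ⟨N, hN1, hN2⟩ := (hstep.and_eventually hev).exists
  exact absurd hN1 (not_le.2 hN2)

end Abstract

/-! ### Operators on square summable sequences -/

/-- Square summable two-sided complex sequences. -/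
abbrev Ell2 := lp (fun _ : ℤ => ℂ) 2

theorem memℓp_two_iff {x : ℤ → ℂ} : Memℓp x 2 ↔ Summable fun n => ‖x n‖ ^ 2 := by
  rw [memℓp_gen_iff (by norm_num)]
  norm_num

theorem Ell2.summable_sq (x : Ell2) : Summable fun n => ‖x n‖ ^ 2 :=
  memℓp_two_iff.1 (lp.memℓp x)

theorem Ell2.norm_sq (x : Ell2) : ‖x‖ ^ 2 = ∑' n, ‖x n‖ ^ 2 := by
  have := lp.norm_rpow_eq_tsum (p := 2) (by norm_num) x
  norm_num at this
  exact_mod_cast this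

theorem Ell2.norm_le_of_forall {x y : Ell2} {C : ℝ} (hC : 0 ≤ C) (h : ∀ n, ‖x n‖ ≤ C * ‖y n‖) :
    ‖x‖ ≤ C * ‖y‖ := by
  refine (sq_le_sq₀ (norm_nonneg _) (by positivity)).1 ?_
  rw [mul_pow, Ell2.norm_sq, Ell2.norm_sq, ← tsum_mul_left]
  refine (Ell2.summable_sq x).tsum_le_tsum (fun n => ?_) ((Ell2.summable_sq y).mul_left _)
  rw [← mul_pow]
  exact pow_le_pow_left₀ (norm_nonneg _) (h n) 2

/-- Composition with a permutation of the indices. -/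
def compL (e : ℤ ≃ ℤ) : Ell2 →L[ℂ] Ell2 :=
  LinearMap.mkContinuous
    { toFun := fun x => ⟨fun n => x (e n), memℓp_two_iff.2 ((Ell2.summable_sq x).comp_injective e.injective)⟩
      map_add' := fun _ _ => rfl
      map_smul' := fun _ _ => rfl } 1 fun x => by
    rw [one_mul]
    refine (sq_le_sq₀ (norm_nonneg _) (norm_nonneg _)).1 ?_
    rw [Ell2.norm_sq, Ell2.norm_sq]
    exact (e.tsum_eq fun n => ‖x n‖ ^ 2).le

@[simp] theorem compL_apply (e : ℤ ≃ ℤ) (x : Ell2) (n : ℤ) : compL e x n = x (e n) := rfl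

theorem norm_compL_apply_le (e : ℤ ≃ ℤ) (x : Ell2) : ‖compL e x‖ ≤ ‖x‖ := by
  have := (compL e).le_of_opNorm_le (LinearMap.mkContinuous_norm_le _ zero_le_one _) x
  rwa [one_mul] at this

theorem Ell2.inner_eq (x y : Ell2) : inner ℂ x y = ∑' n, y n * (starRingEnd ℂ) (x n) := by
  rw [lp.inner_eq_tsum]
  rfl

theorem inner_compL_left (e : ℤ ≃ ℤ) (x y : Ell2) :
    inner ℂ (compL e x) y = inner ℂ x (compL e.symm y) := by
  rw [Ell2.inner_eq, Ell2.inner_eq, ← e.tsum_eq (fun n => (compL e.symm y) n * _)]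
  simp

/-- Multiplication by a bounded sequence. -/
def diagL (d : ℤ → ℂ) (hd : ∀ n, ‖d n‖ ≤ 1) : Ell2 →L[ℂ] Ell2 :=
  LinearMap.mkContinuous
    { toFun := fun x => ⟨fun n => d n * x n, memℓp_two_iff.2 ((Ell2.summable_sq x).of_nonneg_of_le
        (fun _ => by positivity) fun n => by
          rw [norm_mul]
          gcongr
          exact mul_le_of_le_one_left (norm_nonneg _) (hd n))⟩
      map_add' := fun x y => by ext n; exact mul_add _ _ _
      map_smul' := fun c x => by ext n; exact mul_left_comm _ _ _ } 1 fun x =>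
    Ell2.norm_le_of_forall zero_le_one fun n => by
      rw [one_mul]
      change ‖d n * x n‖ ≤ _
      rw [norm_mul]
      exact mul_le_of_le_one_left (norm_nonneg _) (hd n)

@[simp] theorem diagL_apply (d : ℤ → ℂ) (hd : ∀ n, ‖d n‖ ≤ 1) (x : Ell2) (n : ℤ) :
    diagL d hd x n = d n * x n := rfl

/-- A finite section of a multiplication operator. -/
def diagSection (d : ℤ → ℂ) (s : Finset ℤ) : Ell2 →L[ℂ] Ell2 :=
  ∑ n ∈ s, (innerSL ℂ (lp.single 2 n (1 : ℂ))).smulRight (lp.single 2 n (d n))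

theorem diagSection_apply (d : ℤ → ℂ) (s : Finset ℤ) (x : Ell2) (n : ℤ) :
    diagSection d s x n = if n ∈ s then d n * x n else 0 := by
  simp only [diagSection, sum_apply, ContinuousLinearMap.smulRight_apply,
    innerSL_apply_apply, lp.inner_single_left, lp.coeFn_sum, Finset.sum_apply, lp.coeFn_smul,
    Pi.smul_apply, lp.single_apply, smul_eq_mul]
  by_cases hn : n ∈ s
  · rw [Finset.sum_eq_single_of_mem n hn]
    · simp [hn, mul_comm]
    · intro m _ hmn
      simp [hmn.symm]
  · rw [if_neg hn]
    refine Finset.sum_eq_zero fun m hm => ?_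
    have : n ≠ m := fun h => hn (h ▸ hm)
    simp [this]

theorem isCompactOperator_smulRight (f : Ell2 →L[ℂ] ℂ) (y : Ell2) :
    IsCompactOperator (f.smulRight y) := by
  have h : IsCompactOperator f := isCompactOperator_of_locallyCompactSpace_dom f
  exact h.clm_comp (ContinuousLinearMap.toSpanSingleton ℂ y)

theorem isCompactOperator_diagSection (d : ℤ → ℂ) (s : Finset ℤ) :
    IsCompactOperator (diagSection d s) := by
  classical
  induction s using Finset.induction_on with
  | empty => simpa [diagSection] using isCompactOperator_zero
  | insert n s hn ih =>
    rw [diagSection, Finset.sum_insert hn]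
    refine IsCompactOperator.add ?_ ih
    exact isCompactOperator_smulRight _ _

/-- Multiplication by a null sequence is compact. -/
theorem isCompactOperator_diagL {d : ℤ → ℂ} (hd : ∀ n, ‖d n‖ ≤ 1)
    (hd0 : Tendsto d cofinite (𝓝 0)) : IsCompactOperator (diagL d hd) := by
  -- Finite sections have finite rank and converge in operator norm, because only finitely many
  -- multipliers have modulus ε/2 or more.
  refine isCompactOperator_of_tendsto (F := fun s : Finset ℤ => diagSection d s) (l := atTop) ?_
    (Eventually.of_forall fun s => isCompactOperator_diagSection d s)
  rw [tendsto_iff_norm_sub_tendsto_zero, Metric.tendsto_atTop]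
  intro ε hε
  have hfin : {n | ¬ ‖d n‖ < ε / 2}.Finite := by
    have := hd0.norm.eventually (gt_mem_nhds (by rw [norm_zero]; positivity : ‖(0 : ℂ)‖ < ε / 2))
    exact eventually_cofinite.1 this
  refine ⟨hfin.toFinset, fun s hs => ?_⟩
  rw [Real.dist_eq, sub_zero, abs_norm]
  refine lt_of_le_of_lt (ContinuousLinearMap.opNorm_le_bound _ (by positivity : 0 ≤ ε / 2)
    fun x => ?_) (by linarith)
  refine Ell2.norm_le_of_forall (by positivity) fun n => ?_
  rw [sub_apply, lp.coeFn_sub, Pi.sub_apply, diagSection_apply, diagL_apply]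
  by_cases hn : n ∈ s
  · rw [if_pos hn, sub_self, norm_zero]; positivity
  · rw [if_neg hn, zero_sub, norm_neg, norm_mul]
    gcongr
    by_contra hlt
    exact hn (hs (hfin.mem_toFinset.2 fun h => hlt h.le))

/-! ### The operator pencil in Fourier coordinates -/

/-- The shift `e n ↦ e (n + 1)`. -/
def shiftR : Ell2 →L[ℂ] Ell2 := compL (Equiv.subRight 1)

/-- The shift `e n ↦ e (n - 1)`. -/
def shiftL : Ell2 →L[ℂ] Ell2 := compL (Equiv.addRight 1)

/-- The reflection `e n ↦ e (-n)`. -/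
def reflL : Ell2 →L[ℂ] Ell2 := compL (Equiv.neg ℤ)

@[simp] theorem shiftR_apply (x : Ell2) (n : ℤ) : shiftR x n = x (n - 1) := rfl
@[simp] theorem shiftL_apply (x : Ell2) (n : ℤ) : shiftL x n = x (n + 1) := rfl
@[simp] theorem reflL_apply (x : Ell2) (n : ℤ) : reflL x n = x (-n) := rfl

/-- Multiplication by `cos (2 τ)` in Fourier coordinates. -/
def cosL : Ell2 →L[ℂ] Ell2 := (1 / 2 : ℂ) • (shiftR + shiftL)

theorem norm_shiftR_apply_le (x : Ell2) : ‖shiftR x‖ ≤ ‖x‖ := norm_compL_apply_le _ _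
theorem norm_shiftL_apply_le (x : Ell2) : ‖shiftL x‖ ≤ ‖x‖ := norm_compL_apply_le _ _

theorem norm_cosL_apply_le (x : Ell2) : ‖cosL x‖ ≤ ‖x‖ := by
  have h1 := norm_shiftR_apply_le x
  have h2 := norm_shiftL_apply_le x
  have h3 : ‖cosL x‖ = 1 / 2 * ‖shiftR x + shiftL x‖ := by
    rw [show cosL x = (1 / 2 : ℂ) • (shiftR x + shiftL x) from rfl, norm_smul]; norm_num
  have h4 := norm_add_le (shiftR x) (shiftL x)
  rw [h3]; linarith

theorem inner_shiftR_left (x y : Ell2) : inner ℂ (shiftR x) y = inner ℂ x (shiftL y) :=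
  inner_compL_left _ _ _

theorem inner_shiftL_left (x y : Ell2) : inner ℂ (shiftL x) y = inner ℂ x (shiftR y) :=
  inner_compL_left _ _ _

theorem inner_cosL_left (x y : Ell2) : inner ℂ (cosL x) y = inner ℂ x (cosL y) := by
  have h : ∀ z, cosL z = ((1 / 2 : ℝ) : ℂ) • (shiftR z + shiftL z) := fun z => by
    rw [show cosL z = (1 / 2 : ℂ) • (shiftR z + shiftL z) from rfl]; norm_num
  rw [h, h, inner_smul_left, inner_smul_right, Complex.conj_ofReal, inner_add_left,
    inner_add_right, inner_shiftR_left, inner_shiftL_left, add_comm]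

theorem norm_inv_one_add_sq_le (n : ℤ) : ‖(1 + (n : ℂ) ^ 2)⁻¹‖ ≤ 1 := by
  have : (1 + (n : ℂ) ^ 2)⁻¹ = (((1 + (n : ℝ) ^ 2)⁻¹ : ℝ) : ℂ) := by push_cast; rfl
  rw [this, Complex.norm_real, Real.norm_of_nonneg (by positivity)]
  exact inv_le_one_of_one_le₀ (by nlinarith [sq_nonneg (n : ℝ)])

theorem norm_mul_inv_one_add_sq (n : ℤ) :
    ‖(n : ℂ) * (1 + (n : ℂ) ^ 2)⁻¹‖ = |(n : ℝ)| / (1 + |(n : ℝ)| ^ 2) := by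
  have : (n : ℂ) * (1 + (n : ℂ) ^ 2)⁻¹ = (((n : ℝ) * (1 + (n : ℝ) ^ 2)⁻¹ : ℝ) : ℂ) := by
    push_cast; rfl
  rw [this, Complex.norm_real, Real.norm_eq_abs, abs_mul, abs_inv, sq_abs, div_eq_mul_inv,
    abs_of_nonneg (by positivity : (0 : ℝ) ≤ 1 + (n : ℝ) ^ 2)]

theorem norm_mul_inv_one_add_sq_le (n : ℤ) : ‖(n : ℂ) * (1 + (n : ℂ) ^ 2)⁻¹‖ ≤ 1 := by
  rw [norm_mul_inv_one_add_sq, div_le_one (by positivity)]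
  nlinarith [sq_nonneg (|(n : ℝ)| - 1)]

theorem tendsto_abs_intCast_cofinite : Tendsto (fun n : ℤ => |(n : ℝ)|) cofinite atTop := by
  have h := Int.tendsto_coe_cofinite
  have := (tendsto_norm_cocompact_atTop (E := ℝ)).comp h
  exact this

/-- Multiplication by `1 / (1 + n ^ 2)`. -/
def invL : Ell2 →L[ℂ] Ell2 := diagL (fun n => (1 + (n : ℂ) ^ 2)⁻¹) norm_inv_one_add_sq_le

/-- Multiplication by `n / (1 + n ^ 2)`. -/
def invDerivL : Ell2 →L[ℂ] Ell2 :=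
  diagL (fun n => (n : ℂ) * (1 + (n : ℂ) ^ 2)⁻¹) norm_mul_inv_one_add_sq_le

@[simp] theorem invL_apply (x : Ell2) (n : ℤ) : invL x n = (1 + (n : ℂ) ^ 2)⁻¹ * x n := rfl
@[simp] theorem invDerivL_apply (x : Ell2) (n : ℤ) :
    invDerivL x n = (n : ℂ) * (1 + (n : ℂ) ^ 2)⁻¹ * x n := rfl

theorem one_add_sq_ne_zero (n : ℤ) : (1 + (n : ℂ) ^ 2) ≠ 0 := by
  have : ((1 + (n : ℝ) ^ 2 : ℝ) : ℂ) ≠ 0 := by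
    exact_mod_cast (by positivity : (1 + (n : ℝ) ^ 2) ≠ 0)
  push_cast at this
  exact this

theorem isCompactOperator_invL : IsCompactOperator invL := by
  refine isCompactOperator_diagL _ ?_
  rw [tendsto_zero_iff_norm_tendsto_zero]
  refine squeeze_zero (fun _ => norm_nonneg _) (fun n => ?_)
    (tendsto_inv_atTop_zero.comp (tendsto_atTop_add_const_left _ (1 / 2)
      tendsto_abs_intCast_cofinite))
  have : (1 + (n : ℂ) ^ 2)⁻¹ = (((1 + (n : ℝ) ^ 2)⁻¹ : ℝ) : ℂ) := by push_cast; rfl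
  rw [this, Complex.norm_real, Real.norm_of_nonneg (by positivity), Function.comp_apply]
  refine inv_anti₀ (by positivity) ?_
  nlinarith [sq_abs (n : ℝ), sq_nonneg (|(n : ℝ)| - 1)]

theorem isCompactOperator_invDerivL : IsCompactOperator invDerivL := by
  refine isCompactOperator_diagL _ ?_
  rw [tendsto_zero_iff_norm_tendsto_zero]
  refine squeeze_zero (fun _ => norm_nonneg _) (fun n => ?_)
    (tendsto_inv_atTop_zero.comp tendsto_abs_intCast_cofinite)
  rw [norm_mul_inv_one_add_sq, Function.comp_apply]
  rcases eq_or_ne n 0 with rfl | hn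
  · simp
  have : 0 < |(n : ℝ)| := by positivity
  rw [div_le_iff₀ (by positivity), inv_mul_eq_div, le_div_iff₀ this]
  nlinarith

/-- The real parameters of the equation
`p w'' + r w' + s (h - lam κ) w = 0`, where `p = (A - B cos 2τ) (C - E cos 2τ)`, `r = R sin 2τ`,
`s = (A - B cos 2τ) ^ 2` and `κ = E (1 + cos 2τ)`. -/
structure Coeffs where
  A : ℝ
  B : ℝ
  C : ℝ
  E : ℝ
  R : ℝ
  lam : ℝ
  B_pos : 0 < B
  B_lt : B < A
  E_pos : 0 < E
  E_lt : E < C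
  R_eq : R = E * A - B * C

namespace Coeffs

variable (m : Coeffs)

/-- Multiplication by `A - B cos 2τ`. -/
def QL : Ell2 →L[ℂ] Ell2 := (m.A : ℂ) • 1 - (m.B : ℂ) • cosL

/-- Multiplication by `C - E cos 2τ`. -/
def DL : Ell2 →L[ℂ] Ell2 := (m.C : ℂ) • 1 - (m.E : ℂ) • cosL

/-- Multiplication by `E (1 + cos 2τ)`. -/
def kL : Ell2 →L[ℂ] Ell2 := (m.E : ℂ) • (1 + cosL)

/-- Multiplication by `R sin 2τ` after differentiation, up to the factor `n`. -/
def rL : Ell2 →L[ℂ] Ell2 := (m.R : ℂ) • (shiftR - shiftL)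

theorem QL_eq (x : Ell2) : m.QL x = (m.A : ℂ) • x - (m.B : ℂ) • cosL x := rfl
theorem DL_eq (x : Ell2) : m.DL x = (m.C : ℂ) • x - (m.E : ℂ) • cosL x := rfl

@[simp] theorem QL_apply (x : Ell2) (n : ℤ) :
    m.QL x n = m.A * x n - m.B * (1 / 2 * (x (n - 1) + x (n + 1))) := rfl
@[simp] theorem DL_apply (x : Ell2) (n : ℤ) :
    m.DL x n = m.C * x n - m.E * (1 / 2 * (x (n - 1) + x (n + 1))) := rfl
@[simp] theorem kL_apply (x : Ell2) (n : ℤ) :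
    m.kL x n = m.E * (x n + 1 / 2 * (x (n - 1) + x (n + 1))) := rfl
@[simp] theorem rL_apply (x : Ell2) (n : ℤ) :
    m.rL x n = m.R * (x (n - 1) - x (n + 1)) := rfl

theorem re_inner_cosL_le (v : Ell2) : (inner ℂ v (cosL v)).re ≤ ‖v‖ * ‖cosL v‖ :=
  (Complex.re_le_norm _).trans (norm_inner_le_norm _ _)

theorem A_pos : 0 < m.A := m.B_pos.trans m.B_lt
theorem C_pos : 0 < m.C := m.E_pos.trans m.E_lt

theorem inner_QL_left (x y : Ell2) : inner ℂ (m.QL x) y = inner ℂ x (m.QL y) := by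
  simp only [QL_eq, inner_sub_left, inner_sub_right, inner_smul_left, inner_smul_right,
    inner_cosL_left, Complex.conj_ofReal]

theorem inner_DL_left (x y : Ell2) : inner ℂ (m.DL x) y = inner ℂ x (m.DL y) := by
  simp only [DL_eq, inner_sub_left, inner_sub_right, inner_smul_left, inner_smul_right,
    inner_cosL_left, Complex.conj_ofReal]

theorem QL_DL_comm : m.QL * m.DL = m.DL * m.QL := by
  simp only [QL, DL, sub_mul, mul_sub, smul_mul_assoc, mul_smul_comm, one_mul, mul_one, smul_sub,
    smul_smul]
  rw [mul_comm (m.C : ℂ), mul_comm (m.E : ℂ), mul_comm (m.E : ℂ), mul_comm (m.C : ℂ)]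
  abel

/-- With x = ‖v‖ and y = ‖cosL v‖ ≤ x, expand the product and bound the mixed term by
Cauchy–Schwarz. What remains is (A x - B y)(C x - E y), and both factors decrease in y. -/
theorem re_inner_QL_DL (v : Ell2) :
    (m.A - m.B) * (m.C - m.E) * ‖v‖ ^ 2 ≤ (inner ℂ v (m.QL (m.DL v))).re := by
  have h1 : inner ℂ v (m.QL (m.DL v)) = (m.A * m.C : ℝ) * (‖v‖ : ℂ) ^ 2 -
      (m.A * m.E + m.B * m.C : ℝ) * inner ℂ v (cosL v) + (m.B * m.E : ℝ) * (‖cosL v‖ : ℂ) ^ 2 := by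
    rw [← inner_QL_left]
    simp only [QL_eq, DL_eq, inner_sub_left, inner_sub_right,
      inner_smul_left, inner_smul_right, inner_cosL_left, Complex.conj_ofReal]
    rw [← inner_cosL_left v (cosL v), inner_self_eq_norm_sq_to_K, inner_self_eq_norm_sq_to_K]
    push_cast
    simp only [RCLike.ofReal_eq_complex_ofReal]
    ring
  rw [h1]
  have h2 := re_inner_cosL_le v
  have h3 := norm_cosL_apply_le v
  have h4 := norm_nonneg (cosL v)
  have e1 : ((m.A * m.C : ℝ) * (‖v‖ : ℂ) ^ 2 - (m.A * m.E + m.B * m.C : ℝ) * inner ℂ v (cosL v) +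
      (m.B * m.E : ℝ) * (‖cosL v‖ : ℂ) ^ 2).re = m.A * m.C * ‖v‖ ^ 2 -
      (m.A * m.E + m.B * m.C) * (inner ℂ v (cosL v)).re + m.B * m.E * ‖cosL v‖ ^ 2 := by
    rw [← Complex.ofReal_pow, ← Complex.ofReal_pow, Complex.add_re, Complex.sub_re,
      Complex.re_ofReal_mul, Complex.re_ofReal_mul, Complex.re_ofReal_mul, Complex.ofReal_re,
      Complex.ofReal_re]
  rw [e1]
  have hA := m.A_pos
  have hB := m.B_pos
  have hC := m.C_pos
  have hE := m.E_pos
  have h5 : (m.A * m.E + m.B * m.C) * (inner ℂ v (cosL v)).re ≤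
      (m.A * m.E + m.B * m.C) * (‖v‖ * ‖cosL v‖) := by gcongr
  have h6 : (m.A - m.B) * ‖v‖ ≤ m.A * ‖v‖ - m.B * ‖cosL v‖ := by nlinarith
  have h7 : (m.C - m.E) * ‖v‖ ≤ m.C * ‖v‖ - m.E * ‖cosL v‖ := by nlinarith
  have h8 : (m.A - m.B) * ‖v‖ * ((m.C - m.E) * ‖v‖) ≤
      (m.A * ‖v‖ - m.B * ‖cosL v‖) * (m.C * ‖v‖ - m.E * ‖cosL v‖) :=
    mul_le_mul h6 h7 (mul_nonneg (sub_pos.2 m.E_lt).le (norm_nonneg _))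
      (le_trans (mul_nonneg (sub_pos.2 m.B_lt).le (norm_nonneg _)) h6)
  nlinarith

/-- A copy of the parameters whose second factor equals the first. -/
def square : Coeffs where
  A := m.A
  B := m.B
  C := m.A
  E := m.B
  R := m.B * m.A - m.B * m.A
  lam := m.lam
  B_pos := m.B_pos
  B_lt := m.B_lt
  E_pos := m.B_pos
  E_lt := m.B_lt
  R_eq := rfl

theorem re_inner_QL_QL (v : Ell2) :
    (m.A - m.B) ^ 2 * ‖v‖ ^ 2 ≤ (inner ℂ v (m.QL (m.QL v))).re := by
  rw [sq (m.A - m.B)]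
  exact m.square.re_inner_QL_DL v

/-- Neumann series, since multiplication by a cosine has norm at most 1. -/
theorem isUnit_sub_cosL {α β : ℝ} (hα : 0 < α) (hβ : 0 < β) (h : β < α) :
    IsUnit ((α : ℂ) • (1 : Ell2 →L[ℂ] Ell2) - (β : ℂ) • cosL) := by
  have hα0 : (α : ℂ) ≠ 0 := by exact_mod_cast hα.ne'
  have h1 : ‖((β / α : ℝ) : ℂ) • cosL‖ < 1 := by
    rw [norm_smul, Complex.norm_real, Real.norm_of_nonneg (by positivity)]
    have : ‖cosL‖ ≤ 1 := ContinuousLinearMap.opNorm_le_bound _ zero_le_one fun x => by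
      rw [one_mul]; exact norm_cosL_apply_le x
    calc β / α * ‖cosL‖ ≤ β / α * 1 := by gcongr
      _ < 1 := by rw [mul_one, div_lt_one hα]; exact h
  have h2 := isUnit_one_sub_of_norm_lt_one h1
  have h3 : (α : ℂ) • (1 : Ell2 →L[ℂ] Ell2) - (β : ℂ) • cosL =
      (Units.mk0 (α : ℂ) hα0) • (1 - ((β / α : ℝ) : ℂ) • cosL) := by
    rw [Units.smul_mk0, smul_sub, smul_smul]
    congr 2
    push_cast
    field_simp
  rw [h3]
  exact h2.smul _

theorem isUnit_QL : IsUnit m.QL := isUnit_sub_cosL m.A_pos m.B_pos m.B_lt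
theorem isUnit_DL : IsUnit m.DL := isUnit_sub_cosL m.C_pos m.E_pos m.E_lt

/-- The even sequences. -/
def _root_.EllipsoidSL.evenSeq : Submodule ℂ Ell2 :=
  LinearMap.ker ((reflL - 1 : Ell2 →L[ℂ] Ell2) : Ell2 →ₗ[ℂ] Ell2)

theorem _root_.EllipsoidSL.mem_evenSeq {x : Ell2} : x ∈ evenSeq ↔ ∀ n, x (-n) = x n := by
  have : x ∈ evenSeq ↔ reflL x - x = 0 := Iff.rfl
  rw [this, sub_eq_zero]
  exact ⟨fun h n => congrFun (congrArg Subtype.val h) n, fun h => lp.ext (funext h)⟩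

theorem _root_.EllipsoidSL.mem_evenSeq_iff_reflL {x : Ell2} : x ∈ evenSeq ↔ reflL x = x := by
  have : x ∈ evenSeq ↔ reflL x - x = 0 := Iff.rfl
  rw [this, sub_eq_zero]

theorem QL_mem {x : Ell2} (hx : x ∈ evenSeq) : m.QL x ∈ evenSeq := by
  rw [mem_evenSeq] at hx ⊢
  intro n
  have h1 := hx (n + 1)
  have h2 := hx (n - 1)
  rw [neg_add, ← sub_eq_add_neg] at h1
  rw [neg_sub', sub_neg_eq_add] at h2
  simp only [QL_apply, hx, h1, h2]
  ring

theorem kL_mem {x : Ell2} (hx : x ∈ evenSeq) : m.kL x ∈ evenSeq := by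
  rw [mem_evenSeq] at hx ⊢
  intro n
  have h1 := hx (n + 1)
  have h2 := hx (n - 1)
  rw [neg_add, ← sub_eq_add_neg] at h1
  rw [neg_sub', sub_neg_eq_add] at h2
  simp only [kL_apply, hx, h1, h2]
  ring

theorem _root_.EllipsoidSL.invL_mem {x : Ell2} (hx : x ∈ evenSeq) : invL x ∈ evenSeq := by
  rw [mem_evenSeq] at hx ⊢
  intro n
  simp [hx]

theorem rL_invDerivL_mem {x : Ell2} (hx : x ∈ evenSeq) : m.rL (invDerivL x) ∈ evenSeq := by
  rw [mem_evenSeq] at hx ⊢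
  intro n
  have h1 := hx (n + 1)
  have h2 := hx (n - 1)
  rw [neg_add, ← sub_eq_add_neg] at h1
  rw [neg_sub', sub_neg_eq_add] at h2
  simp only [rL_apply, invDerivL_apply, h1, h2]
  push_cast
  ring

theorem reflL_QL_DL (x : Ell2) : reflL (m.QL (m.DL x)) = m.QL (m.DL (reflL x)) := by
  ext n
  simp only [QL_apply, DL_apply, reflL_apply]
  ring_nf

theorem QL_DL_injective : Function.Injective fun x => m.QL (m.DL x) := by
  have h := (m.isUnit_QL.mul m.isUnit_DL)
  rw [ContinuousLinearMap.isUnit_iff_bijective] at h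
  exact h.1

theorem QL_DL_surjective : Function.Surjective fun x => m.QL (m.DL x) := by
  have h := (m.isUnit_QL.mul m.isUnit_DL)
  rw [ContinuousLinearMap.isUnit_iff_bijective] at h
  exact h.2

/-- Multiplication by an even function commutes with the reflection; injectivity supplies the
converse direction. -/
theorem QL_DL_mem_iff (x : Ell2) : m.QL (m.DL x) ∈ evenSeq ↔ x ∈ evenSeq := by
  rw [mem_evenSeq_iff_reflL, mem_evenSeq_iff_reflL, reflL_QL_DL]
  exact ⟨fun h => m.QL_DL_injective h, fun h => by rw [h]⟩

/-- The operator pencil of the differential equation, in terms of the Fourier coefficients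
`(1 + n ^ 2) u n` where `u n` are the Fourier coefficients of the solution. -/
def pencil : CompactPencil Ell2 where
  P := (4 : ℂ) • (m.QL * m.DL)
  -- As v n = (1 + n²) u n, one has n² u = v - `invL v` and n u = `invDerivL v`. The second order
  -- term therefore splits into the coercive part P and a compact correction.
  G := -((4 : ℂ) • (m.QL * m.DL)) * invL - m.rL * invDerivL +
    (m.lam : ℂ) • (m.kL * (m.QL * m.QL)) * invL
  S := (m.QL * m.QL) * invL
  E := evenSeq
  isClosed_E := ContinuousLinearMap.isClosed_ker _
  c := 4 * ((m.A - m.B) * (m.C - m.E))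
  c_pos := by
    have := sub_pos.2 m.B_lt
    have := sub_pos.2 m.E_lt
    positivity
  coercive v := by
    have h := m.re_inner_QL_DL v
    have e : inner ℂ v (((4 : ℂ) • (m.QL * m.DL)) v) = ((4 : ℝ) : ℂ) * inner ℂ v (m.QL (m.DL v)) := by
      rw [smul_apply, inner_smul_right]; norm_num
    rw [e, Complex.re_ofReal_mul]
    linarith
  surjective y := by
    obtain ⟨x, hx⟩ := m.QL_DL_surjective ((4 : ℂ)⁻¹ • y)
    refine ⟨x, ?_⟩
    change (4 : ℂ) • m.QL (m.DL x) = y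
    rw [show m.QL (m.DL x) = (4 : ℂ)⁻¹ • y from hx, smul_smul]; norm_num
  compact_G := by
    refine IsCompactOperator.add (IsCompactOperator.sub ?_ ?_) ?_
    · exact isCompactOperator_invL.clm_comp (-((4 : ℂ) • (m.QL * m.DL)))
    · exact isCompactOperator_invDerivL.clm_comp m.rL
    · exact isCompactOperator_invL.clm_comp ((m.lam : ℂ) • (m.kL * (m.QL * m.QL)))
  compact_S := isCompactOperator_invL.clm_comp (m.QL * m.QL)
  P_mem_iff v := by
    rw [← m.QL_DL_mem_iff v]
    exact Submodule.smul_mem_iff (x := m.QL (m.DL v)) evenSeq (by norm_num : (4 : ℂ) ≠ 0)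
  G_mem v hv := by
    refine Submodule.add_mem _ (Submodule.sub_mem _ ?_ (m.rL_invDerivL_mem hv)) ?_
    · exact Submodule.neg_mem _ (Submodule.smul_mem _ _ ((m.QL_DL_mem_iff _).2 (invL_mem hv)))
    · exact Submodule.smul_mem _ _ (m.kL_mem (m.QL_mem (m.QL_mem (invL_mem hv))))
  S_mem v hv := m.QL_mem (m.QL_mem (invL_mem hv))

theorem pencil_T_apply (h : ℂ) (v : Ell2) :
    m.pencil.T h v = (4 : ℂ) • m.QL (m.DL (v - invL v)) - m.rL (invDerivL v) +
      (m.lam : ℂ) • m.kL (m.QL (m.QL (invL v))) - h • m.QL (m.QL (invL v)) := by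
  rw [CompactPencil.T_apply]
  change (4 : ℂ) • m.QL (m.DL v) + (-((4 : ℂ) • m.QL (m.DL (invL v))) - m.rL (invDerivL v) +
    (m.lam : ℂ) • m.kL (m.QL (m.QL (invL v)))) - h • m.QL (m.QL (invL v)) = _
  simp only [map_sub, smul_sub]
  abel

theorem pencil_S_apply (v : Ell2) : m.pencil.S v = m.QL (m.QL (invL v)) := rfl

end Coeffs

/-! ### A sector containing the eigenvalues of the projected problems -/

/-- `y n = n * x n` for all `n`. -/
def IsIndexMul (x y : Ell2) : Prop := ∀ n : ℤ, y n = n * x n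

/-- Integration by parts in Fourier coordinates: the multiplier n is real. -/
theorem IsIndexMul.inner_left {x x₁ y y₁ : Ell2} (hx : IsIndexMul x x₁) (hy : IsIndexMul y y₁) :
    inner ℂ x₁ y = inner ℂ x y₁ := by
  rw [Ell2.inner_eq, Ell2.inner_eq]
  refine tsum_congr fun n => ?_
  rw [hx n, hy n, map_mul, map_intCast]
  ring

theorem isIndexMul_invL (v : Ell2) : IsIndexMul (invL v) (invDerivL v) := fun n => by
  simp only [invL_apply, invDerivL_apply]; ring

theorem isIndexMul_invDerivL (v : Ell2) : IsIndexMul (invDerivL v) (v - invL v) := fun n => by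
  have := one_add_sq_ne_zero n
  simp only [invL_apply, invDerivL_apply, lp.coeFn_sub, Pi.sub_apply]
  field_simp
  ring

namespace Coeffs

variable (m : Coeffs)

/-- The commutator of the index multiplication with `QL`. -/
def QL' : Ell2 →L[ℂ] Ell2 := (-(m.B : ℂ) / 2) • (shiftR - shiftL)

/-- The commutator of the index multiplication with `DL`. -/
def DL' : Ell2 →L[ℂ] Ell2 := (-(m.E : ℂ) / 2) • (shiftR - shiftL)

theorem isIndexMul_QL {x x₁ : Ell2} (h : IsIndexMul x x₁) :
    IsIndexMul (m.QL x) (m.QL x₁ + m.QL' x) := fun n => by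
  have e : m.QL' x n = -(m.B : ℂ) / 2 * (x (n - 1) - x (n + 1)) := rfl
  rw [lp.coeFn_add, Pi.add_apply, e, QL_apply, QL_apply, h n, h (n - 1), h (n + 1)]
  push_cast
  ring

theorem isIndexMul_DL {x x₁ : Ell2} (h : IsIndexMul x x₁) :
    IsIndexMul (m.DL x) (m.DL x₁ + m.DL' x) := fun n => by
  have e : m.DL' x n = -(m.E : ℂ) / 2 * (x (n - 1) - x (n + 1)) := rfl
  rw [lp.coeFn_add, Pi.add_apply, e, DL_apply, DL_apply, h n, h (n - 1), h (n + 1)]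
  push_cast
  ring

theorem isIndexMul_QL_QL {x x₁ : Ell2} (h : IsIndexMul x x₁) :
    IsIndexMul (m.QL (m.QL x)) (m.QL (m.QL x₁) + (m.QL * m.QL' + m.QL' * m.QL) x) := by
  have := m.isIndexMul_QL (m.isIndexMul_QL h)
  rwa [map_add, add_assoc] at this

theorem isIndexMul_QL_DL {x x₁ : Ell2} (h : IsIndexMul x x₁) :
    IsIndexMul (m.QL (m.DL x)) (m.QL (m.DL x₁) + (m.QL * m.DL' + m.QL' * m.DL) x) := by
  have := m.isIndexMul_QL (m.isIndexMul_DL h)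
  rwa [map_add, add_assoc] at this

theorem QL_DL_apply_comm (x : Ell2) : m.DL (m.QL x) = m.QL (m.DL x) :=
  (DFunLike.congr_fun m.QL_DL_comm x).symm

theorem inner_QL_DL_left (x y : Ell2) :
    inner ℂ (m.QL (m.DL x)) y = inner ℂ x (m.QL (m.DL y)) := by
  rw [inner_QL_left, inner_DL_left, QL_DL_apply_comm]

theorem im_inner_QL_DL (x : Ell2) : (inner ℂ x (m.QL (m.DL x))).im = 0 := by
  have h := m.inner_QL_DL_left x x
  rw [← inner_conj_symm] at h
  exact Complex.conj_eq_iff_im.1 h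

theorem im_inner_QL_QL (x : Ell2) : (inner ℂ x (m.QL (m.QL x))).im = 0 :=
  m.square.im_inner_QL_DL x

theorem norm_inner_apply_le (L : Ell2 →L[ℂ] Ell2) (x y : Ell2) :
    ‖inner ℂ x (L y)‖ ≤ ‖L‖ * (‖x‖ * ‖y‖) := by
  calc ‖inner ℂ x (L y)‖ ≤ ‖x‖ * ‖L y‖ := norm_inner_le_norm _ _
    _ ≤ ‖x‖ * (‖L‖ * ‖y‖) := by gcongr; exact L.le_opNorm y
    _ = _ := by ring

end Coeffs

/-- If `Y` and `g Y` both lie in narrow sectors around the positive half axis, so does `g`. -/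
theorem norm_le_five_mul_re {g X Y : ℂ} (hX : X = g * Y) (hY0 : 0 < Y.re)
    (hYim : |Y.im| ≤ Y.re / 3) (hXim : |X.im| ≤ 3 / 5 * X.re) : ‖g‖ ≤ 5 * g.re := by
  have hXre : 0 ≤ X.re := by linarith [abs_nonneg X.im]
  have hn : 0 < ‖Y‖ := norm_pos_iff.2 fun h => by simp [h] at hY0
  have h1 : g.re * ‖Y‖ ^ 2 = X.re * Y.re + X.im * Y.im := by
    rw [← Complex.normSq_eq_norm_sq, Complex.normSq_apply, hX, Complex.mul_re, Complex.mul_im]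
    ring
  have h2 : ‖g‖ * ‖Y‖ ^ 2 = ‖X‖ * ‖Y‖ := by rw [hX, norm_mul]; ring
  have h3 : ‖X‖ ≤ 8 / 5 * X.re := by
    have := Complex.norm_le_abs_re_add_abs_im X
    rw [abs_of_nonneg hXre] at this
    linarith
  have h4 : ‖Y‖ ≤ 4 / 3 * Y.re := by
    have := Complex.norm_le_abs_re_add_abs_im Y
    rw [abs_of_pos hY0] at this
    linarith
  have h5 : ‖X‖ * ‖Y‖ ≤ 8 / 5 * X.re * (4 / 3 * Y.re) := by gcongr
  have h6 : |X.im * Y.im| ≤ 3 / 5 * X.re * (Y.re / 3) := by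
    rw [abs_mul]; gcongr
  have h7 := neg_abs_le (X.im * Y.im)
  have h8 : 0 ≤ X.re * Y.re := by positivity
  -- The left side is at most 32/15 · Re X · Re Y, while Re g · ‖Y‖² is at least 4/5 · Re X · Re Y.
  -- The factor 8/3 would suffice; 5 leaves room.
  have h9 : ‖g‖ * ‖Y‖ ^ 2 ≤ 5 * g.re * ‖Y‖ ^ 2 := by
    rw [mul_assoc 5, h1, h2]; nlinarith
  exact le_of_mul_le_mul_right h9 (by positivity)

/-- The real inequalities behind the sector bound. -/
theorem exists_sector_constants {s p m' l' r k : ℝ} (hs : 0 < s) (hp : 0 < p)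
    (hl : 0 ≤ l') (hr : 0 ≤ r) (hk : 0 ≤ k) :
    ∃ μ > 0, ∃ M ≥ 0, ∀ x y z : ℝ, 0 ≤ x → 0 ≤ y → 0 ≤ z →
      m' * (y * x) ≤ (s * y ^ 2 + μ * (s * x ^ 2)) / 4 ∧
      4 * μ * (l' * (x * y)) + r * ((z + μ * x) * y) + k * ((z + μ * x) * x) ≤
        p * z ^ 2 + M * (s * y ^ 2 + μ * (s * x ^ 2)) := by
  -- The square is what Young's inequality needs to absorb m' y x into a quarter of the quadratic
  -- form; the summand 1 secures μ ≥ 1.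
  set μ : ℝ := (2 * m' / s) ^ 2 + 1 with hμ
  have hμ1 : 1 ≤ μ := by rw [hμ]; nlinarith [sq_nonneg (2 * m' / s)]
  -- Each of the two mixed terms containing z receives half of p z² in Young's inequality; the
  -- remainders are collected in this constant.
  set M₁ : ℝ := 2 * μ * l' + r * μ / 2 + k * μ + (r ^ 2 + k ^ 2) / (2 * p) with hM₁
  have hM₁0 : 0 ≤ M₁ := by positivity
  refine ⟨μ, by linarith, M₁ / s, by positivity, fun x y z hx hy hz => ⟨?_, ?_⟩⟩
  · have h1 : s * μ * s = 4 * m' ^ 2 + s ^ 2 := by rw [hμ]; field_simp; ring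
    have h2 : s * (m' * (y * x)) ≤ s * ((s * y ^ 2 + μ * (s * x ^ 2)) / 4) := by
      nlinarith [sq_nonneg (s * y - 2 * m' * x), sq_nonneg (s * x)]
    exact le_of_mul_le_mul_left h2 hs
  · have h1 : r * (z * y) ≤ p / 2 * z ^ 2 + r ^ 2 / (2 * p) * y ^ 2 := by
      have : p / 2 * z ^ 2 + r ^ 2 / (2 * p) * y ^ 2 - r * (z * y) = (p * z - r * y) ^ 2 / (2 * p) := by
        field_simp; ring
      have h0 : 0 ≤ (p * z - r * y) ^ 2 / (2 * p) := by positivity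
      linarith
    have h2 : k * (z * x) ≤ p / 2 * z ^ 2 + k ^ 2 / (2 * p) * x ^ 2 := by
      have : p / 2 * z ^ 2 + k ^ 2 / (2 * p) * x ^ 2 - k * (z * x) = (p * z - k * x) ^ 2 / (2 * p) := by
        field_simp; ring
      have h0 : 0 ≤ (p * z - k * x) ^ 2 / (2 * p) := by positivity
      linarith
    have h3 : x * y ≤ (x ^ 2 + y ^ 2) / 2 := by nlinarith [sq_nonneg (x - y)]
    have h4 : (4 * μ * l' + r * μ) * (x * y) ≤ (4 * μ * l' + r * μ) * ((x ^ 2 + y ^ 2) / 2) := by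
      gcongr
    have h5 : M₁ / s * (s * y ^ 2 + μ * (s * x ^ 2)) = M₁ * (y ^ 2 + μ * x ^ 2) := by
      field_simp
    have h6 : M₁ * (y ^ 2 + x ^ 2) ≤ M₁ * (y ^ 2 + μ * x ^ 2) := by
      gcongr
      nlinarith [sq_nonneg x]
    have h7 : 0 ≤ k * μ * y ^ 2 := by positivity
    have h8 : 0 ≤ r ^ 2 / (2 * p) * x ^ 2 := by positivity
    have h9 : 0 ≤ k ^ 2 / (2 * p) * y ^ 2 := by positivity
    have h10 : (r ^ 2 + k ^ 2) / (2 * p) = r ^ 2 / (2 * p) + k ^ 2 / (2 * p) := add_div _ _ _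
    rw [h5]
    refine le_trans ?_ (add_le_add le_rfl h6)
    rw [hM₁, h10]
    nlinarith

namespace Coeffs

variable (m : Coeffs)

/-- The eigenvalues of all projected problems lie in a common sector around the positive half
axis. -/
theorem exists_sector : ∃ K : ℝ, ∀ (U : Submodule ℂ Ell2) [U.HasOrthogonalProjection],
    (∀ v ∈ U, invL v ∈ U) → ∀ h : ℂ, m.pencil.IsProjEigenvalue U h →
    ‖h + K‖ ≤ 5 * (h + K).re := by
  set s : ℝ := (m.A - m.B) ^ 2 with hs
  set p : ℝ := (m.A - m.B) * (m.C - m.E) with hp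
  have hAB := sub_pos.2 m.B_lt
  have hCE := sub_pos.2 m.E_lt
  have hs0 : 0 < s := by positivity
  have hp0 : 0 < p := by positivity
  set M' := m.QL * m.QL' + m.QL' * m.QL with hM'
  set L' := m.QL * m.DL' + m.QL' * m.DL with hL'
  set k' := (m.lam : ℂ) • (m.kL * (m.QL * m.QL)) with hk'
  obtain ⟨μ, hμ, M, hM, hineq⟩ := exists_sector_constants (m' := ‖M'‖) hs0 hp0
    (norm_nonneg L') (norm_nonneg m.rL) (norm_nonneg k')
  -- The shift is dictated by the estimates for X and Y below. Adding 8M Y to X raises the real part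
  -- to at least 3 p z² + 5 M F, while the imaginary part stays below p z² + 3 M F, hence within 3/5
  -- of the real part.
  refine ⟨8 * M, fun U _ hU h ⟨v, hvU, hv0, hTv⟩ => ?_⟩
  set u := invL v with hu
  set u₁ := invDerivL v with hu₁
  set u₂ := v - invL v with hu₂
  have hN1 : IsIndexMul u u₁ := isIndexMul_invL v
  have hN2 : IsIndexMul u₁ u₂ := isIndexMul_invDerivL v
  have hu0 : u ≠ 0 := fun h0 => hv0 <| by
    ext n
    have : u n = 0 := by rw [h0]; rfl
    rw [hu, invL_apply, mul_eq_zero] at this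
    exact this.resolve_left (inv_ne_zero (one_add_sq_ne_zero n))
  -- The test vector corresponds to -u''/4 + μ u. After integration by parts both X and Y have
  -- symmetric positive main parts, and only commutators and lower order terms are left as errors.
  -- The invariance of U under `invL` makes this vector admissible. The orthogonality relation then
  -- reads X = h Y, so that h is a quotient of two controlled numbers.
  set w := u₂ + (μ : ℂ) • u with hw
  have hwU : w ∈ U := U.add_mem (U.sub_mem hvU (hU v hvU)) (U.smul_mem _ (hU v hvU))
  have horth : inner ℂ w (m.pencil.T h v) = 0 := by
    rw [← Submodule.starProjection_eq_self_iff.2 hwU, Submodule.inner_starProjection_left_eq_right,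
      hTv, inner_zero_right]
  set Y := inner ℂ w (m.QL (m.QL u)) with hY
  set X := inner ℂ w ((4 : ℂ) • m.QL (m.DL u₂) - m.rL u₁ + k' u) with hX
  have hXY : X = h * Y := by
    have e : m.pencil.T h v = ((4 : ℂ) • m.QL (m.DL u₂) - m.rL u₁ + k' u) - h • m.QL (m.QL u) :=
      m.pencil_T_apply h v
    rw [e, inner_sub_right, inner_smul_right, sub_eq_zero] at horth
    exact horth
  have hwn : ‖w‖ ≤ ‖u₂‖ + μ * ‖u‖ := by
    refine (norm_add_le _ _).trans ?_
    rw [norm_smul, Complex.norm_real, Real.norm_of_nonneg hμ.le]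
  have hYeq : Y = inner ℂ u₁ (m.QL (m.QL u₁)) + inner ℂ u₁ (M' u) +
      (μ : ℂ) * inner ℂ u (m.QL (m.QL u)) := by
    rw [hY, hw, inner_add_left, inner_smul_left, Complex.conj_ofReal,
      hN2.inner_left (m.isIndexMul_QL_QL hN1), inner_add_right]
  have hXeq : X = 4 * inner ℂ u₂ (m.QL (m.DL u₂)) + (4 * μ : ℝ) * inner ℂ u₁ (m.QL (m.DL u₁)) +
      ((4 * μ : ℝ) * inner ℂ (L' u) u₁ - inner ℂ w (m.rL u₁) + inner ℂ w (k' u)) := by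
    have e : inner ℂ u (m.QL (m.DL u₂)) = inner ℂ u₁ (m.QL (m.DL u₁)) + inner ℂ (L' u) u₁ := by
      rw [← inner_QL_DL_left, ← inner_QL_DL_left m u₁ u₁, ← inner_add_left]
      exact ((m.isIndexMul_QL_DL hN1).inner_left hN2).symm
    rw [hX, inner_add_right, inner_sub_right, inner_smul_right, hw, inner_add_left (x := u₂)
      (z := m.QL (m.DL u₂)), inner_smul_left, Complex.conj_ofReal, e]
    push_cast
    ring
  set x := ‖u‖ with hx
  set y := ‖u₁‖ with hy
  set z := ‖u₂‖ with hz
  obtain ⟨hi1, hi2⟩ := hineq x y z (norm_nonneg _) (norm_nonneg _) (norm_nonneg _)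
  set F := s * y ^ 2 + μ * (s * x ^ 2) with hF
  have hFpos : 0 < F := by
    have : 0 < x := norm_pos_iff.2 hu0
    positivity
  have hM'b : ‖inner ℂ u₁ (M' u)‖ ≤ F / 4 := (norm_inner_apply_le M' u₁ u).trans hi1
  have hYre : 3 / 4 * F ≤ Y.re := by
    rw [hYeq, Complex.add_re, Complex.add_re, Complex.re_ofReal_mul]
    have h1 := m.re_inner_QL_QL u₁
    have h2 := mul_le_mul_of_nonneg_left (m.re_inner_QL_QL u) hμ.le
    have h3 := (abs_le.1 (Complex.abs_re_le_norm (inner ℂ u₁ (M' u)))).1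
    linarith
  have hYim : |Y.im| ≤ F / 4 := by
    rw [hYeq, Complex.add_im, Complex.add_im, Complex.im_ofReal_mul, im_inner_QL_QL,
      im_inner_QL_QL, mul_zero, add_zero, zero_add]
    exact (Complex.abs_im_le_norm _).trans hM'b
  set err := (4 * μ : ℝ) * inner ℂ (L' u) u₁ - inner ℂ w (m.rL u₁) + inner ℂ w (k' u) with herr
  have herrb : ‖err‖ ≤ p * z ^ 2 + M * F := by
    refine le_trans ?_ hi2
    have h1 : ‖((4 * μ : ℝ) : ℂ) * inner ℂ (L' u) u₁‖ ≤ 4 * μ * (‖L'‖ * (x * y)) := by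
      rw [norm_mul, Complex.norm_real, Real.norm_of_nonneg (by positivity)]
      gcongr
      rw [norm_inner_symm, mul_comm x]
      exact norm_inner_apply_le _ _ _
    have h2 : ‖inner ℂ w (m.rL u₁)‖ ≤ ‖m.rL‖ * ((z + μ * x) * y) :=
      (norm_inner_apply_le _ _ _).trans (by gcongr)
    have h3 : ‖inner ℂ w (k' u)‖ ≤ ‖k'‖ * ((z + μ * x) * x) :=
      (norm_inner_apply_le _ _ _).trans (by gcongr)
    refine (norm_add_le _ _).trans (add_le_add ((norm_sub_le _ _).trans (add_le_add h1 h2)) h3)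
  have hXre : 4 * (p * z ^ 2) - (p * z ^ 2 + M * F) ≤ X.re := by
    have e4 : (4 : ℂ) = ((4 : ℝ) : ℂ) := by norm_num
    rw [hXeq, Complex.add_re, Complex.add_re, Complex.re_ofReal_mul, e4, Complex.re_ofReal_mul]
    have h1 := m.re_inner_QL_DL u₂
    have h2 : 0 ≤ 4 * μ * (inner ℂ u₁ (m.QL (m.DL u₁))).re := by
      have := m.re_inner_QL_DL u₁
      have : 0 ≤ (inner ℂ u₁ (m.QL (m.DL u₁))).re := le_trans (by positivity) this
      positivity
    have h3 := (abs_le.1 ((Complex.abs_re_le_norm err).trans herrb)).1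
    linarith
  have hXim : |X.im| ≤ p * z ^ 2 + M * F := by
    have e4 : (4 : ℂ) = ((4 : ℝ) : ℂ) := by norm_num
    rw [hXeq, Complex.add_im, Complex.add_im, Complex.im_ofReal_mul, e4, Complex.im_ofReal_mul,
      im_inner_QL_DL, im_inner_QL_DL, mul_zero, mul_zero, add_zero, zero_add]
    exact (Complex.abs_im_le_norm _).trans herrb
  have hMF : 0 ≤ M * F := by positivity
  have hpz : 0 ≤ p * z ^ 2 := by positivity
  refine norm_le_five_mul_re (X := X + ((8 * M : ℝ) : ℂ) * Y) (Y := Y) (by rw [hXY, add_mul])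
    (by linarith) (by linarith) ?_
  rw [Complex.add_im, Complex.add_re, Complex.im_ofReal_mul, Complex.re_ofReal_mul]
  have h1 : |8 * M * Y.im| ≤ 8 * M * (F / 4) := by
    rw [abs_mul, abs_of_nonneg (by positivity : 0 ≤ 8 * M)]
    gcongr
  have h2 : 8 * M * (3 / 4 * F) ≤ 8 * M * Y.re := by gcongr
  have h3 := abs_add_le X.im (8 * M * Y.im)
  nlinarith

end Coeffs

/-! ### Two roots of a characteristic polynomial -/

/-- Two roots of the characteristic polynomial, counted with multiplicity, give rise to an
eigenvector and an independent generalized eigenvector. -/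
theorem exists_chain_of_roots_charpoly {W : Type*} [AddCommGroup W] [Module ℂ W]
    [FiniteDimensional ℂ W] (f : Module.End ℂ W) {μ ν : ℂ}
    (h : ({μ, ν} : Multiset ℂ) ≤ f.charpoly.roots) :
    ∃ x y : W, ∃ κ : ℂ, x ≠ 0 ∧ f x = μ • x ∧ f y = ν • y + κ • x ∧ ∀ r : ℂ, y ≠ r • x := by
  have hev : ∀ ξ ∈ ({μ, ν} : Multiset ℂ), ∃ x, x ≠ 0 ∧ f x = ξ • x := fun ξ hξ => by
    have h1 := (Polynomial.mem_roots f.charpoly_monic.ne_zero).1 (Multiset.mem_of_le h hξ)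
    obtain ⟨x, hx⟩ := ((Module.End.hasEigenvalue_iff_isRoot_charpoly f ξ).2 h1).exists_hasEigenvector
    exact ⟨x, hx.2, Module.End.mem_eigenspace_iff.1 hx.1⟩
  obtain ⟨x, hx0, hx⟩ := hev μ (by simp)
  -- Distinct roots have independent eigenvectors and κ = 0. For a double root, the absence of a
  -- chain would make the maximal generalized eigenspace one-dimensional, although its dimension is
  -- the algebraic multiplicity.
  by_cases hμν : μ = ν
  · subst hμν
    by_contra hcon
    push Not at hcon
    have hstep : ∀ y, (∃ r : ℂ, (f - algebraMap ℂ (Module.End ℂ W) μ) y = r • x) → ∃ r : ℂ, y = r • x := by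
      rintro y ⟨r, hr⟩
      obtain ⟨r', hr'⟩ := hcon x y r hx0 hx (by
        rw [LinearMap.sub_apply, Module.algebraMap_end_apply] at hr
        rw [← hr]; abel)
      exact ⟨r', hr'⟩
    have hall : ∀ k : ℕ, ∀ y, ((f - algebraMap ℂ (Module.End ℂ W) μ) ^ k) y = 0 → ∃ r : ℂ, y = r • x := by
      intro k
      induction k with
      | zero => intro y hy; exact ⟨0, by simpa using hy⟩
      | succ k ih =>
        intro y hy
        rw [pow_succ, Module.End.mul_apply] at hy
        exact hstep y (ih _ hy)
    have hrank := f.finrank_maxGenEigenspace_eq μ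
    have h2 : 2 ≤ Polynomial.rootMultiplicity μ f.charpoly := by
      rw [← Polynomial.count_roots]
      have := Multiset.count_le_of_le μ h
      simpa using this
    have h1 : Module.finrank ℂ (f.maxGenEigenspace μ) ≤ 1 := by
      have hxm : x ∈ f.maxGenEigenspace μ :=
        Module.End.eigenspace_le_maxGenEigenspace (Module.End.mem_eigenspace_iff.2 hx)
      refine finrank_le_one (⟨x, hxm⟩ : f.maxGenEigenspace μ) fun y => ?_
      obtain ⟨k, hk⟩ := (f.mem_maxGenEigenspace μ y).1 y.2
      obtain ⟨r, hr⟩ := hall k y hk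
      exact ⟨r, Subtype.ext hr.symm⟩
    omega
  · obtain ⟨y, hy0, hy⟩ := hev ν (by simp)
    refine ⟨x, y, 0, hx0, hx, by rw [hy, zero_smul, add_zero], fun r hr => hy0 ?_⟩
    have h1 : ν • y = μ • y := by
      rw [← hy, hr, map_smul, hx, smul_comm]
    rw [← sub_eq_zero, ← sub_smul, smul_eq_zero, sub_eq_zero] at h1
    exact h1.resolve_left fun h => hμν h.symm

/-- The determinant of a linear matrix pencil with invertible leading matrix. -/
theorem det_X_smul_sub {n : Type*} [Fintype n] [DecidableEq n] (X Y : Matrix n n ℂ)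
    (hY : Y.det ≠ 0) :
    ((Polynomial.X : Polynomial ℂ) • Y.map Polynomial.C - X.map Polynomial.C).det =
      Polynomial.C Y.det * (Y⁻¹ * X).charpoly := by
  have h1 : (Polynomial.X : Polynomial ℂ) • Y.map Polynomial.C - X.map Polynomial.C =
      Y.map Polynomial.C * (Y⁻¹ * X).charmatrix := by
    have hu : IsUnit Y.det := isUnit_iff_ne_zero.2 hY
    have h2 : X.map Polynomial.C = Y.map Polynomial.C * (Y⁻¹ * X).map Polynomial.C := by
      rw [← Matrix.map_mul, Matrix.mul_nonsing_inv_cancel_left _ _ hu]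
    rw [Matrix.charmatrix, Matrix.mul_sub, h2, Matrix.scalar_apply, ← Matrix.smul_one_eq_diagonal,
      Matrix.mul_smul, mul_one]
    rfl
  rw [h1, Matrix.det_mul, Matrix.charpoly]
  congr 1
  exact (RingHom.map_det Polynomial.C Y).symm

/-! ### Cosine vectors -/

/-- The Fourier coefficients of `cos (2 n τ)`. -/
def cosVec (n : ℤ) : Ell2 := (1 / 2 : ℂ) • (lp.single 2 n (1 : ℂ) + lp.single 2 (-n) (1 : ℂ))

/-- The Fourier coefficients of `i sin (2 n τ)`. -/
def sinVec (n : ℤ) : Ell2 := (1 / 2 : ℂ) • (lp.single 2 n (1 : ℂ) - lp.single 2 (-n) (1 : ℂ))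

theorem single_one_apply (n j : ℤ) :
    (lp.single 2 n (1 : ℂ) : Ell2) j = if j = n then 1 else 0 := by
  rw [lp.single_apply, Pi.single_apply]

theorem cosVec_apply (n j : ℤ) :
    cosVec n j = 1 / 2 * ((if j = n then 1 else 0) + if j = -n then 1 else 0) := by
  rw [← single_one_apply, ← single_one_apply]; rfl

theorem cosVec_neg (n : ℤ) : cosVec (-n) = cosVec n := by
  rw [cosVec, cosVec, neg_neg, add_comm]

theorem cosVec_mem_evenSeq (n : ℤ) : cosVec n ∈ evenSeq := by
  rw [mem_evenSeq]
  intro j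
  rw [cosVec_apply, cosVec_apply, add_comm]
  simp only [neg_eq_iff_eq_neg, neg_neg]

theorem shiftR_single (n : ℤ) : shiftR (lp.single 2 n (1 : ℂ)) = lp.single 2 (n + 1) (1 : ℂ) := by
  ext j
  rw [shiftR_apply, single_one_apply, single_one_apply]
  simp only [sub_eq_iff_eq_add]

theorem shiftL_single (n : ℤ) : shiftL (lp.single 2 n (1 : ℂ)) = lp.single 2 (n - 1) (1 : ℂ) := by
  ext j
  rw [shiftL_apply, single_one_apply, single_one_apply]
  simp only [eq_sub_iff_add_eq]

theorem shiftR_add_shiftL_cosVec (n : ℤ) :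
    shiftR (cosVec n) + shiftL (cosVec n) = cosVec (n - 1) + cosVec (n + 1) := by
  simp only [cosVec, map_smul, map_add, shiftR_single, shiftL_single, ← smul_add]
  rw [neg_add', neg_sub', sub_neg_eq_add]
  congr 1
  abel

theorem cosL_cosVec (n : ℤ) :
    cosL (cosVec n) = (1 / 2 : ℂ) • (cosVec (n - 1) + cosVec (n + 1)) := by
  rw [← shiftR_add_shiftL_cosVec]; rfl

theorem shiftR_sub_shiftL_sinVec (n : ℤ) :
    shiftR (sinVec n) - shiftL (sinVec n) = cosVec (n + 1) - cosVec (n - 1) := by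
  simp only [cosVec, sinVec, map_smul, map_sub, shiftR_single, shiftL_single, ← smul_sub]
  rw [neg_add', neg_sub', sub_neg_eq_add]
  congr 1
  abel

theorem invL_cosVec (n : ℤ) : invL (cosVec n) = (1 + (n : ℂ) ^ 2)⁻¹ • cosVec n := by
  ext j
  rw [invL_apply, lp.coeFn_smul, Pi.smul_apply, smul_eq_mul, cosVec_apply]
  by_cases h1 : j = n
  · rw [h1]
  · by_cases h2 : j = -n
    · rw [h2]; simp
    · simp [h1, h2]

theorem invDerivL_cosVec (n : ℤ) :
    invDerivL (cosVec n) = ((n : ℂ) * (1 + (n : ℂ) ^ 2)⁻¹) • sinVec n := by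
  ext j
  have e : sinVec n j = 1 / 2 * ((if j = n then 1 else 0) - if j = -n then 1 else 0) := by
    rw [← single_one_apply, ← single_one_apply]; rfl
  rw [invDerivL_apply, lp.coeFn_smul, Pi.smul_apply, smul_eq_mul, cosVec_apply, e]
  rcases eq_or_ne n 0 with rfl | hn
  · by_cases h1 : j = 0 <;> simp [h1]
  by_cases h1 : j = n
  · have : n ≠ -n := fun h => hn (by omega)
    simp [h1, this]
  · by_cases h2 : j = -n
    · have : -n ≠ n := fun h => hn (by omega)
      simp [h2, this]
    · simp [h1, h2]

/-- The span of `cos (2 n τ)`, `n = 0, …, N`. -/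
def cosSpan (N : ℕ) : Submodule ℂ Ell2 :=
  Submodule.span ℂ (Set.range fun n : Fin (N + 1) => cosVec (n : ℕ))

instance (N : ℕ) : FiniteDimensional ℂ (cosSpan N) :=
  FiniteDimensional.span_of_finite ℂ (Set.finite_range _)

/-- Linear combinations of `cos (2 n τ)`, `n = 0, …, N`. -/
def cosComb (N : ℕ) : (Fin (N + 1) → ℂ) →ₗ[ℂ] Ell2 :=
  Fintype.linearCombination ℂ fun n : Fin (N + 1) => cosVec (n : ℕ)

theorem cosComb_apply (N : ℕ) (x : Fin (N + 1) → ℂ) :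
    cosComb N x = ∑ n : Fin (N + 1), x n • cosVec (n : ℕ) := rfl

theorem range_cosComb (N : ℕ) : LinearMap.range (cosComb N) = cosSpan N :=
  Fintype.range_linearCombination ℂ _

theorem cosComb_mem (N : ℕ) (x : Fin (N + 1) → ℂ) : cosComb N x ∈ cosSpan N := by
  rw [← range_cosComb]; exact ⟨x, rfl⟩

theorem cosVec_mem_cosSpan {N : ℕ} {n : ℤ} (hn : n.natAbs ≤ N) : cosVec n ∈ cosSpan N := by
  have h : cosVec n = cosVec (n.natAbs : ℕ) := by
    rcases Int.natAbs_eq n with h | h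
    · rw [← h]
    · conv_lhs => rw [h]
      exact cosVec_neg _
  rw [h]
  exact Submodule.subset_span ⟨⟨n.natAbs, by omega⟩, rfl⟩

/-- For j > 0 the two unit vectors in `cosVec j` are distinct and each has weight 1/2; at j = 0 they
coincide. -/
theorem cosComb_coord (N : ℕ) (x : Fin (N + 1) → ℂ) (j : Fin (N + 1)) :
    cosComb N x ((j : ℕ) : ℤ) = (if (j : ℕ) = 0 then 1 else 1 / 2) * x j := by
  rw [cosComb_apply, lp.coeFn_sum, Finset.sum_apply, Finset.sum_eq_single j]
  · rw [lp.coeFn_smul, Pi.smul_apply, cosVec_apply, smul_eq_mul]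
    by_cases h : (j : ℕ) = 0
    · simp [h]; ring
    · have : ((j : ℕ) : ℤ) ≠ -((j : ℕ) : ℤ) := by omega
      simp [h, this]; ring
  · intro i _ hij
    rw [lp.coeFn_smul, Pi.smul_apply, cosVec_apply]
    have h1 : ((j : ℕ) : ℤ) ≠ ((i : ℕ) : ℤ) := fun h => hij (Fin.ext (by omega))
    have h2 : ((j : ℕ) : ℤ) ≠ -((i : ℕ) : ℤ) := fun h => hij (Fin.ext (by omega))
    simp [h1, h2]
  · simp

theorem cosComb_injective (N : ℕ) : Function.Injective (cosComb N) := by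
  rw [injective_iff_map_eq_zero]
  intro x hx
  ext j
  have h := cosComb_coord N x j
  rw [hx] at h
  have h2 : (if (j : ℕ) = 0 then 1 else 1 / 2 : ℂ) ≠ 0 := by split_ifs <;> norm_num
  exact (mul_eq_zero.1 h.symm).resolve_left h2

theorem inner_cosVec (m n : ℤ) (h : m.natAbs ≠ n.natAbs) : inner ℂ (cosVec m) (cosVec n) = 0 := by
  rw [Ell2.inner_eq]
  refine (tsum_congr fun j => ?_).trans tsum_zero
  rw [cosVec_apply, cosVec_apply]
  by_cases h1 : j.natAbs = m.natAbs
  · have h2 : j ≠ n := fun e => h (by rw [← h1, e])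
    have h3 : j ≠ -n := fun e => h (by rw [← h1, e, Int.natAbs_neg])
    simp [h2, h3]
  · have h2 : j ≠ m := fun e => h1 (by rw [e])
    have h3 : j ≠ -m := fun e => h1 (by rw [e, Int.natAbs_neg])
    simp [h2, h3]

/-- A cosine either belongs to the span or is orthogonal to it. Dropping the coefficients beyond N
is thus an orthogonal projection, which is why the truncated matrices are Galerkin matrices. -/
theorem starProjection_cosVec (N : ℕ) (m : ℤ) :
    (cosSpan N).starProjection (cosVec m) =
      cosComb N fun j => ((cosCoeff m j : ℝ) : ℂ) := by
  by_cases hm : m.natAbs ≤ N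
  · rw [Submodule.starProjection_eq_self_iff.2 (cosVec_mem_cosSpan hm), cosComb_apply,
      Finset.sum_eq_single (⟨m.natAbs, by omega⟩ : Fin (N + 1))]
    · have h : cosVec m = cosVec (m.natAbs : ℕ) := by
        rcases Int.natAbs_eq m with h | h
        · rw [← h]
        · conv_lhs => rw [h]
          exact cosVec_neg _
      simp [cosCoeff, h]
    · intro j _ hj
      have : m.natAbs ≠ j := fun h => hj (Fin.ext h.symm)
      simp [cosCoeff, this]
    · simp
  · have h0 : (fun j : Fin (N + 1) => ((cosCoeff m j : ℝ) : ℂ)) = 0 := by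
      ext j
      have : m.natAbs ≠ j := by omega
      simp [cosCoeff, this]
    rw [h0, map_zero, Submodule.starProjection_apply_eq_zero_iff, Submodule.mem_orthogonal,
      ← range_cosComb]
    rintro _ ⟨x, rfl⟩
    rw [cosComb_apply, sum_inner]
    refine Finset.sum_eq_zero fun n _ => ?_
    rw [inner_smul_left, inner_cosVec _ _ (by rw [Int.natAbs_natCast]; omega), mul_zero]

theorem invL_mem_cosSpan (N : ℕ) (v : Ell2) (hv : v ∈ cosSpan N) : invL v ∈ cosSpan N := by
  rw [← range_cosComb] at hv
  obtain ⟨x, rfl⟩ := hv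
  rw [cosComb_apply, map_sum]
  refine Submodule.sum_mem _ fun n _ => ?_
  rw [map_smul, invL_cosVec]
  exact Submodule.smul_mem _ _ (Submodule.smul_mem _ _ (cosVec_mem_cosSpan (by simp; omega)))

/-- The symmetric partial sums of an even sequence are averages over n and -n, hence combinations of
cosines; they converge to the sequence, and the projections contract the remainders. -/
theorem isApproximating_cosSpan : IsApproximating evenSeq cosSpan := by
  refine ⟨fun N => Submodule.span_le.2 ?_, fun x hx => ?_⟩
  · rintro _ ⟨n, rfl⟩
    exact cosVec_mem_evenSeq _
  set y : ℕ → Ell2 := fun N => ∑ n ∈ Finset.Icc (-(N : ℤ)) N, lp.single 2 n (x n) with hy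
  have hylim : Tendsto y atTop (𝓝 x) :=
    (lp.hasSum_single (by norm_num) x).comp
      (Finset.tendsto_Icc_neg_atTop_atTop.comp tendsto_natCast_atTop_atTop)
  have hymem : ∀ N, y N ∈ cosSpan N := by
    intro N
    rw [mem_evenSeq] at hx
    have h1 : y N = ∑ n ∈ Finset.Icc (-(N : ℤ)) N, lp.single 2 (-n) (x n) := by
      refine Finset.sum_nbij' (fun n => -n) (fun n => -n) ?_ ?_ ?_ ?_ ?_
      · intro n hn; simp only [Finset.mem_Icc] at hn ⊢; omega
      · intro n hn; simp only [Finset.mem_Icc] at hn ⊢; omega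
      · intro n _; exact neg_neg n
      · intro n _; exact neg_neg n
      · intro n _; rw [neg_neg, hx]
    have h2 : y N = ∑ n ∈ Finset.Icc (-(N : ℤ)) N, x n • cosVec n := by
      have h3 : y N = (1 / 2 : ℂ) • (y N + y N) := by
        rw [← two_smul ℂ (y N), smul_smul]; norm_num
      rw [h3]
      nth_rewrite 2 [h1]
      rw [hy, ← Finset.sum_add_distrib, Finset.smul_sum]
      refine Finset.sum_congr rfl fun n _ => ?_
      have h4 : ∀ j : ℤ, (lp.single 2 j (x n) : Ell2) = x n • lp.single 2 j (1 : ℂ) := fun j => by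
        rw [← lp.single_smul, smul_eq_mul, mul_one]
      rw [h4, h4, cosVec, ← smul_add, smul_comm]
    rw [h2]
    refine Submodule.sum_mem _ fun n hn => Submodule.smul_mem _ _ (cosVec_mem_cosSpan ?_)
    simp only [Finset.mem_Icc] at hn
    omega
  have h1 : ∀ N, (cosSpan N).starProjection x = y N + (cosSpan N).starProjection (x - y N) := by
    intro N
    rw [map_sub, Submodule.starProjection_eq_self_iff.2 (hymem N)]; abel
  have h2 : Tendsto (fun N => (cosSpan N).starProjection (x - y N)) atTop (𝓝 0) := by
    refine squeeze_zero_norm (fun N => (cosSpan N).norm_starProjection_apply_le _) ?_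
    have := (tendsto_const_nhds (x := x)).sub hylim
    simpa using this.norm
  simp only [h1]
  simpa using hylim.add h2

/-! ### The truncated matrices represent the projected pencil -/

namespace Coeffs

variable (m : Coeffs)

theorem QL_cosVec (n : ℤ) : m.QL (cosVec n) =
    (m.A : ℂ) • cosVec n - (m.B / 2 : ℂ) • (cosVec (n - 1) + cosVec (n + 1)) := by
  rw [QL_eq, cosL_cosVec, smul_smul]
  congr 2
  ring

theorem DL_cosVec (n : ℤ) : m.DL (cosVec n) =
    (m.C : ℂ) • cosVec n - (m.E / 2 : ℂ) • (cosVec (n - 1) + cosVec (n + 1)) := by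
  rw [DL_eq, cosL_cosVec, smul_smul]
  congr 2
  ring

theorem QL_DL_cosVec (n : ℤ) : m.QL (m.DL (cosVec n)) =
    (m.A * m.C + m.B * m.E / 2 : ℂ) • cosVec n -
      ((m.A * m.E + m.B * m.C) / 2 : ℂ) • (cosVec (n - 1) + cosVec (n + 1)) +
      (m.B * m.E / 4 : ℂ) • (cosVec (n - 2) + cosVec (n + 2)) := by
  rw [DL_cosVec, map_sub, map_smul, map_smul, map_add, QL_cosVec, QL_cosVec, QL_cosVec,
    show n - 1 - 1 = n - 2 by ring, show n - 1 + 1 = n by ring, show n + 1 - 1 = n by ring,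
    show n + 1 + 1 = n + 2 by ring]
  module

theorem QL_QL_cosVec (n : ℤ) : m.QL (m.QL (cosVec n)) =
    (m.A * m.A + m.B * m.B / 2 : ℂ) • cosVec n -
      (m.A * m.B : ℂ) • (cosVec (n - 1) + cosVec (n + 1)) +
      (m.B * m.B / 4 : ℂ) • (cosVec (n - 2) + cosVec (n + 2)) := by
  have h : m.QL (m.QL (cosVec n)) = _ := m.square.QL_DL_cosVec n
  rw [h]
  change (m.A * m.A + m.B * m.B / 2 : ℂ) • cosVec n -
      ((m.A * m.B + m.B * m.A) / 2 : ℂ) • (cosVec (n - 1) + cosVec (n + 1)) +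
      (m.B * m.B / 4 : ℂ) • (cosVec (n - 2) + cosVec (n + 2)) = _
  module

theorem kL_cosVec (n : ℤ) : m.kL (cosVec n) =
    (m.E : ℂ) • cosVec n + (m.E / 2 : ℂ) • (cosVec (n - 1) + cosVec (n + 1)) := by
  change (m.E : ℂ) • (cosVec n + cosL (cosVec n)) = _
  rw [cosL_cosVec]
  module

theorem kL_QL_QL_cosVec (n : ℤ) : m.kL (m.QL (m.QL (cosVec n))) =
    (m.E * (m.A * m.A + m.B * m.B / 2 - m.A * m.B) : ℂ) • cosVec n +
      (m.E * (-(m.A * m.B) + (m.A * m.A + m.B * m.B / 2) / 2 + m.B * m.B / 8) : ℂ) •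
        (cosVec (n - 1) + cosVec (n + 1)) +
      (m.E * (m.B * m.B / 4 - m.A * m.B / 2) : ℂ) • (cosVec (n - 2) + cosVec (n + 2)) +
      (m.E * (m.B * m.B / 8) : ℂ) • (cosVec (n - 3) + cosVec (n + 3)) := by
  rw [QL_QL_cosVec, map_add, map_sub, map_smul, map_smul, map_smul, map_add, map_add, kL_cosVec,
    kL_cosVec, kL_cosVec, kL_cosVec, kL_cosVec,
    show n - 1 - 1 = n - 2 by ring, show n - 1 + 1 = n by ring, show n + 1 - 1 = n by ring,
    show n + 1 + 1 = n + 2 by ring, show n - 2 - 1 = n - 3 by ring, show n - 2 + 1 = n - 1 by ring,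
    show n + 2 - 1 = n + 1 by ring, show n + 2 + 1 = n + 3 by ring]
  module

/-- The weight 1 + n² cancels the one built into the pencil, so that the differential operator
itself acts on cos 2nτ and the columns of D_N, C_N, B_N can be read off. -/
theorem pencil_T_cosVec (h : ℂ) (n : ℤ) : m.pencil.T h ((1 + (n : ℂ) ^ 2) • cosVec n) =
    (4 * (n : ℂ) ^ 2) • m.QL (m.DL (cosVec n)) +
      (m.R * n : ℂ) • (cosVec (n - 1) - cosVec (n + 1)) +
      (m.lam : ℂ) • m.kL (m.QL (m.QL (cosVec n))) - h • m.QL (m.QL (cosVec n)) := by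
  have h0 := one_add_sq_ne_zero n
  have e1 : invL ((1 + (n : ℂ) ^ 2) • cosVec n) = cosVec n := by
    rw [map_smul, invL_cosVec, smul_smul, mul_inv_cancel₀ h0, one_smul]
  have e2 : (1 + (n : ℂ) ^ 2) • cosVec n - cosVec n = ((n : ℂ) ^ 2) • cosVec n := by
    module
  have e3 : m.rL (invDerivL ((1 + (n : ℂ) ^ 2) • cosVec n)) =
      (m.R * n : ℂ) • (cosVec (n + 1) - cosVec (n - 1)) := by
    rw [map_smul, invDerivL_cosVec, smul_smul, ← shiftR_sub_shiftL_sinVec,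
      show (1 + (n : ℂ) ^ 2) * ((n : ℂ) * (1 + (n : ℂ) ^ 2)⁻¹) = n by field_simp, map_smul]
    change (n : ℂ) • ((m.R : ℂ) • (shiftR (sinVec n) - shiftL (sinVec n))) = _
    rw [smul_smul, mul_comm]
  rw [pencil_T_apply, e3, e1, e2, map_smul, map_smul]
  module

theorem pencil_S_cosVec (n : ℤ) : m.pencil.S ((1 + (n : ℂ) ^ 2) • cosVec n) =
    m.QL (m.QL (cosVec n)) := by
  rw [pencil_S_apply, map_smul, invL_cosVec, smul_smul, mul_inv_cancel₀ (one_add_sq_ne_zero n),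
    one_smul]

end Coeffs

/-! ### The parameters determined by the semi-axes -/

theorem kSq_pos {a b c : ℝ} (hab : b < a) (hbc : c < b) (hc : 0 < c) : 0 < kSq a b c :=
  div_pos (by nlinarith) (by nlinarith)

theorem kSq_lt_one {a b c : ℝ} (hab : b < a) (hbc : c < b) (hc : 0 < c) : kSq a b c < 1 := by
  rw [kSq, div_lt_one (by nlinarith)]
  nlinarith

theorem kSq_mul {a b c : ℝ} (hab : b < a) (hbc : c < b) (hc : 0 < c) :
    kSq a b c * (a ^ 2 - c ^ 2) = a ^ 2 - b ^ 2 :=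
  div_mul_cancel₀ _ (by nlinarith)

/-- The parameters belonging to the semi-axes `a > b > c > 0`. -/
def axesCoeffs (a b c lam : ℝ) (hab : b < a) (hbc : c < b) (hc : 0 < c) : Coeffs where
  A := (a ^ 2 + b ^ 2) / 2
  B := (a ^ 2 - b ^ 2) / 2
  C := 1 - kSq a b c / 2
  E := kSq a b c / 2
  R := c ^ 2 * kSq a b c / 2
  lam := lam
  B_pos := by nlinarith
  B_lt := by nlinarith
  E_pos := by linarith [kSq_pos hab hbc hc]
  E_lt := by linarith [kSq_lt_one hab hbc hc]
  R_eq := by linarith [kSq_mul hab hbc hc]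

section Matrices

variable {a b c lam : ℝ} (hab : b < a) (hbc : c < b) (hc : 0 < c) (N : ℕ)

/-- The vector of the pencil that corresponds to a coefficient vector. -/
def cosLift (N : ℕ) (x : Fin (N + 1) → ℂ) : Ell2 :=
  ∑ n : Fin (N + 1), x n • (1 + (((n : ℕ) : ℤ) : ℂ) ^ 2) • cosVec (n : ℕ)

theorem cosLift_eq (N : ℕ) (x : Fin (N + 1) → ℂ) :
    cosLift N x = cosComb N fun n => x n * (1 + (((n : ℕ) : ℤ) : ℂ) ^ 2) := by
  simp only [cosLift, cosComb_apply, smul_smul]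

theorem cosLift_mem (N : ℕ) (x : Fin (N + 1) → ℂ) : cosLift N x ∈ cosSpan N := by
  rw [cosLift_eq]; exact cosComb_mem _ _

theorem cosLift_smul (N : ℕ) (r : ℂ) (x : Fin (N + 1) → ℂ) :
    cosLift N (r • x) = r • cosLift N x := by
  rw [cosLift_eq, cosLift_eq, ← map_smul]
  congr 1
  ext n
  simp [mul_assoc]

theorem cosLift_injective (N : ℕ) : Function.Injective (cosLift N) := by
  intro x y h
  rw [cosLift_eq, cosLift_eq] at h
  have h1 := cosComb_injective N h
  ext n
  have := congrFun h1 n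
  exact mul_right_cancel₀ (one_add_sq_ne_zero _) this

theorem cosLift_zero (N : ℕ) : cosLift N 0 = 0 := by simp [cosLift]

theorem exists_cosLift {v : Ell2} (hv : v ∈ cosSpan N) : ∃ x, cosLift N x = v := by
  rw [← range_cosComb] at hv
  obtain ⟨y, rfl⟩ := hv
  refine ⟨fun n => y n * (1 + (((n : ℕ) : ℤ) : ℂ) ^ 2)⁻¹, ?_⟩
  rw [cosLift_eq]
  congr 1
  ext n
  rw [inv_mul_cancel_right₀ (one_add_sq_ne_zero _)]

/-- The matrix `B_N` with complex entries. -/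
def matBC (a b : ℝ) (N : ℕ) : Matrix (Fin (N + 1)) (Fin (N + 1)) ℂ :=
  (matB a b N).map fun x : ℝ => (x : ℂ)

/-- The matrix `D_N + lam C_N` with complex entries. -/
def matAC (a b c lam : ℝ) (N : ℕ) : Matrix (Fin (N + 1)) (Fin (N + 1)) ℂ :=
  (matD a b c N + lam • matC a b c N).map fun x : ℝ => (x : ℂ)

theorem starProjection_QL_QL_cosVec (n : Fin (N + 1)) :
    (cosSpan N).starProjection ((axesCoeffs a b c lam hab hbc hc).QL
      ((axesCoeffs a b c lam hab hbc hc).QL (cosVec (n : ℕ)))) =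
      cosComb N fun j => matBC a b N j n := by
  rw [Coeffs.QL_QL_cosVec]
  simp only [map_add, map_sub, map_smul, starProjection_cosVec]
  simp only [← map_add, ← map_sub, ← map_smul]
  congr 1
  ext j
  simp only [Pi.add_apply, Pi.sub_apply, Pi.smul_apply, smul_eq_mul, matBC, matB, axesCoeffs,
    Matrix.map_apply, Matrix.of_apply]
  push_cast
  ring

theorem starProjection_T_cosVec (h : ℂ) (n : Fin (N + 1)) :
    (cosSpan N).starProjection ((axesCoeffs a b c lam hab hbc hc).pencil.T h
      ((1 + (((n : ℕ) : ℤ) : ℂ) ^ 2) • cosVec (n : ℕ))) =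
      cosComb N fun j => (matAC a b c lam N - h • matBC a b N) j n := by
  rw [Coeffs.pencil_T_cosVec, Coeffs.kL_QL_QL_cosVec, Coeffs.QL_DL_cosVec, map_sub, map_smul,
    starProjection_QL_QL_cosVec]
  simp only [map_add, map_sub, map_smul, starProjection_cosVec]
  simp only [← map_add, ← map_sub, ← map_smul]
  congr 1
  ext j
  simp only [Pi.add_apply, Pi.sub_apply, Pi.smul_apply, smul_eq_mul, matAC, matD, matC, axesCoeffs,
    Matrix.map_apply, Matrix.of_apply, Matrix.sub_apply, Matrix.add_apply, Matrix.smul_apply]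
  push_cast
  ring

theorem sum_smul_cosComb (x : Fin (N + 1) → ℂ) (M : Matrix (Fin (N + 1)) (Fin (N + 1)) ℂ) :
    ∑ n, x n • cosComb N (fun j => M j n) = cosComb N (M.mulVec x) := by
  simp only [← map_smul, ← map_sum]
  congr 1
  ext j
  simp [Matrix.mulVec, dotProduct, mul_comm]

theorem starProjection_T_cosLift (h : ℂ) (x : Fin (N + 1) → ℂ) :
    (cosSpan N).starProjection ((axesCoeffs a b c lam hab hbc hc).pencil.T h (cosLift N x)) =
      cosComb N ((matAC a b c lam N - h • matBC a b N).mulVec x) := by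
  rw [cosLift, map_sum, map_sum, ← sum_smul_cosComb]
  refine Finset.sum_congr rfl fun n _ => ?_
  rw [map_smul, map_smul, starProjection_T_cosVec]

theorem starProjection_S_cosLift (x : Fin (N + 1) → ℂ) :
    (cosSpan N).starProjection ((axesCoeffs a b c lam hab hbc hc).pencil.S (cosLift N x)) =
      cosComb N ((matBC a b N).mulVec x) := by
  rw [cosLift, map_sum, map_sum, ← sum_smul_cosComb]
  refine Finset.sum_congr rfl fun n _ => ?_
  rw [map_smul, map_smul, Coeffs.pencil_S_cosVec, starProjection_QL_QL_cosVec]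

/-- A kernel vector gives u in the span with `QL (QL u)` orthogonal to the span. Then ⟨u, Q²u⟩ = 0,
which positivity of Q² permits only for u = 0. Consequently the characteristic polynomial has degree
N + 1. -/
theorem det_matBC_ne_zero
    {a b c : ℝ} (hab : b < a) (hbc : c < b) (hc : 0 < c) (N : ℕ) : (matBC a b N).det ≠ 0 := by
  intro hdet
  obtain ⟨x, hx0, hx⟩ := Matrix.exists_mulVec_eq_zero_iff.2 hdet
  set m := axesCoeffs a b c 0 hab hbc hc with hm
  have h1 := starProjection_S_cosLift (lam := 0) hab hbc hc N x
  rw [hx, map_zero, ← hm, Coeffs.pencil_S_apply] at h1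
  set u := invL (cosLift N x) with hu
  have huU : u ∈ cosSpan N := invL_mem_cosSpan N _ (cosLift_mem N x)
  have h2 : inner ℂ u (m.QL (m.QL u)) = 0 := by
    rw [← Submodule.starProjection_eq_self_iff.2 huU, Submodule.inner_starProjection_left_eq_right,
      Submodule.starProjection_eq_self_iff.2 huU, h1, inner_zero_right]
  have h3 := m.re_inner_QL_QL u
  rw [h2, Complex.zero_re] at h3
  have h4 : 0 < (m.A - m.B) ^ 2 := by have := sub_pos.2 m.B_lt; positivity
  have h5 : u = 0 := by
    by_contra h0
    have : 0 < ‖u‖ := norm_pos_iff.2 h0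
    have : 0 < (m.A - m.B) ^ 2 * ‖u‖ ^ 2 := by positivity
    linarith
  have h6 : cosLift N x = 0 := by
    ext n
    have : u n = 0 := by rw [h5]; rfl
    rw [hu, invL_apply, mul_eq_zero] at this
    exact this.resolve_left (inv_ne_zero (one_add_sq_ne_zero n))
  exact hx0 (cosLift_injective N (h6.trans (cosLift_zero N).symm))

theorem pencilPoly_eq
    {a b c lam : ℝ} (hab : b < a) (hbc : c < b) (hc : 0 < c) (N : ℕ) : pencilPoly a b c lam N =
    Polynomial.C (matBC a b N).det * ((matBC a b N)⁻¹ * matAC a b c lam N).charpoly := by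
  rw [← det_X_smul_sub _ _ (det_matBC_ne_zero hab hbc hc N)]
  rfl

theorem roots_pencilPoly
    {a b c lam : ℝ} (hab : b < a) (hbc : c < b) (hc : 0 < c) (N : ℕ) : (pencilPoly a b c lam N).roots =
    ((matBC a b N)⁻¹ * matAC a b c lam N).charpoly.roots := by
  rw [pencilPoly_eq hab hbc hc, Polynomial.roots_C_mul _ (det_matBC_ne_zero hab hbc hc N)]

theorem card_roots_pencilPoly
    {a b c lam : ℝ} (hab : b < a) (hbc : c < b) (hc : 0 < c) (N : ℕ) : (pencilPoly a b c lam N).roots.card = N + 1 := by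
  rw [roots_pencilPoly hab hbc hc, IsAlgClosed.card_roots_eq_natDegree,
    Matrix.charpoly_natDegree_eq_dim, Fintype.card_fin]

/-- `cosLift` is a bijection from coefficient vectors to the span and intertwines the matrix pencil
with the projected operator pencil; this is the bridge between determinants and Galerkin equations.
-/
theorem isProjEigenvalue_iff (h : ℂ) :
    (axesCoeffs a b c lam hab hbc hc).pencil.IsProjEigenvalue (cosSpan N) h ↔
      h ∈ (pencilPoly a b c lam N).roots := by
  have hB := det_matBC_ne_zero hab hbc hc N
  have hu : IsUnit (matBC a b N).det := isUnit_iff_ne_zero.2 hB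
  have key : h ∈ (pencilPoly a b c lam N).roots ↔
      ∃ x, x ≠ 0 ∧ (matAC a b c lam N - h • matBC a b N).mulVec x = 0 := by
    rw [roots_pencilPoly hab hbc hc, Polynomial.mem_roots (Matrix.charpoly_monic _).ne_zero,
      Polynomial.IsRoot, Matrix.eval_charpoly, Matrix.exists_mulVec_eq_zero_iff]
    have e : matAC a b c lam N - h • matBC a b N =
        (-matBC a b N) * (Matrix.scalar _ h - (matBC a b N)⁻¹ * matAC a b c lam N) := by
      rw [Matrix.mul_sub, Matrix.neg_mul, Matrix.neg_mul, Matrix.mul_nonsing_inv_cancel_left _ _ hu,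
        Matrix.scalar_apply, ← Matrix.smul_one_eq_diagonal, Matrix.mul_smul, mul_one]
      abel
    rw [e, Matrix.det_mul, mul_eq_zero, Matrix.det_neg]
    have : (-1 : ℂ) ^ Fintype.card (Fin (N + 1)) * (matBC a b N).det ≠ 0 :=
      mul_ne_zero (pow_ne_zero _ (by norm_num)) hB
    exact ⟨Or.inr, fun h => h.resolve_left this⟩
  rw [key]
  constructor
  · rintro ⟨v, hv, hv0, hTv⟩
    obtain ⟨x, rfl⟩ := exists_cosLift N hv
    rw [starProjection_T_cosLift] at hTv
    exact ⟨x, fun h0 => hv0 (by rw [h0, cosLift_zero]),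
      cosComb_injective N (hTv.trans (map_zero _).symm)⟩
  · rintro ⟨x, hx0, hx⟩
    refine ⟨cosLift N x, cosLift_mem N x,
      fun h0 => hx0 (cosLift_injective N (h0.trans (cosLift_zero N).symm)), ?_⟩
    rw [starProjection_T_cosLift, hx, map_zero]

/-- Two roots of the characteristic polynomial yield a chain of the projected pencil. -/
theorem exists_chain_of_roots {μ ν : ℂ}
    (h : ({μ, ν} : Multiset ℂ) ≤ (pencilPoly a b c lam N).roots) :
    ∃ v ∈ cosSpan N, ∃ w ∈ cosSpan N, ∃ κ : ℂ, v ≠ 0 ∧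
      (cosSpan N).starProjection ((axesCoeffs a b c lam hab hbc hc).pencil.T μ v) = 0 ∧
      (cosSpan N).starProjection ((axesCoeffs a b c lam hab hbc hc).pencil.T ν w) =
        κ • (cosSpan N).starProjection ((axesCoeffs a b c lam hab hbc hc).pencil.S v) ∧
      ∀ r : ℂ, w ≠ r • v := by
  have hu : IsUnit (matBC a b N).det := isUnit_iff_ne_zero.2 (det_matBC_ne_zero hab hbc hc N)
  rw [roots_pencilPoly hab hbc hc, ← Matrix.charpoly_toLin'] at h
  obtain ⟨x, y, κ, hx0, hx, hy, hxy⟩ := exists_chain_of_roots_charpoly _ h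
  rw [Matrix.toLin'_apply] at hx hy
  have hA : ∀ z, (matAC a b c lam N).mulVec z =
      (matBC a b N).mulVec (((matBC a b N)⁻¹ * matAC a b c lam N).mulVec z) := fun z => by
    rw [Matrix.mulVec_mulVec, Matrix.mul_nonsing_inv_cancel_left _ _ hu]
  refine ⟨cosLift N x, cosLift_mem N x, cosLift N y, cosLift_mem N y, κ,
    fun h0 => hx0 (cosLift_injective N (h0.trans (cosLift_zero N).symm)), ?_, ?_, fun r hr => ?_⟩
  · rw [starProjection_T_cosLift, Matrix.sub_mulVec, hA, hx, Matrix.mulVec_smul,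
      Matrix.smul_mulVec, sub_self, map_zero]
  · rw [starProjection_T_cosLift, starProjection_S_cosLift, Matrix.sub_mulVec, hA, hy,
      Matrix.mulVec_add, Matrix.mulVec_smul, Matrix.mulVec_smul, Matrix.smul_mulVec,
      add_sub_cancel_left, map_smul]
  · rw [← cosLift_smul] at hr
    exact hxy r (cosLift_injective N hr)

/-- The eigenvalues of the truncated problem can be listed in increasing order of real parts. -/
theorem exists_isPencilEigenvalueList
    {a b c lam : ℝ} (hab : b < a) (hbc : c < b) (hc : 0 < c) (N : ℕ) : ∃ g : ℕ → ℂ, IsPencilEigenvalueList a b c lam N g := by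
  set l := (pencilPoly a b c lam N).roots.toList with hl
  have hlen : l.length = N + 1 := by
    rw [hl, Multiset.length_toList, card_roots_pencilPoly hab hbc hc]
  let l' := l.mergeSort fun x y => decide (x.re ≤ y.re)
  have hlen' : l'.length = N + 1 := by rw [List.length_mergeSort, hlen]
  have hpw : l'.Pairwise fun x y => x.re ≤ y.re := by
    have := List.pairwise_mergeSort (le := fun x y : ℂ => decide (x.re ≤ y.re))
      (fun x y z h1 h2 => by simp only [decide_eq_true_eq] at *; linarith)
      (fun x y => by simp [le_total]) l
    simpa using this
  refine ⟨fun n => l'.getD n 0, ?_, fun i j hij hj => ?_⟩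
  · have h1 : (List.range (N + 1)).map (fun n => l'.getD n 0) = l' := by
      refine List.ext_getElem (by simp [hlen']) fun i h1 h2 => ?_
      simp [h2]
    have h2 : (Multiset.range (N + 1)).map (fun n => l'.getD n 0) = (l' : Multiset ℂ) := by
      rw [← h1]
      simp only [h1]
      change ((List.range (N + 1)).map (fun n => l'.getD n 0) : Multiset ℂ) = _
      rw [h1]
    rw [h2, Multiset.coe_eq_coe.2 (List.mergeSort_perm l _), hl, Multiset.coe_toList]
  · rcases hij.eq_or_lt with rfl | hlt
    · exact le_rfl
    · have h1 : i < l'.length := by omega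
      have h2 : j < l'.length := by omega
      simp only [List.getD_eq_getElem _ _ h1, List.getD_eq_getElem _ _ h2]
      exact List.pairwise_iff_getElem.1 hpw i j h1 h2 hlt

end Matrices

/-! ### From sequences to functions -/

/-- A bounded nonnegative sequence is summable if its values exceed a strict multiple of the
average of their neighbours by a summable amount at most. -/
theorem summable_of_le_average {X g : ℤ → ℝ} {α β M : ℝ} (hX : ∀ n, 0 ≤ X n) (hM : ∀ n, X n ≤ M)
    (hg : Summable g) (hg0 : ∀ n, 0 ≤ g n) (hβ : 0 ≤ β) (hαβ : β < α)
    (h : ∀ n, α * X n ≤ g n + β * ((X (n - 1) + X (n + 1)) / 2)) : Summable X := by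
  -- Summed over a symmetric box, each shifted sum exceeds the unshifted one by at most a single
  -- boundary term, bounded by M. Since β < α, the sums over X can be collected on the left.
  have hbox : ∀ N : ℕ, ∑ n ∈ Finset.Icc (-(N : ℤ)) N, X n ≤ (∑' n, g n + β * M) / (α - β) := by
    intro N
    set s := Finset.Icc (-(N : ℤ)) N with hs
    have h1 : ∑ n ∈ s, X (n - 1) ≤ ∑ n ∈ s, X n + M := by
      have e : ∑ n ∈ s, X (n - 1) = ∑ n ∈ s.image (fun n => n - 1), X n := by
        rw [Finset.sum_image (fun x _ y _ hxy => by simpa using hxy)]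
      have hsub : s.image (fun n => n - 1) ⊆ insert (-(N : ℤ) - 1) s := by
        intro n hn
        simp only [hs, Finset.mem_image, Finset.mem_Icc, Finset.mem_insert] at hn ⊢
        obtain ⟨k, hk, rfl⟩ := hn
        omega
      have hnot : -(N : ℤ) - 1 ∉ s := by simp [hs]
      calc ∑ n ∈ s, X (n - 1) = _ := e
        _ ≤ ∑ n ∈ insert (-(N : ℤ) - 1) s, X n :=
          Finset.sum_le_sum_of_subset_of_nonneg hsub fun n _ _ => hX n
        _ = X (-(N : ℤ) - 1) + ∑ n ∈ s, X n := Finset.sum_insert hnot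
        _ ≤ _ := by linarith [hM (-(N : ℤ) - 1)]
    have h2 : ∑ n ∈ s, X (n + 1) ≤ ∑ n ∈ s, X n + M := by
      have e : ∑ n ∈ s, X (n + 1) = ∑ n ∈ s.image (fun n => n + 1), X n := by
        rw [Finset.sum_image (fun x _ y _ hxy => by simpa using hxy)]
      have hsub : s.image (fun n => n + 1) ⊆ insert ((N : ℤ) + 1) s := by
        intro n hn
        simp only [hs, Finset.mem_image, Finset.mem_Icc, Finset.mem_insert] at hn ⊢
        obtain ⟨k, hk, rfl⟩ := hn
        omega
      have hnot : (N : ℤ) + 1 ∉ s := by simp [hs]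
      calc ∑ n ∈ s, X (n + 1) = _ := e
        _ ≤ ∑ n ∈ insert ((N : ℤ) + 1) s, X n :=
          Finset.sum_le_sum_of_subset_of_nonneg hsub fun n _ _ => hX n
        _ = X ((N : ℤ) + 1) + ∑ n ∈ s, X n := Finset.sum_insert hnot
        _ ≤ _ := by linarith [hM ((N : ℤ) + 1)]
    have h3 : α * ∑ n ∈ s, X n ≤ ∑ n ∈ s, g n +
        β * ((∑ n ∈ s, X (n - 1) + ∑ n ∈ s, X (n + 1)) / 2) := by
      rw [Finset.mul_sum, ← Finset.sum_add_distrib, Finset.sum_div, Finset.mul_sum,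
        ← Finset.sum_add_distrib]
      exact Finset.sum_le_sum fun n _ => h n
    have h4 : ∑ n ∈ s, g n ≤ ∑' n, g n := hg.sum_le_tsum s fun n _ => hg0 n
    have h5 : β * ((∑ n ∈ s, X (n - 1) + ∑ n ∈ s, X (n + 1)) / 2) ≤ β * (∑ n ∈ s, X n + M) := by
      gcongr; linarith
    rw [le_div_iff₀ (sub_pos.2 hαβ)]
    nlinarith
  refine summable_of_sum_le hX (c := (∑' n, g n + β * M) / (α - β)) fun u => ?_
  obtain ⟨N, hN⟩ := (Finset.tendsto_Icc_neg_atTop_atTop.comp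
    (tendsto_natCast_atTop_atTop (R := ℤ))).eventually (eventually_ge_atTop u) |>.exists
  exact (Finset.sum_le_sum_of_subset_of_nonneg hN fun n _ _ => hX n).trans (hbox N)

/-! ### Absolute summability of solutions -/

theorem summable_inv_one_add_sq : Summable fun n : ℤ => (1 + (n : ℝ) ^ 2)⁻¹ := by
  refine Summable.of_norm_bounded_eventually (Real.summable_one_div_int_pow.2 one_lt_two) ?_
  filter_upwards [(Set.finite_singleton (0 : ℤ)).eventually_cofinite_notMem] with n hn
  have hn' : (n : ℝ) ≠ 0 := by simpa using hn
  rw [Real.norm_of_nonneg (by positivity), one_div]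
  exact inv_anti₀ (by positivity) (by linarith)

/-- Absolutely summable sequences. -/
def AbsSummable (x : ℤ → ℂ) : Prop := Summable fun n => ‖x n‖

theorem AbsSummable.shift {x : ℤ → ℂ} (hx : AbsSummable x) (k : ℤ) :
    AbsSummable fun n => x (n + k) :=
  hx.comp_injective (i := fun n : ℤ => n + k) (add_left_injective k)

theorem AbsSummable.smul {x : ℤ → ℂ} (hx : AbsSummable x) (c : ℂ) :
    AbsSummable fun n => c * x n := by
  simpa [AbsSummable, norm_mul] using hx.mul_left ‖c‖

theorem AbsSummable.add {x y : ℤ → ℂ} (hx : AbsSummable x) (hy : AbsSummable y) :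
    AbsSummable fun n => x n + y n :=
  (Summable.add hx hy).of_nonneg_of_le (fun _ => norm_nonneg _) fun _ => norm_add_le _ _

theorem AbsSummable.sub {x y : ℤ → ℂ} (hx : AbsSummable x) (hy : AbsSummable y) :
    AbsSummable fun n => x n - y n :=
  (Summable.add hx hy).of_nonneg_of_le (fun _ => norm_nonneg _) fun _ => norm_sub_le _ _

/-- If `α x n - β (x (n - 1) + x (n + 1)) / 2` is absolutely summable, so is the bounded
sequence `x`. -/
theorem AbsSummable.of_average {x g : ℤ → ℂ} {α β M : ℝ} (hβ : 0 ≤ β) (hαβ : β < α)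
    (hM : ∀ n, ‖x n‖ ≤ M) (hg : AbsSummable g)
    (h : ∀ n, α * x n - β * (1 / 2 * (x (n - 1) + x (n + 1))) = g n) : AbsSummable x := by
  refine summable_of_le_average (fun n => norm_nonneg _) hM hg (fun n => norm_nonneg _) hβ hαβ
    fun n => ?_
  have h1 : (α : ℂ) * x n = g n + β * (1 / 2 * (x (n - 1) + x (n + 1))) := by rw [← h n]; ring
  have h2 := congrArg norm h1
  rw [norm_mul, Complex.norm_real, Real.norm_of_nonneg (hβ.trans hαβ.le)] at h2
  rw [h2]
  refine (norm_add_le _ _).trans ?_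
  gcongr
  rw [norm_mul, norm_mul, Complex.norm_real, Real.norm_of_nonneg hβ]
  gcongr
  have h3 : ‖(1 / 2 : ℂ)‖ = 1 / 2 := by norm_num
  rw [h3]
  have := norm_add_le (x (n - 1)) (x (n + 1))
  linarith

/-- The product of two square summable sequences, handled by the arithmetic–geometric mean
inequality. -/
theorem absSummable_invDerivL (v : Ell2) : AbsSummable (invDerivL v) := by
  refine ((summable_inv_one_add_sq.add (Ell2.summable_sq v)).mul_left (1 / 2)).of_nonneg_of_le
    (fun _ => norm_nonneg _) fun n => ?_
  rw [invDerivL_apply, norm_mul, norm_mul_inv_one_add_sq]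
  have h0 : (0 : ℝ) < 1 + |(n : ℝ)| ^ 2 := by positivity
  have h1 : (|(n : ℝ)| / (1 + |(n : ℝ)| ^ 2)) ^ 2 ≤ (1 + (n : ℝ) ^ 2)⁻¹ := by
    rw [← sq_abs (n : ℝ), div_pow, div_le_iff₀ (by positivity), inv_mul_eq_div,
      le_div_iff₀ h0]
    nlinarith [sq_nonneg |(n : ℝ)|]
  nlinarith [sq_nonneg (|(n : ℝ)| / (1 + |(n : ℝ)| ^ 2) - ‖v n‖)]

theorem absSummable_invL (v : Ell2) : AbsSummable (invL v) := by
  refine ((summable_inv_one_add_sq.add (Ell2.summable_sq v)).mul_left (1 / 2)).of_nonneg_of_le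
    (fun _ => norm_nonneg _) fun n => ?_
  have h0 : (1 : ℝ) ≤ 1 + (n : ℝ) ^ 2 := by nlinarith [sq_nonneg (n : ℝ)]
  have e : (1 + (n : ℂ) ^ 2)⁻¹ = (((1 + (n : ℝ) ^ 2)⁻¹ : ℝ) : ℂ) := by push_cast; rfl
  rw [invL_apply, norm_mul, e, Complex.norm_real, Real.norm_of_nonneg (by positivity)]
  have h1 : (1 + (n : ℝ) ^ 2)⁻¹ ^ 2 ≤ (1 + (n : ℝ) ^ 2)⁻¹ := by
    have := inv_le_one_of_one_le₀ h0
    have h2 : 0 ≤ (1 + (n : ℝ) ^ 2)⁻¹ := by positivity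
    nlinarith
  nlinarith [sq_nonneg ((1 + (n : ℝ) ^ 2)⁻¹ - ‖v n‖)]

namespace Coeffs

variable (m : Coeffs)

theorem absSummable_cosL {x : Ell2} (hx : AbsSummable x) : AbsSummable (cosL x) :=
  ((hx.shift (-1)).add (hx.shift 1)).smul (1 / 2)

theorem absSummable_QL {x : Ell2} (hx : AbsSummable x) : AbsSummable (m.QL x) :=
  (hx.smul m.A).sub ((absSummable_cosL hx).smul m.B)

theorem absSummable_DL {x : Ell2} (hx : AbsSummable x) : AbsSummable (m.DL x) :=
  (hx.smul m.C).sub ((absSummable_cosL hx).smul m.E)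

theorem absSummable_kL {x : Ell2} (hx : AbsSummable x) : AbsSummable (m.kL x) :=
  (hx.add (absSummable_cosL hx)).smul m.E

theorem absSummable_rL {x : Ell2} (hx : AbsSummable x) : AbsSummable (m.rL x) :=
  ((hx.shift (-1)).sub (hx.shift 1)).smul m.R

theorem absSummable_of_QL {x : Ell2} (hx : AbsSummable (m.QL x)) : AbsSummable x :=
  AbsSummable.of_average m.B_pos.le m.B_lt (M := ‖x‖) (lp.norm_apply_le_norm (by norm_num) x) hx
    fun n => (m.QL_apply x n).symm

theorem absSummable_of_DL {x : Ell2} (hx : AbsSummable (m.DL x)) : AbsSummable x :=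
  AbsSummable.of_average m.E_pos.le m.E_lt (M := ‖x‖) (lp.norm_apply_le_norm (by norm_num) x) hx
    fun n => (m.DL_apply x n).symm

/-- Solutions of the pencil equation are absolutely summable. -/
theorem absSummable_of_pencil {h κ : ℂ} {v v₁ : Ell2}
    (hv : m.pencil.T h v = κ • m.pencil.S v₁) : AbsSummable v := by
  -- Regularity gain: solved for the leading part, the equation has an absolutely summable right
  -- side, and the averaging lemma transfers this through Q and then D to v. As v n = (1 + n²) u n,
  -- the series of u can be differentiated twice term by term.
  have h1 : m.QL (m.DL v) = m.QL (m.DL (invL v)) + (1 / 4 : ℂ) • (m.rL (invDerivL v) -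
      (m.lam : ℂ) • m.kL (m.QL (m.QL (invL v))) + h • m.QL (m.QL (invL v)) +
      κ • m.QL (m.QL (invL v₁))) := by
    rw [pencil_T_apply, pencil_S_apply, map_sub, map_sub] at hv
    rw [← hv]
    module
  have h2 := absSummable_invL v
  have h3 := m.absSummable_QL (m.absSummable_QL h2)
  refine m.absSummable_of_DL (m.absSummable_of_QL ?_)
  rw [h1]
  exact (m.absSummable_QL (m.absSummable_DL h2)).add
    (((((m.absSummable_rL (absSummable_invDerivL v)).sub ((m.absSummable_kL h3).smul _)).add
      (h3.smul _)).add
      ((m.absSummable_QL (m.absSummable_QL (absSummable_invL v₁))).smul _)).smul _)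

end Coeffs

/-- The cosine series with given coefficients. -/
def cosSer (x : ℤ → ℂ) (τ : ℝ) : ℂ := ∑' n, x n * (Real.cos (2 * n * τ) : ℂ)

/-- The sine series with given coefficients. -/
def sinSer (x : ℤ → ℂ) (τ : ℝ) : ℂ := ∑' n, x n * (Real.sin (2 * n * τ) : ℂ)

theorem norm_mul_cos_le (x : ℂ) (t : ℝ) : ‖x * (Real.cos t : ℂ)‖ ≤ ‖x‖ := by
  rw [norm_mul, Complex.norm_real]
  exact mul_le_of_le_one_right (norm_nonneg _) (Real.abs_cos_le_one _)

theorem norm_mul_sin_le (x : ℂ) (t : ℝ) : ‖x * (Real.sin t : ℂ)‖ ≤ ‖x‖ := by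
  rw [norm_mul, Complex.norm_real]
  exact mul_le_of_le_one_right (norm_nonneg _) (Real.abs_sin_le_one _)

theorem AbsSummable.hasSum_cosSer {x : ℤ → ℂ} (hx : AbsSummable x) (τ : ℝ) :
    HasSum (fun n : ℤ => x n * (Real.cos (2 * n * τ) : ℂ)) (cosSer x τ) :=
  (Summable.of_norm_bounded hx fun _ => norm_mul_cos_le _ _).hasSum

theorem AbsSummable.hasSum_sinSer {x : ℤ → ℂ} (hx : AbsSummable x) (τ : ℝ) :
    HasSum (fun n : ℤ => x n * (Real.sin (2 * n * τ) : ℂ)) (sinSer x τ) :=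
  (Summable.of_norm_bounded hx fun _ => norm_mul_sin_le _ _).hasSum

theorem cosSer_add {x y : ℤ → ℂ} (hx : AbsSummable x) (hy : AbsSummable y) (τ : ℝ) :
    cosSer (fun n => x n + y n) τ = cosSer x τ + cosSer y τ := by
  rw [← ((hx.hasSum_cosSer τ).add (hy.hasSum_cosSer τ)).tsum_eq]
  exact tsum_congr fun n => add_mul _ _ _

theorem cosSer_sub {x y : ℤ → ℂ} (hx : AbsSummable x) (hy : AbsSummable y) (τ : ℝ) :
    cosSer (fun n => x n - y n) τ = cosSer x τ - cosSer y τ := by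
  rw [← ((hx.hasSum_cosSer τ).sub (hy.hasSum_cosSer τ)).tsum_eq]
  exact tsum_congr fun n => sub_mul _ _ _

theorem cosSer_smul (c : ℂ) (x : ℤ → ℂ) (τ : ℝ) :
    cosSer (fun n => c * x n) τ = c * cosSer x τ := by
  rw [cosSer, cosSer, ← tsum_mul_left]
  exact tsum_congr fun n => mul_assoc _ _ _

theorem cosSer_shift {x : ℤ → ℂ} (hx : AbsSummable x) (k : ℤ) (τ : ℝ) :
    cosSer (fun n => x (n + k)) τ =
      cosSer x τ * (Real.cos (2 * k * τ) : ℂ) + sinSer x τ * (Real.sin (2 * k * τ) : ℂ) := by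
  have h1 : cosSer (fun n => x (n + k)) τ = ∑' n : ℤ, x n * (Real.cos (2 * (n - k : ℤ) * τ) : ℂ) := by
    rw [cosSer, ← (Equiv.addRight k).tsum_eq fun n : ℤ => x n * (Real.cos (2 * (n - k : ℤ) * τ) : ℂ)]
    simp
  rw [h1, ← (((hx.hasSum_cosSer τ).mul_right _).add ((hx.hasSum_sinSer τ).mul_right _)).tsum_eq]
  refine tsum_congr fun n => ?_
  have : (2 * ((n - k : ℤ) : ℝ) * τ) = 2 * n * τ - 2 * k * τ := by push_cast; ring
  rw [this, Real.cos_sub]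
  push_cast
  ring

theorem cosSer_cosL {x : Ell2} (hx : AbsSummable x) (τ : ℝ) :
    cosSer (cosL x) τ = (Real.cos (2 * τ) : ℂ) * cosSer x τ := by
  have h : cosSer (cosL x) τ = 1 / 2 * (cosSer (fun n => x (n + -1)) τ + cosSer (fun n => x (n + 1)) τ) := by
    rw [← cosSer_add (hx.shift (-1)) (hx.shift 1), ← cosSer_smul]; rfl
  rw [h, cosSer_shift hx, cosSer_shift hx]
  have e1 : 2 * ((-1 : ℤ) : ℝ) * τ = -(2 * τ) := by push_cast; ring
  have e2 : 2 * ((1 : ℤ) : ℝ) * τ = 2 * τ := by push_cast; ring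
  rw [e1, e2, Real.cos_neg, Real.sin_neg]
  push_cast
  ring

theorem hasDerivAt_cosSer {x y : Ell2} (hxy : IsIndexMul x y) (hx : AbsSummable x)
    (hy : AbsSummable y) (τ : ℝ) : HasDerivAt (cosSer x) (-2 * sinSer y τ) τ := by
  have h := hasDerivAt_tsum (u := fun n => 2 * ‖y n‖)
    (g := fun (n : ℤ) (t : ℝ) => x n * (Real.cos (2 * n * t) : ℂ))
    (g' := fun (n : ℤ) (t : ℝ) => -2 * (y n * (Real.sin (2 * n * t) : ℂ))) (y₀ := τ)
    (Summable.mul_left 2 hy) (fun n t => ?_) (fun n t => ?_) (hx.hasSum_cosSer τ).summable τ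
  · rw [tsum_mul_left] at h
    exact h
  · have h1 : HasDerivAt (fun t : ℝ => Real.cos (2 * n * t)) (-Real.sin (2 * n * t) * (2 * n)) t := by
      simpa using ((hasDerivAt_id t).const_mul (2 * (n : ℝ))).cos
    have h2 := h1.ofReal_comp.const_mul (x n)
    refine h2.congr_deriv ?_
    rw [hxy n]
    push_cast
    ring
  · rw [norm_mul, norm_neg, Complex.norm_two]
    gcongr
    exact norm_mul_sin_le _ _

theorem hasDerivAt_sinSer {x y : Ell2} (hxy : IsIndexMul x y) (hx : AbsSummable x)
    (hy : AbsSummable y) (τ : ℝ) : HasDerivAt (sinSer x) (2 * cosSer y τ) τ := by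
  have h := hasDerivAt_tsum (u := fun n => 2 * ‖y n‖)
    (g := fun (n : ℤ) (t : ℝ) => x n * (Real.sin (2 * n * t) : ℂ))
    (g' := fun (n : ℤ) (t : ℝ) => 2 * (y n * (Real.cos (2 * n * t) : ℂ))) (y₀ := τ)
    (Summable.mul_left 2 hy) (fun n t => ?_) (fun n t => ?_) (hx.hasSum_sinSer τ).summable τ
  · rw [tsum_mul_left] at h
    exact h
  · have h1 : HasDerivAt (fun t : ℝ => Real.sin (2 * n * t)) (Real.cos (2 * n * t) * (2 * n)) t := by
      simpa using ((hasDerivAt_id t).const_mul (2 * (n : ℝ))).sin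
    have h2 := h1.ofReal_comp.const_mul (x n)
    refine h2.congr_deriv ?_
    rw [hxy n]
    push_cast
    ring
  · rw [norm_mul, Complex.norm_two]
    gcongr
    exact norm_mul_cos_le _ _

namespace Coeffs

variable (m : Coeffs)

/-- The function `A - B cos 2τ`. -/
def qf (τ : ℝ) : ℝ := m.A - m.B * Real.cos (2 * τ)

/-- The function `C - E cos 2τ`. -/
def df (τ : ℝ) : ℝ := m.C - m.E * Real.cos (2 * τ)

/-- The function `E (1 + cos 2τ)`. -/
def kf (τ : ℝ) : ℝ := m.E * (1 + Real.cos (2 * τ))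

/-- The function `((A - B cos 2τ) / (C - E cos 2τ)) ^ (1 / 2)`. -/
def gam (τ : ℝ) : ℝ := Real.sqrt (m.qf τ / m.df τ)

theorem qf_pos (τ : ℝ) : 0 < m.qf τ := by
  have := Real.cos_le_one (2 * τ)
  have := m.B_pos
  have := m.B_lt
  rw [qf]; nlinarith

theorem df_pos (τ : ℝ) : 0 < m.df τ := by
  have := Real.cos_le_one (2 * τ)
  have := m.E_pos
  have := m.E_lt
  rw [df]; nlinarith

theorem gam_pos (τ : ℝ) : 0 < m.gam τ := Real.sqrt_pos.2 (div_pos (m.qf_pos τ) (m.df_pos τ))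

theorem gam_sq (τ : ℝ) : m.gam τ ^ 2 = m.qf τ / m.df τ :=
  Real.sq_sqrt (div_pos (m.qf_pos τ) (m.df_pos τ)).le

/-- Here the relation `R_eq` enters. It makes 1/γ an integrating factor: γ (W'/γ)' = W'' + R sin 2τ
/ (qf df) W', so the equation takes divergence form. -/
theorem hasDerivAt_gam (τ : ℝ) :
    HasDerivAt m.gam (-(m.R * Real.sin (2 * τ) / (m.qf τ * m.df τ)) * m.gam τ) τ := by
  have hcos : HasDerivAt (fun t : ℝ => Real.cos (2 * t)) (-Real.sin (2 * τ) * 2) τ := by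
    simpa using ((hasDerivAt_id τ).const_mul (2 : ℝ)).cos
  have hq : HasDerivAt m.qf (-(m.B * (-Real.sin (2 * τ) * 2))) τ :=
    (hcos.const_mul m.B).const_sub m.A
  have hd : HasDerivAt m.df (-(m.E * (-Real.sin (2 * τ) * 2))) τ :=
    (hcos.const_mul m.E).const_sub m.C
  have h := (hq.div hd (m.df_pos τ).ne').sqrt (div_pos (m.qf_pos τ) (m.df_pos τ)).ne'
  refine h.congr_deriv ?_
  have h1 := m.gam_pos τ
  have h2 := m.gam_sq τ
  have hq0 := m.qf_pos τ
  have hd0 := m.df_pos τ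
  change _ / (2 * m.gam τ) = _
  rw [div_eq_iff (by positivity), show -(m.R * Real.sin (2 * τ) / (m.qf τ * m.df τ)) * m.gam τ *
    (2 * m.gam τ) = -(m.R * Real.sin (2 * τ) / (m.qf τ * m.df τ)) * 2 * m.gam τ ^ 2 by ring, h2]
  field_simp
  rw [m.R_eq, qf, df]
  ring

theorem continuous_gam : Continuous m.gam :=
  continuous_iff_continuousAt.2 fun τ => (m.hasDerivAt_gam τ).continuousAt

theorem cosSer_QL {x : Ell2} (hx : AbsSummable x) (τ : ℝ) :
    cosSer (m.QL x) τ = m.qf τ * cosSer x τ := by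
  have h : cosSer (m.QL x) τ = m.A * cosSer x τ - m.B * cosSer (cosL x) τ := by
    rw [← cosSer_smul, ← cosSer_smul, ← cosSer_sub (hx.smul _) ((absSummable_cosL hx).smul _)]; rfl
  rw [h, cosSer_cosL hx, qf]
  push_cast
  ring

theorem cosSer_DL {x : Ell2} (hx : AbsSummable x) (τ : ℝ) :
    cosSer (m.DL x) τ = m.df τ * cosSer x τ := by
  have h : cosSer (m.DL x) τ = m.C * cosSer x τ - m.E * cosSer (cosL x) τ := by
    rw [← cosSer_smul, ← cosSer_smul, ← cosSer_sub (hx.smul _) ((absSummable_cosL hx).smul _)]; rfl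
  rw [h, cosSer_cosL hx, df]
  push_cast
  ring

theorem cosSer_kL {x : Ell2} (hx : AbsSummable x) (τ : ℝ) :
    cosSer (m.kL x) τ = m.kf τ * cosSer x τ := by
  have h : cosSer (m.kL x) τ = m.E * (cosSer x τ + cosSer (cosL x) τ) := by
    rw [← cosSer_add hx (absSummable_cosL hx), ← cosSer_smul]; rfl
  rw [h, cosSer_cosL hx, kf]
  push_cast
  ring

theorem cosSer_rL {x : Ell2} (hx : AbsSummable x) (τ : ℝ) :
    cosSer (m.rL x) τ = -2 * m.R * (Real.sin (2 * τ) : ℂ) * sinSer x τ := by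
  have h : cosSer (m.rL x) τ =
      m.R * (cosSer (fun n => x (n + -1)) τ - cosSer (fun n => x (n + 1)) τ) := by
    rw [← cosSer_sub (hx.shift (-1)) (hx.shift 1), ← cosSer_smul]; rfl
  rw [h, cosSer_shift hx, cosSer_shift hx]
  have e1 : 2 * ((-1 : ℤ) : ℝ) * τ = -(2 * τ) := by push_cast; ring
  have e2 : 2 * ((1 : ℤ) : ℝ) * τ = 2 * τ := by push_cast; ring
  rw [e1, e2, Real.cos_neg, Real.sin_neg]
  push_cast
  ring

/-- The first order system `W' = γ Z`, `Z' = -γ ((h - lam κ) W + f)` on `[0, π / 2]` with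
boundary conditions `Z(0) = Z(π / 2) = 0`. -/
structure IsSol (h : ℂ) (f W Z : ℝ → ℂ) : Prop where
  deriv_W : ∀ τ ∈ Set.Icc 0 (Real.pi / 2),
    HasDerivWithinAt W (m.gam τ * Z τ) (Set.Icc 0 (Real.pi / 2)) τ
  deriv_Z : ∀ τ ∈ Set.Icc 0 (Real.pi / 2),
    HasDerivWithinAt Z (-(m.gam τ * ((h - m.lam * m.kf τ) * W τ + f τ)))
      (Set.Icc 0 (Real.pi / 2)) τ
  left : Z 0 = 0
  right : Z (Real.pi / 2) = 0

/-- Solutions of the pencil equation yield solutions of the differential equation. -/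
theorem isSol_of_pencil {h κ : ℂ} {v v₁ : Ell2} (hv : m.pencil.T h v = κ • m.pencil.S v₁) :
    m.IsSol h (fun τ => κ * cosSer (invL v₁) τ) (cosSer (invL v))
      (fun τ => -2 * sinSer (invDerivL v) τ * (m.gam τ : ℂ)⁻¹) := by
  have hs := m.absSummable_of_pencil hv
  have hs0 := absSummable_invL v
  have hs1 := absSummable_invDerivL v
  have hs2 : AbsSummable (v - invL v : Ell2) := hs.sub hs0
  have hdW := hasDerivAt_cosSer (isIndexMul_invL v) hs0 hs1
  have hdS := hasDerivAt_sinSer (isIndexMul_invDerivL v) hs1 hs2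
  have heq : ∀ τ, 4 * (m.qf τ * (m.df τ * cosSer (v - invL v : Ell2) τ)) -
      -2 * m.R * (Real.sin (2 * τ) : ℂ) * sinSer (invDerivL v) τ +
      m.lam * (m.kf τ * (m.qf τ * (m.qf τ * cosSer (invL v) τ))) -
      h * (m.qf τ * (m.qf τ * cosSer (invL v) τ)) =
      κ * (m.qf τ * (m.qf τ * cosSer (invL v₁) τ)) := fun τ => by
    have hQQ := m.absSummable_QL (m.absSummable_QL hs0)
    have hQD := m.absSummable_QL (m.absSummable_DL hs2)
    have hr := m.absSummable_rL hs1
    have hk := m.absSummable_kL hQQ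
    have e := congrArg (fun x : Ell2 => cosSer x τ) hv
    simp only [pencil_T_apply, pencil_S_apply] at e
    have e1 : cosSer ((4 : ℂ) • m.QL (m.DL (v - invL v)) - m.rL (invDerivL v) +
        (m.lam : ℂ) • m.kL (m.QL (m.QL (invL v))) - h • m.QL (m.QL (invL v)) : Ell2) τ =
        4 * cosSer (m.QL (m.DL (v - invL v))) τ - cosSer (m.rL (invDerivL v)) τ +
        m.lam * cosSer (m.kL (m.QL (m.QL (invL v)))) τ - h * cosSer (m.QL (m.QL (invL v))) τ := by
      rw [← cosSer_smul, ← cosSer_smul, ← cosSer_smul, ← cosSer_sub (hQD.smul _) hr,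
        ← cosSer_add ((hQD.smul _).sub hr) (hk.smul _),
        ← cosSer_sub (((hQD.smul _).sub hr).add (hk.smul _)) (hQQ.smul _)]
      rfl
    have e2 : cosSer (κ • m.QL (m.QL (invL v₁)) : Ell2) τ =
        κ * cosSer (m.QL (m.QL (invL v₁))) τ := by
      rw [← cosSer_smul]; rfl
    rw [e1, e2, m.cosSer_QL (m.absSummable_DL hs2), m.cosSer_DL hs2, m.cosSer_rL hs1,
      m.cosSer_kL (m.absSummable_QL (m.absSummable_QL hs0)), m.cosSer_QL (m.absSummable_QL hs0),
      m.cosSer_QL hs0, m.cosSer_QL (m.absSummable_QL (absSummable_invL v₁)),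
      m.cosSer_QL (absSummable_invL v₁)] at e
    exact e
  have hγ0 : ∀ τ, (m.gam τ : ℂ) ≠ 0 := fun τ => by exact_mod_cast (m.gam_pos τ).ne'
  refine ⟨fun τ _ => ?_, fun τ _ => ?_, ?_, ?_⟩
  · refine ((hdW τ).congr_deriv ?_).hasDerivWithinAt
    have := hγ0 τ
    field_simp
  · refine HasDerivAt.hasDerivWithinAt ?_
    have h1 := ((hdS τ).const_mul (-2 : ℂ)).mul ((m.hasDerivAt_gam τ).ofReal_comp.fun_inv (hγ0 τ))
    refine h1.congr_deriv ?_
    have hg := hγ0 τ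
    have hq : (m.qf τ : ℂ) ≠ 0 := by exact_mod_cast (m.qf_pos τ).ne'
    have hd : (m.df τ : ℂ) ≠ 0 := by exact_mod_cast (m.df_pos τ).ne'
    have hg2 : (m.gam τ : ℂ) ^ 2 * m.df τ = m.qf τ := by
      have := m.gam_sq τ
      rw [eq_div_iff (m.df_pos τ).ne'] at this
      exact_mod_cast this
    have e := heq τ
    generalize cosSer (v - invL v : Ell2) τ = y at e ⊢
    push_cast
    have hprod : (m.gam τ : ℂ) * m.qf τ * m.df τ ≠ 0 := mul_ne_zero (mul_ne_zero hg hq) hd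
    refine mul_right_cancel₀ hprod ?_
    trans -(4 * (m.qf τ * (m.df τ * y))) -
      2 * m.R * Complex.sin (2 * τ) * sinSer (invDerivL v) τ
    · field_simp
      ring
    · push_cast at e
      linear_combination (-1 : ℂ) * e + (m.qf τ : ℂ) *
        ((h - m.lam * m.kf τ) * cosSer (invL v) τ + κ * cosSer (invL v₁) τ) * hg2
  · simp [sinSer]
  · have : sinSer (invDerivL v) (Real.pi / 2) = 0 := by
      refine (tsum_congr fun n => ?_).trans tsum_zero
      rw [show 2 * (n : ℝ) * (Real.pi / 2) = n * Real.pi by ring, Real.sin_int_mul_pi]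
      simp
    simp [this]

end Coeffs

/-! ### Orthogonality of the cosines and uniqueness of the coefficients -/

theorem integral_cos_two_mul (n : ℤ) :
    ∫ τ in (0 : ℝ)..(Real.pi / 2), Real.cos (2 * n * τ) = if n = 0 then Real.pi / 2 else 0 := by
  split_ifs with h
  · simp [h]
  · have h1 : (2 * (n : ℝ)) ≠ 0 := by
      have : (n : ℝ) ≠ 0 := by exact_mod_cast h
      positivity
    rw [intervalIntegral.integral_comp_mul_left (fun x => Real.cos x) h1, integral_cos,
      show 2 * (n : ℝ) * (Real.pi / 2) = n * Real.pi by ring, Real.sin_int_mul_pi]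
    simp

theorem integral_cos_mul_cos (n k : ℤ) :
    ∫ τ in (0 : ℝ)..(Real.pi / 2), Real.cos (2 * n * τ) * Real.cos (2 * k * τ) =
      Real.pi / 4 * ((if n = k then 1 else 0) + if n = -k then 1 else 0) := by
  have h : ∀ τ : ℝ, Real.cos (2 * n * τ) * Real.cos (2 * k * τ) =
      1 / 2 * (Real.cos (2 * (n - k : ℤ) * τ) + Real.cos (2 * (n + k : ℤ) * τ)) := fun τ => by
    rw [show 2 * ((n - k : ℤ) : ℝ) * τ = 2 * n * τ - 2 * k * τ by push_cast; ring,
      show 2 * ((n + k : ℤ) : ℝ) * τ = 2 * n * τ + 2 * k * τ by push_cast; ring, Real.cos_sub,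
      Real.cos_add]
    ring
  simp only [h]
  rw [intervalIntegral.integral_const_mul, intervalIntegral.integral_add
    (Continuous.intervalIntegrable (by fun_prop) _ _)
    (Continuous.intervalIntegrable (by fun_prop) _ _), integral_cos_two_mul, integral_cos_two_mul]
  simp only [sub_eq_zero, add_eq_zero_iff_eq_neg]
  split_ifs <;> ring

/-- The coefficients of a cosine series are determined by its sum on `[0, π / 2]`. -/
theorem integral_cosSer_mul_cos {x : ℤ → ℂ} (hx : AbsSummable x) (k : ℤ) :
    ∫ τ in (0 : ℝ)..(Real.pi / 2), cosSer x τ * (Real.cos (2 * k * τ) : ℂ) =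
      Real.pi / 4 * (x k + x (-k)) := by
  let F : ℤ → C(ℝ, ℂ) := fun n =>
    ⟨fun τ => x n * (Real.cos (2 * n * τ) : ℂ) * (Real.cos (2 * k * τ) : ℂ), by fun_prop⟩
  have hF : ∀ n τ, ‖F n τ‖ ≤ ‖x n‖ := fun n τ =>
    (norm_mul_cos_le _ _).trans (norm_mul_cos_le _ _)
  have h1 := intervalIntegral.hasSum_intervalIntegral_of_summable_norm (a := 0)
    (b := Real.pi / 2) (f := F) (Summable.of_nonneg_of_le (fun _ => norm_nonneg _)
      (fun n => (ContinuousMap.norm_le _ (norm_nonneg (x n))).2 fun τ => hF n τ) hx)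
  have h2 : ∀ τ, ∑' n, F n τ = cosSer x τ * (Real.cos (2 * k * τ) : ℂ) := fun τ => by
    rw [cosSer, ← tsum_mul_right]; rfl
  have h3 : ∀ n, ∫ τ in (0 : ℝ)..(Real.pi / 2), F n τ =
      x n * (Real.pi / 4 * ((if n = k then 1 else 0) + if n = -k then 1 else 0)) := fun n => by
    have e := congrArg (fun r : ℝ => x n * (r : ℂ)) (integral_cos_mul_cos n k)
    rw [← intervalIntegral.integral_ofReal, ← intervalIntegral.integral_const_mul] at e
    refine Eq.trans ?_ (e.trans (by push_cast; split_ifs <;> simp))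
    refine intervalIntegral.integral_congr fun τ _ => ?_
    change x n * (Real.cos (2 * n * τ) : ℂ) * (Real.cos (2 * k * τ) : ℂ) = _
    push_cast
    ring
  simp only [h2, h3] at h1
  rw [← h1.tsum_eq]
  have h4 : ∀ n, x n * ((Real.pi : ℂ) / 4 * ((if n = k then 1 else 0) + if n = -k then 1 else 0)) =
      (if n = k then Real.pi / 4 * x k else 0) + if n = -k then Real.pi / 4 * x (-k) else 0 := by
    intro n
    split_ifs with h5 h6 h6
    · rw [show x (-k) = x n by rw [h6], show x k = x n by rw [h5]]; ring
    · rw [← h5]; ring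
    · rw [← h6]; ring
    · ring
  simp only [h4]
  rw [Summable.tsum_add (summable_of_ne_finset_zero (s := {k}) fun n hn => by
      rw [if_neg (by simpa using hn)])
    (summable_of_ne_finset_zero (s := {-k}) fun n hn => by rw [if_neg (by simpa using hn)]),
    tsum_ite_eq, tsum_ite_eq]
  ring

/-- An even absolutely summable sequence vanishes if its cosine series does. -/
theorem eq_zero_of_cosSer_eq_zero {v : Ell2} (hv : v ∈ evenSeq)
    (h : ∀ τ ∈ Set.Icc 0 (Real.pi / 2), cosSer (invL v) τ = 0) : v = 0 := by
  ext k
  have h1 := integral_cosSer_mul_cos (absSummable_invL v) k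
  have h2 : ∫ τ in (0 : ℝ)..(Real.pi / 2), cosSer (invL v) τ * (Real.cos (2 * k * τ) : ℂ) = 0 := by
    rw [intervalIntegral.integral_congr (g := fun _ => 0) fun τ hτ => ?_]
    · simp
    · rw [Set.uIcc_of_le (by positivity)] at hτ
      simp [h τ hτ]
  have h3 := mem_evenSeq.1 (invL_mem hv) k
  rw [h2, h3, ← two_mul] at h1
  have h4 : (Real.pi : ℂ) ≠ 0 := by exact_mod_cast Real.pi_ne_zero
  have h5 : invL v k = 0 := by
    have : (Real.pi : ℂ) / 4 * (2 * invL v k) = 0 := h1.symm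
    simpa [h4] using this
  rw [invL_apply, mul_eq_zero] at h5
  exact h5.resolve_left (inv_ne_zero (one_add_sq_ne_zero k))

/-! ### Eigenvalues of the first order system are real and simple -/

/-- A monotone function with equal end values is constant. The Lagrange identities below enter in
this form, without any integration. -/
theorem eq_zero_of_deriv_nonneg_of_eq {a b : ℝ} (hab : a < b) {F g : ℝ → ℝ}
    (hF : ∀ x ∈ Set.Icc a b, HasDerivWithinAt F (g x) (Set.Icc a b) x)
    (hg : ∀ x ∈ Set.Icc a b, 0 ≤ g x) (h : F a = F b) : ∀ x ∈ Set.Icc a b, g x = 0 := by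
  have hmono : MonotoneOn F (Set.Icc a b) :=
    monotoneOn_of_hasDerivWithinAt_nonneg (convex_Icc a b)
      (fun x hx => (hF x hx).continuousWithinAt)
      (fun x hx => (hF x (interior_subset hx)).mono interior_subset)
      (fun x hx => hg x (interior_subset hx))
  have hc : ∀ x ∈ Set.Icc a b, F x = F a := fun x hx =>
    le_antisymm ((hmono hx (Set.right_mem_Icc.2 hab.le) hx.2).trans h.ge)
      (hmono (Set.left_mem_Icc.2 hab.le) hx hx.1)
  intro x hx
  have h1 : HasDerivWithinAt F 0 (Set.Icc a b) x :=
    (hasDerivWithinAt_const x _ (F a)).congr hc (hc x hx)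
  exact (uniqueDiffOn_Icc hab x hx).eq_deriv _ (hF x hx) h1

theorem hasDerivWithinAt_re {W : ℝ → ℂ} {w : ℂ} {s : Set ℝ} {τ : ℝ}
    (h : HasDerivWithinAt W w s τ) : HasDerivWithinAt (fun t => (W t).re) w.re s τ :=
  (Complex.reCLM.hasFDerivAt (x := W τ)).comp_hasDerivWithinAt τ h

theorem hasDerivWithinAt_im {W : ℝ → ℂ} {w : ℂ} {s : Set ℝ} {τ : ℝ}
    (h : HasDerivWithinAt W w s τ) : HasDerivWithinAt (fun t => (W t).im) w.im s τ :=
  (Complex.imCLM.hasFDerivAt (x := W τ)).comp_hasDerivWithinAt τ h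

namespace Coeffs

variable (m : Coeffs)

theorem continuous_kf : Continuous m.kf := by
  unfold kf; fun_prop

variable {m}

/-- Lagrange's identity: -Im h · Im(Z conj W) vanishes at both ends and has derivative γ (Im h)²
|W|². -/
theorem IsSol.im_eq_zero {h : ℂ} {W Z : ℝ → ℂ} (hs : m.IsSol h (fun _ => 0) W Z)
    (hW : ∃ τ ∈ Set.Icc 0 (Real.pi / 2), W τ ≠ 0) : h.im = 0 := by
  by_contra him
  obtain ⟨τ, hτ, hne⟩ := hW
  refine hne ?_
  have hd : ∀ x ∈ Set.Icc 0 (Real.pi / 2), HasDerivWithinAt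
      (fun t => -h.im * ((Z t).im * (W t).re - (Z t).re * (W t).im))
      (m.gam x * h.im ^ 2 * Complex.normSq (W x)) (Set.Icc 0 (Real.pi / 2)) x := by
    intro x hx
    have hw := hs.deriv_W x hx
    have hz := hs.deriv_Z x hx
    refine ((((hasDerivWithinAt_im hz).mul (hasDerivWithinAt_re hw)).sub
      ((hasDerivWithinAt_re hz).mul (hasDerivWithinAt_im hw))).const_mul (-h.im)).congr_deriv ?_
    simp [Complex.normSq_apply]
    ring
  have h0 := eq_zero_of_deriv_nonneg_of_eq (by positivity) hd
    (fun x _ => mul_nonneg (mul_nonneg (m.gam_pos x).le (sq_nonneg _)) (Complex.normSq_nonneg _))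
    (by simp [hs.left, hs.right]) τ hτ
  have := (m.gam_pos τ).ne'
  simpa [this, him] using h0

/-- The Fredholm condition: the Wronskian of the conjugate of (W₁, Z₁) with (W₂, Z₂), times conj κ,
vanishes at both ends, and its real part has derivative γ |κ|² |W₁|². This excludes Jordan chains.
-/
theorem IsSol.force_eq_zero {h : ℝ} {κ : ℂ} {W₁ Z₁ W₂ Z₂ : ℝ → ℂ}
    (h₁ : m.IsSol h (fun _ => 0) W₁ Z₁) (h₂ : m.IsSol h (fun τ => κ * W₁ τ) W₂ Z₂)
    (hW : ∃ τ ∈ Set.Icc 0 (Real.pi / 2), W₁ τ ≠ 0) : κ = 0 := by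
  by_contra hκ
  obtain ⟨τ, hτ, hne⟩ := hW
  refine hne ?_
  have hd : ∀ x ∈ Set.Icc 0 (Real.pi / 2), HasDerivWithinAt
      (fun t => (star κ * (star (Z₁ t) * W₂ t - Z₂ t * star (W₁ t))).re)
      (m.gam x * Complex.normSq κ * Complex.normSq (W₁ x)) (Set.Icc 0 (Real.pi / 2)) x := by
    intro x hx
    refine (hasDerivWithinAt_re ((((h₁.deriv_Z x hx).star.mul (h₂.deriv_W x hx)).sub
      ((h₂.deriv_Z x hx).mul (h₁.deriv_W x hx).star)).const_mul (star κ))).congr_deriv ?_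
    simp [Complex.normSq_apply]
    ring
  have h0 := eq_zero_of_deriv_nonneg_of_eq (by positivity) hd
    (fun x _ => mul_nonneg (mul_nonneg (m.gam_pos x).le (Complex.normSq_nonneg _))
      (Complex.normSq_nonneg _))
    (by simp [h₁.left, h₁.right, h₂.left, h₂.right]) τ hτ
  have := (m.gam_pos τ).ne'
  simpa [this, hκ] using h0

/-- As Z(0) = 0 as well, this is uniqueness for the linear initial value problem, by Gronwall's
inequality. -/
theorem IsSol.eq_zero_of_left {h : ℂ} {W Z : ℝ → ℂ} (hs : m.IsSol h (fun _ => 0) W Z)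
    (h0 : W 0 = 0) : ∀ τ ∈ Set.Icc 0 (Real.pi / 2), W τ = 0 := by
  obtain ⟨M₁, hM₁⟩ := isCompact_Icc.exists_bound_of_continuousOn (s := Set.Icc 0 (Real.pi / 2))
    m.continuous_gam.continuousOn
  have hk := m.continuous_kf
  have hg := m.continuous_gam
  obtain ⟨M₂, hM₂⟩ := isCompact_Icc.exists_bound_of_continuousOn (s := Set.Icc 0 (Real.pi / 2))
    (f := fun τ => (m.gam τ : ℂ) * (h - m.lam * m.kf τ))
    (Continuous.continuousOn (by fun_prop))
  have hd : ∀ τ ∈ Set.Icc 0 (Real.pi / 2), HasDerivWithinAt (fun t => (W t, Z t))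
      (m.gam τ * Z τ, -(m.gam τ * ((h - m.lam * m.kf τ) * W τ + 0))) (Set.Icc 0 (Real.pi / 2)) τ :=
    fun τ hτ => (hs.deriv_W τ hτ).prodMk (hs.deriv_Z τ hτ)
  have key := eq_zero_of_abs_deriv_le_mul_abs_self_of_eq_zero_right (K := max M₁ M₂)
    (f := fun t => (W t, Z t)) (a := 0) (b := Real.pi / 2)
    (fun τ hτ => (hd τ hτ).continuousWithinAt)
    (fun τ hτ => (hd τ (Set.Ico_subset_Icc_self hτ)).mono_of_mem_nhdsWithin
      (Icc_mem_nhdsGE_of_mem hτ))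
    (by simp [h0, hs.left])
    (fun τ hτ => by
      have hτ := Set.Ico_subset_Icc_self hτ
      rw [Prod.norm_def, Prod.norm_def]
      refine max_le ?_ ?_
      · rw [norm_mul]
        exact mul_le_mul (by simpa using (hM₁ τ hτ).trans (le_max_left _ _)) (le_max_right _ _)
          (norm_nonneg _) ((norm_nonneg _).trans ((hM₁ τ hτ).trans (le_max_left _ _)))
      · rw [norm_neg, add_zero, ← mul_assoc, norm_mul]
        exact mul_le_mul ((hM₂ τ hτ).trans (le_max_right _ _)) (le_max_left _ _)
          (norm_nonneg _) ((norm_nonneg _).trans ((hM₁ τ hτ).trans (le_max_left _ _))))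
  exact fun τ hτ => (Prod.mk.inj (key τ hτ)).1

theorem isSol_of_isEigenvector {h : ℂ} {v : Ell2} (hv : m.pencil.T h v = 0) :
    m.IsSol h (fun _ => 0) (cosSer (invL v))
      (fun τ => -2 * sinSer (invDerivL v) τ * (m.gam τ : ℂ)⁻¹) := by
  have := m.isSol_of_pencil (κ := 0) (v₁ := 0) (hv.trans (by simp))
  simpa using this

theorem exists_cosSer_ne_zero {v : Ell2} (hv : v ∈ evenSeq) (h0 : v ≠ 0) :
    ∃ τ ∈ Set.Icc 0 (Real.pi / 2), cosSer (invL v) τ ≠ 0 := by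
  by_contra! hc
  exact h0 (eq_zero_of_cosSer_eq_zero hv hc)

/-- An eigenvector forces h to be real, and the Lagrange identity then gives κ = 0. Subtracting the
multiple of v₁ that cancels the value at τ = 0 leaves a solution with zero initial data. At points
that are not eigenvalues the condition is vacuous, so it can be used near any limit point. -/
theorem isSimpleAt (m : Coeffs) (h : ℂ) : m.pencil.IsSimpleAt h := by
  intro v₁ hv₁ v₂ hv₂ κ h0 h₁ h₂
  have hs₁ := isSol_of_isEigenvector h₁
  have hW := exists_cosSer_ne_zero hv₁ h0
  have him := hs₁.im_eq_zero hW
  obtain ⟨x, rfl⟩ : ∃ x : ℝ, h = x := ⟨h.re, Complex.ext rfl (by simpa using him)⟩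
  have hκ := hs₁.force_eq_zero (m.isSol_of_pencil h₂) hW
  refine ⟨hκ, ?_⟩
  rw [hκ, zero_smul] at h₂
  have hW0 : cosSer (invL v₁) 0 ≠ 0 := fun h' => by
    obtain ⟨τ, hτ, hne⟩ := hW
    exact hne (hs₁.eq_zero_of_left h' τ hτ)
  refine ⟨cosSer (invL v₂) 0 / cosSer (invL v₁) 0, ?_⟩
  set r := cosSer (invL v₂) 0 / cosSer (invL v₁) 0 with hr
  have h₃ : m.pencil.T x (v₂ - r • v₁) = 0 := by rw [map_sub, map_smul, h₁, h₂]; simp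
  have hcs : ∀ τ, cosSer (invL (v₂ - r • v₁)) τ =
      cosSer (invL v₂) τ - r * cosSer (invL v₁) τ := fun τ => by
    rw [map_sub, map_smul, ← cosSer_smul,
      ← cosSer_sub (absSummable_invL v₂) ((absSummable_invL v₁).smul r)]
    rfl
  have := eq_zero_of_cosSer_eq_zero (evenSeq.sub_mem hv₂ (evenSeq.smul_mem r hv₁))
    ((isSol_of_isEigenvector h₃).eq_zero_of_left (by rw [hcs, hr, div_mul_cancel₀ _ hW0, sub_self]))
  exact sub_eq_zero.1 this

/-- Real solutions of the system `W' = γ Z`, `Z' = -γ (h - λ κ) W` with `Z = 0` at both ends. -/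
structure IsRealSol (m : Coeffs) (h : ℝ) (W Z : ℝ → ℝ) : Prop where
  deriv_W : ∀ τ ∈ Set.Icc 0 (Real.pi / 2),
    HasDerivWithinAt W (m.gam τ * Z τ) (Set.Icc 0 (Real.pi / 2)) τ
  deriv_Z : ∀ τ ∈ Set.Icc 0 (Real.pi / 2),
    HasDerivWithinAt Z (-(m.gam τ * ((h - m.lam * m.kf τ) * W τ))) (Set.Icc 0 (Real.pi / 2)) τ
  left : Z 0 = 0
  right : Z (Real.pi / 2) = 0

/-- The system has a nontrivial real solution. -/
def IsSystemEigenvalue (m : Coeffs) (h : ℝ) : Prop :=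
  ∃ W Z, m.IsRealSol h W Z ∧ ∃ τ ∈ Set.Icc 0 (Real.pi / 2), W τ ≠ 0

theorem IsSol.re {h : ℝ} {W Z : ℝ → ℂ} (hs : m.IsSol h (fun _ => 0) W Z) :
    m.IsRealSol h (fun τ => (W τ).re) (fun τ => (Z τ).re) where
  deriv_W τ hτ := (hasDerivWithinAt_re (hs.deriv_W τ hτ)).congr_deriv (by simp)
  deriv_Z τ hτ := (hasDerivWithinAt_re (hs.deriv_Z τ hτ)).congr_deriv (by simp)
  left := by simp [hs.left]
  right := by simp [hs.right]

theorem IsSol.im {h : ℝ} {W Z : ℝ → ℂ} (hs : m.IsSol h (fun _ => 0) W Z) :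
    m.IsRealSol h (fun τ => (W τ).im) (fun τ => (Z τ).im) where
  deriv_W τ hτ := (hasDerivWithinAt_im (hs.deriv_W τ hτ)).congr_deriv (by simp)
  deriv_Z τ hτ := (hasDerivWithinAt_im (hs.deriv_Z τ hτ)).congr_deriv (by simp)
  left := by simp [hs.left]
  right := by simp [hs.right]

theorem isSystemEigenvalue_of_isEigenvalue {h : ℂ} (hh : m.pencil.IsEigenvalue h) :
    ∃ x : ℝ, h = x ∧ m.IsSystemEigenvalue x := by
  obtain ⟨v, hv, h0, hT⟩ := hh
  have hs := isSol_of_isEigenvector hT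
  have hW := exists_cosSer_ne_zero hv h0
  have him := hs.im_eq_zero hW
  obtain ⟨x, rfl⟩ : ∃ x : ℝ, h = x := ⟨h.re, Complex.ext rfl (by simpa using him)⟩
  refine ⟨x, rfl, ?_⟩
  obtain ⟨τ, hτ, hne⟩ := hW
  by_cases hre : (cosSer (invL v) τ).re = 0
  · exact ⟨_, _, hs.im, τ, hτ, fun h' => hne (Complex.ext hre h')⟩
  · exact ⟨_, _, hs.re, τ, hτ, hre⟩

end Coeffs

/-! ### From functions to sequences -/

/-- Each application of the equation improves the bound by the factor β/α. This is injectivity of Q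
and D on bounded sequences, where their invertibility on ℓ² does not apply. -/
theorem eq_zero_of_mul_eq_average {x : ℤ → ℂ} {α β M : ℝ} (hβ : 0 ≤ β) (hαβ : β < α)
    (hM : ∀ n, ‖x n‖ ≤ M) (h : ∀ n, (α : ℂ) * x n = β * (1 / 2 * (x (n - 1) + x (n + 1)))) :
    ∀ n, x n = 0 := by
  have hα : 0 < α := hβ.trans_lt hαβ
  have key : ∀ k : ℕ, ∀ n, ‖x n‖ ≤ (β / α) ^ k * M := by
    intro k
    induction k with
    | zero => simpa using hM
    | succ k ih =>
      intro n
      have e := congrArg norm (h n)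
      rw [norm_mul, norm_mul, norm_mul, Complex.norm_real, Complex.norm_real, Real.norm_of_nonneg hβ,
        Real.norm_of_nonneg hα.le] at e
      have h1 : ‖x (n - 1) + x (n + 1)‖ ≤ 2 * ((β / α) ^ k * M) := by
        refine (norm_add_le _ _).trans ?_
        linarith [ih (n - 1), ih (n + 1)]
      have h2 : α * ‖x n‖ ≤ β * ((β / α) ^ k * M) := by
        rw [e]
        refine mul_le_mul_of_nonneg_left ?_ hβ
        have : ‖(1 / 2 : ℂ)‖ = 1 / 2 := by norm_num
        rw [this]; linarith
      rw [← le_div_iff₀' hα] at h2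
      refine h2.trans (le_of_eq ?_)
      rw [pow_succ]; ring
  intro n
  have hlim : Tendsto (fun k : ℕ => (β / α) ^ k * M) atTop (𝓝 (0 * M)) :=
    (tendsto_pow_atTop_nhds_zero_of_lt_one (div_nonneg hβ hα.le)
      ((div_lt_one hα).2 hαβ)).mul_const M
  rw [zero_mul] at hlim
  exact norm_le_zero_iff.1 (ge_of_tendsto' hlim fun k => key k n)

/-- The cosine coefficients of a function on `[0, π / 2]`, up to normalization. -/
def cosInt (f : ℝ → ℝ) (n : ℤ) : ℝ := ∫ τ in (0 : ℝ)..(Real.pi / 2), f τ * Real.cos (2 * n * τ)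

/-- The sine coefficients of a function on `[0, π / 2]`, up to normalization. -/
def sinInt (f : ℝ → ℝ) (n : ℤ) : ℝ := ∫ τ in (0 : ℝ)..(Real.pi / 2), f τ * Real.sin (2 * n * τ)

theorem half_pi_nonneg : (0 : ℝ) ≤ Real.pi / 2 := by positivity

theorem cosInt_neg (f : ℝ → ℝ) (n : ℤ) : cosInt f (-n) = cosInt f n := by
  refine intervalIntegral.integral_congr fun τ _ => ?_
  rw [show 2 * ((-n : ℤ) : ℝ) * τ = -(2 * n * τ) by push_cast; ring, Real.cos_neg]

theorem cosInt_congr {f g : ℝ → ℝ} (h : Set.EqOn f g (Set.Icc 0 (Real.pi / 2))) (n : ℤ) :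
    cosInt f n = cosInt g n := by
  refine intervalIntegral.integral_congr fun τ hτ => ?_
  rw [Set.uIcc_of_le half_pi_nonneg] at hτ
  rw [h hτ]

theorem intervalIntegrable_half_pi {f : ℝ → ℝ} (hf : ContinuousOn f (Set.Icc 0 (Real.pi / 2))) :
    IntervalIntegrable f MeasureTheory.volume 0 (Real.pi / 2) :=
  hf.intervalIntegrable_of_Icc half_pi_nonneg

theorem exists_abs_cosInt_le {f : ℝ → ℝ} (hf : ContinuousOn f (Set.Icc 0 (Real.pi / 2))) :
    ∃ M, ∀ n, |cosInt f n| ≤ M := by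
  obtain ⟨M, hM⟩ := isCompact_Icc.exists_bound_of_continuousOn hf
  refine ⟨M * |Real.pi / 2 - 0|, fun n => ?_⟩
  rw [← Real.norm_eq_abs, cosInt]
  refine intervalIntegral.norm_integral_le_of_norm_le_const fun τ hτ => ?_
  rw [Set.uIoc_of_le half_pi_nonneg] at hτ
  rw [norm_mul]
  have h1 := hM τ (Set.Ioc_subset_Icc_self hτ)
  have h2 := Real.abs_cos_le_one (2 * n * τ)
  rw [Real.norm_eq_abs (Real.cos _)]
  nlinarith [norm_nonneg (f τ), abs_nonneg (Real.cos (2 * n * τ))]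

theorem cosInt_add {f g : ℝ → ℝ} (hf : ContinuousOn f (Set.Icc 0 (Real.pi / 2)))
    (hg : ContinuousOn g (Set.Icc 0 (Real.pi / 2))) (n : ℤ) :
    cosInt (fun τ => f τ + g τ) n = cosInt f n + cosInt g n := by
  simp only [cosInt]
  rw [← intervalIntegral.integral_add (intervalIntegrable_half_pi (by fun_prop))
    (intervalIntegrable_half_pi (by fun_prop))]
  simp only [add_mul]

theorem cosInt_const_mul (r : ℝ) (f : ℝ → ℝ) (n : ℤ) :
    cosInt (fun τ => r * f τ) n = r * cosInt f n := by
  simp only [cosInt]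
  rw [← intervalIntegral.integral_const_mul]
  simp only [mul_assoc]

theorem cosInt_cos_mul {f : ℝ → ℝ} (hf : ContinuousOn f (Set.Icc 0 (Real.pi / 2))) (n : ℤ) :
    cosInt (fun τ => Real.cos (2 * τ) * f τ) n =
      1 / 2 * (cosInt f (n - 1) + cosInt f (n + 1)) := by
  simp only [cosInt]
  rw [← intervalIntegral.integral_add (intervalIntegrable_half_pi (by fun_prop))
    (intervalIntegrable_half_pi (by fun_prop)), ← intervalIntegral.integral_const_mul]
  refine intervalIntegral.integral_congr fun τ _ => ?_
  rw [show 2 * ((n - 1 : ℤ) : ℝ) * τ = 2 * n * τ - 2 * τ by push_cast; ring,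
    show 2 * ((n + 1 : ℤ) : ℝ) * τ = 2 * n * τ + 2 * τ by push_cast; ring, Real.cos_sub,
    Real.cos_add]
  ring

theorem cosInt_sin_mul {f : ℝ → ℝ} (hf : ContinuousOn f (Set.Icc 0 (Real.pi / 2))) (n : ℤ) :
    cosInt (fun τ => Real.sin (2 * τ) * f τ) n =
      1 / 2 * (sinInt f (n + 1) - sinInt f (n - 1)) := by
  simp only [cosInt, sinInt]
  rw [← intervalIntegral.integral_sub (intervalIntegrable_half_pi (by fun_prop))
    (intervalIntegrable_half_pi (by fun_prop)), ← intervalIntegral.integral_const_mul]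
  refine intervalIntegral.integral_congr fun τ _ => ?_
  rw [show 2 * ((n - 1 : ℤ) : ℝ) * τ = 2 * n * τ - 2 * τ by push_cast; ring,
    show 2 * ((n + 1 : ℤ) : ℝ) * τ = 2 * n * τ + 2 * τ by push_cast; ring, Real.sin_sub,
    Real.sin_add]
  ring

theorem cosInt_affine_mul {f : ℝ → ℝ} (hf : ContinuousOn f (Set.Icc 0 (Real.pi / 2)))
    (α β : ℝ) (n : ℤ) :
    cosInt (fun τ => (α + β * Real.cos (2 * τ)) * f τ) n =
      α * cosInt f n + β * (1 / 2 * (cosInt f (n - 1) + cosInt f (n + 1))) := by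
  have e : (fun τ => (α + β * Real.cos (2 * τ)) * f τ) =
      fun τ => α * f τ + β * (Real.cos (2 * τ) * f τ) := by ext τ; ring
  rw [e, cosInt_add (by fun_prop) (by fun_prop), cosInt_const_mul, cosInt_const_mul,
    cosInt_cos_mul hf]

theorem sinInt_deriv {f f' : ℝ → ℝ}
    (hf : ∀ τ ∈ Set.Icc 0 (Real.pi / 2), HasDerivWithinAt f (f' τ) (Set.Icc 0 (Real.pi / 2)) τ)
    (hf' : ContinuousOn f' (Set.Icc 0 (Real.pi / 2))) (n : ℤ) :
    sinInt f' n = -(2 * n) * cosInt f n := by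
  have hd : ∀ τ : ℝ, HasDerivAt (fun t : ℝ => Real.sin (2 * n * t))
      (Real.cos (2 * n * τ) * (2 * n)) τ := fun τ => by
    simpa using ((hasDerivAt_id τ).const_mul (2 * (n : ℝ))).sin
  have h := intervalIntegral.integral_mul_deriv_eq_deriv_mul_of_hasDerivWithinAt
    (u := fun t : ℝ => Real.sin (2 * n * t)) (v := f) (a := 0) (b := Real.pi / 2)
    (fun τ _ => (hd τ).hasDerivWithinAt)
    (by rw [Set.uIcc_of_le half_pi_nonneg]; exact hf)
    (Continuous.intervalIntegrable (by fun_prop) _ _) (intervalIntegrable_half_pi hf')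
  rw [show 2 * (n : ℝ) * (Real.pi / 2) = n * Real.pi by ring, Real.sin_int_mul_pi] at h
  simp only [mul_zero, Real.sin_zero, zero_mul, sub_zero, zero_sub] at h
  rw [sinInt, cosInt, ← intervalIntegral.integral_const_mul]
  simp only [mul_comm (f' _)]
  rw [h, ← intervalIntegral.integral_neg]
  refine intervalIntegral.integral_congr fun τ _ => ?_
  ring

/-- Unlike for `sinInt_deriv`, where sin 2nτ vanishes at the ends, the boundary terms disappear here
only through the boundary values of f; the Neumann conditions are used at this point. -/
theorem cosInt_deriv {f f' : ℝ → ℝ}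
    (hf : ∀ τ ∈ Set.Icc 0 (Real.pi / 2), HasDerivWithinAt f (f' τ) (Set.Icc 0 (Real.pi / 2)) τ)
    (hf' : ContinuousOn f' (Set.Icc 0 (Real.pi / 2))) (h0 : f 0 = 0) (h1 : f (Real.pi / 2) = 0)
    (n : ℤ) : cosInt f' n = 2 * n * sinInt f n := by
  have hd : ∀ τ : ℝ, HasDerivAt (fun t : ℝ => Real.cos (2 * n * t))
      (-Real.sin (2 * n * τ) * (2 * n)) τ := fun τ => by
    simpa using ((hasDerivAt_id τ).const_mul (2 * (n : ℝ))).cos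
  have h := intervalIntegral.integral_mul_deriv_eq_deriv_mul_of_hasDerivWithinAt
    (u := fun t : ℝ => Real.cos (2 * n * t)) (v := f) (a := 0) (b := Real.pi / 2)
    (fun τ _ => (hd τ).hasDerivWithinAt)
    (by rw [Set.uIcc_of_le half_pi_nonneg]; exact hf)
    (Continuous.intervalIntegrable (by fun_prop) _ _) (intervalIntegrable_half_pi hf')
  rw [h0, h1] at h
  simp only [mul_zero, sub_zero, zero_sub] at h
  rw [sinInt, cosInt, ← intervalIntegral.integral_const_mul]
  simp only [mul_comm (f' _)]
  rw [h, ← intervalIntegral.integral_neg]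
  refine intervalIntegral.integral_congr fun τ _ => ?_
  ring

/-- The cosines `cos 2nτ` are complete on `[0, π / 2]`. -/
theorem eq_zero_of_cosInt_eq_zero {f : ℝ → ℝ} (hf : ContinuousOn f (Set.Icc 0 (Real.pi / 2)))
    (h : ∀ n, cosInt f n = 0) : ∀ τ ∈ Set.Icc 0 (Real.pi / 2), f τ = 0 := by
  -- Multiplication by cos 2τ only mixes neighbouring coefficients, so f is orthogonal to every
  -- polynomial in cos 2τ.
  have hpoly : ∀ p : Polynomial ℝ, ∀ n, cosInt (fun τ => p.eval (Real.cos (2 * τ)) * f τ) n = 0 := by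
    intro p
    have hc : ∀ p : Polynomial ℝ,
        ContinuousOn (fun τ => p.eval (Real.cos (2 * τ)) * f τ) (Set.Icc 0 (Real.pi / 2)) := fun p =>
      ContinuousOn.mul (p.continuous.comp (by fun_prop)).continuousOn hf
    induction p using Polynomial.induction_on with
    | C r => intro n; simp [cosInt_const_mul, h]
    | add p q hp hq =>
      intro n
      simp only [Polynomial.eval_add, add_mul]
      rw [cosInt_add (hc p) (hc q), hp, hq, add_zero]
    | monomial k r ih =>
      intro n
      have e : (fun τ => (Polynomial.C r * Polynomial.X ^ (k + 1)).eval (Real.cos (2 * τ)) * f τ) =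
          fun τ => Real.cos (2 * τ) *
            ((Polynomial.C r * Polynomial.X ^ k).eval (Real.cos (2 * τ)) * f τ) := by
        ext τ; simp; ring
      rw [e, cosInt_cos_mul (hc _), ih, ih]; simp
  obtain ⟨M, hM⟩ := isCompact_Icc.exists_bound_of_continuousOn hf
  have hM0 : 0 ≤ M := (norm_nonneg _).trans (hM 0 ⟨le_rfl, half_pi_nonneg⟩)
  -- The substitution x = cos 2τ maps [0, π/2] onto [-1, 1], where the Weierstrass theorem provides
  -- polynomials close to f.
  have hF : ContinuousOn (fun x => f (Real.arccos x / 2)) (Set.Icc (-1) 1) := by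
    refine hf.comp (Real.continuous_arccos.div_const 2).continuousOn fun x _ => ?_
    exact ⟨by linarith [Real.arccos_nonneg x], by linarith [Real.arccos_le_pi x]⟩
  have hle : ∀ ε > 0, ∫ τ in (0 : ℝ)..(Real.pi / 2), f τ * f τ ≤ ε * (M * |Real.pi / 2 - 0|) := by
    intro ε hε
    obtain ⟨p, hp⟩ := exists_polynomial_near_of_continuousOn (-1) 1 _ hF ε hε
    have hp0 := hpoly p 0
    rw [cosInt] at hp0
    simp only [Int.cast_zero, mul_zero, zero_mul, Real.cos_zero, mul_one] at hp0
    have hpc : Continuous fun τ : ℝ => p.eval (Real.cos (2 * τ)) := p.continuous.comp (by fun_prop)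
    have e : ∫ τ in (0 : ℝ)..(Real.pi / 2), f τ * f τ =
        ∫ τ in (0 : ℝ)..(Real.pi / 2), (f τ * f τ - p.eval (Real.cos (2 * τ)) * f τ) := by
      rw [intervalIntegral.integral_sub (intervalIntegrable_half_pi (by fun_prop))
        (intervalIntegrable_half_pi (by fun_prop)), hp0, sub_zero]
    rw [e, ← mul_assoc]
    refine (Real.le_norm_self _).trans (intervalIntegral.norm_integral_le_of_norm_le_const fun τ hτ => ?_)
    rw [Set.uIoc_of_le half_pi_nonneg] at hτ
    have h1 := hM τ (Set.Ioc_subset_Icc_self hτ)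
    have h2 := hp (Real.cos (2 * τ)) ⟨Real.neg_one_le_cos _, Real.cos_le_one _⟩
    rw [Real.arccos_cos (by linarith [hτ.1]) (by linarith [hτ.2]), mul_div_cancel_left₀ _ two_ne_zero,
      abs_sub_comm] at h2
    rw [← sub_mul, norm_mul, Real.norm_eq_abs]
    exact mul_le_mul h2.le h1 (norm_nonneg _) hε.le
  have hzero : ∫ τ in (0 : ℝ)..(Real.pi / 2), f τ * f τ ≤ 0 := by
    have hlim : Tendsto (fun ε : ℝ => ε * (M * |Real.pi / 2 - 0|)) (𝓝[>] 0)
        (𝓝 (0 * (M * |Real.pi / 2 - 0|))) :=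
      (tendsto_id.mono_left nhdsWithin_le_nhds).mul_const _
    rw [zero_mul] at hlim
    exact ge_of_tendsto hlim (eventually_mem_nhdsWithin.mono fun ε hε => hle ε hε)
  intro τ hτ
  by_contra hne
  exact absurd hzero (not_le.2 (intervalIntegral.integral_pos (by positivity) (hf.mul hf)
    (fun x _ => mul_self_nonneg _) ⟨τ, hτ, mul_self_pos.2 hne⟩))

/-- A square-summable sequence from a bound by `1 / (1 + n ^ 2) ^ (1 / 2)`. -/
theorem memℓp_of_sq_le {x : ℤ → ℂ} {M : ℝ} (h : ∀ n : ℤ, ‖x n‖ ^ 2 ≤ M * (1 + (n : ℝ) ^ 2)⁻¹) :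
    Memℓp x 2 :=
  memℓp_two_iff.2 (Summable.of_nonneg_of_le (fun _ => sq_nonneg _) h
    (summable_inv_one_add_sq.mul_left M))

namespace Coeffs

variable {m : Coeffs}

theorem cosInt_qf {f : ℝ → ℝ} (hf : ContinuousOn f (Set.Icc 0 (Real.pi / 2))) (n : ℤ) :
    cosInt (fun τ => m.qf τ * f τ) n =
      m.A * cosInt f n - m.B * (1 / 2 * (cosInt f (n - 1) + cosInt f (n + 1))) := by
  have := cosInt_affine_mul hf m.A (-m.B) n
  simp only [neg_mul, ← sub_eq_add_neg] at this
  exact this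

theorem cosInt_df {f : ℝ → ℝ} (hf : ContinuousOn f (Set.Icc 0 (Real.pi / 2))) (n : ℤ) :
    cosInt (fun τ => m.df τ * f τ) n =
      m.C * cosInt f n - m.E * (1 / 2 * (cosInt f (n - 1) + cosInt f (n + 1))) := by
  have := cosInt_affine_mul hf m.C (-m.E) n
  simp only [neg_mul, ← sub_eq_add_neg] at this
  exact this

theorem cosInt_kf {f : ℝ → ℝ} (hf : ContinuousOn f (Set.Icc 0 (Real.pi / 2))) (n : ℤ) :
    cosInt (fun τ => m.kf τ * f τ) n =
      m.E * (cosInt f n + 1 / 2 * (cosInt f (n - 1) + cosInt f (n + 1))) := by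
  have := cosInt_affine_mul hf m.E m.E n
  rw [mul_add, ← this]
  exact cosInt_congr (fun τ _ => by simp only [kf]; ring) n

variable (m) in
theorem continuous_qf : Continuous m.qf := by
  unfold qf; fun_prop

variable (m) in
theorem continuous_df : Continuous m.df := by
  unfold df; fun_prop

/-- The second derivative of the first component of a solution. -/
theorem IsRealSol.deriv_deriv {h : ℝ} {W Z : ℝ → ℝ} (hs : m.IsRealSol h W Z) :
    ∀ τ ∈ Set.Icc 0 (Real.pi / 2), HasDerivWithinAt (fun t => m.gam t * Z t)
      (-(m.R * Real.sin (2 * τ) / (m.qf τ * m.df τ)) * m.gam τ * Z τ +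
        m.gam τ * -(m.gam τ * ((h - m.lam * m.kf τ) * W τ))) (Set.Icc 0 (Real.pi / 2)) τ :=
  fun τ hτ => (m.hasDerivAt_gam τ).hasDerivWithinAt.mul (hs.deriv_Z τ hτ)

theorem IsRealSol.continuousOn {h : ℝ} {W Z : ℝ → ℝ} (hs : m.IsRealSol h W Z) :
    ContinuousOn W (Set.Icc 0 (Real.pi / 2)) := fun τ hτ => (hs.deriv_W τ hτ).continuousWithinAt

/-- The recursion for the cosine coefficients of a solution. -/
theorem IsRealSol.exists_cosInt_recursion {h : ℝ} {W Z : ℝ → ℝ} (hs : m.IsRealSol h W Z) :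
    ∃ V : ℝ → ℝ, ContinuousOn V (Set.Icc 0 (Real.pi / 2)) ∧
      (∀ n, cosInt V n = -4 * ((n : ℝ) ^ 2 * cosInt W n)) ∧
      ∀ n, cosInt (fun τ => m.qf τ * (m.df τ * V τ)) n =
        m.R * ((n + 1 : ℤ) * cosInt W (n + 1) - (n - 1 : ℤ) * cosInt W (n - 1)) +
        m.lam * cosInt (fun τ => m.kf τ * (m.qf τ * (m.qf τ * W τ))) n -
        h * cosInt (fun τ => m.qf τ * (m.qf τ * W τ)) n := by
  have hq := m.continuous_qf
  have hdc := m.continuous_df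
  have hk := m.continuous_kf
  have hg := m.continuous_gam
  have hW := hs.continuousOn
  have hZ : ContinuousOn Z (Set.Icc 0 (Real.pi / 2)) := fun τ hτ =>
    (hs.deriv_Z τ hτ).continuousWithinAt
  have hq0 : ∀ τ, m.qf τ * m.df τ ≠ 0 := fun τ => (mul_pos (m.qf_pos τ) (m.df_pos τ)).ne'
  have hW1 : ContinuousOn (fun τ => m.gam τ * Z τ) (Set.Icc 0 (Real.pi / 2)) := by fun_prop
  -- This is W'', computed from the system. Its continuity will bound n² times the cosine
  -- coefficients of W.
  set V : ℝ → ℝ := fun τ => -(m.R * Real.sin (2 * τ) / (m.qf τ * m.df τ)) * m.gam τ * Z τ +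
    m.gam τ * -(m.gam τ * ((h - m.lam * m.kf τ) * W τ)) with hV
  have hVc : ContinuousOn V (Set.Icc 0 (Real.pi / 2)) := by
    have : Continuous fun τ => m.R * Real.sin (2 * τ) / (m.qf τ * m.df τ) :=
      Continuous.div (by fun_prop) (by fun_prop) hq0
    fun_prop
  have hsin := sinInt_deriv hs.deriv_W hW1
  refine ⟨V, hVc, fun n => ?_, fun n => ?_⟩
  · rw [cosInt_deriv hs.deriv_deriv hVc (by simp [hs.left]) (by simp [hs.right]), hsin]
    ring
  · have e : Set.EqOn (fun τ => m.qf τ * (m.df τ * V τ))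
        (fun τ => (-m.R) * (Real.sin (2 * τ) * (m.gam τ * Z τ)) +
          (m.lam * (m.kf τ * (m.qf τ * (m.qf τ * W τ))) + (-h) * (m.qf τ * (m.qf τ * W τ))))
        (Set.Icc 0 (Real.pi / 2)) := by
      intro τ _
      have h2 := m.gam_sq τ
      rw [eq_div_iff (m.df_pos τ).ne'] at h2
      have h3 := (m.qf_pos τ).ne'
      have h4 := (m.df_pos τ).ne'
      simp only [hV]
      have h5 : m.qf τ * (m.df τ * (-(m.R * Real.sin (2 * τ) / (m.qf τ * m.df τ)) * m.gam τ * Z τ)) =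
          -m.R * (Real.sin (2 * τ) * (m.gam τ * Z τ)) := by
        field_simp
      linear_combination h5 - m.qf τ * (h - m.lam * m.kf τ) * W τ * h2
    rw [cosInt_congr e, cosInt_add (by fun_prop) (by fun_prop),
      cosInt_add (by fun_prop) (by fun_prop), cosInt_const_mul, cosInt_const_mul, cosInt_const_mul,
      cosInt_sin_mul hW1, hsin, hsin]
    ring

/-- The decay of the cosine coefficients u of W places u and n u in ℓ², but n² u is a priori only
bounded. The sequence y is therefore obtained by solving the leading equation in ℓ² and is then
identified with n² u by uniqueness among bounded sequences; the eigenvector is y + u. -/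
theorem isEigenvalue_of_isSystemEigenvalue {h : ℝ} (hh : m.IsSystemEigenvalue h) :
    m.pencil.IsEigenvalue (h : ℂ) := by
  obtain ⟨W, Z, hs, τ₀, hτ₀, hne⟩ := hh
  have hW := hs.continuousOn
  have hq := m.continuous_qf
  have hdc := m.continuous_df
  obtain ⟨V, hV, hVW, hrec⟩ := hs.exists_cosInt_recursion
  obtain ⟨M₁, hM₁⟩ := exists_abs_cosInt_le hW
  obtain ⟨M₂, hM₂⟩ := exists_abs_cosInt_le hV
  obtain ⟨M, hM₀, hM⟩ : ∃ M, 0 ≤ M ∧ ∀ n : ℤ, (1 + (n : ℝ) ^ 2) * |cosInt W n| ≤ M := by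
    refine ⟨M₁ + M₂ / 4, ?_, fun n => ?_⟩
    · linarith [(abs_nonneg _).trans (hM₁ 0), (abs_nonneg _).trans (hM₂ 0)]
    · have h2 := hM₂ n
      rw [hVW, abs_mul, abs_mul, abs_of_nonneg (sq_nonneg (n : ℝ))] at h2
      norm_num at h2
      linarith [hM₁ n]
  have hsq : ∀ n : ℤ, (1 + (n : ℝ) ^ 2) * ‖(cosInt W n : ℂ)‖ ^ 2 ≤ M ^ 2 * (1 + (n : ℝ) ^ 2)⁻¹ := by
    intro n
    have hp : (0 : ℝ) < 1 + (n : ℝ) ^ 2 := by positivity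
    rw [← div_eq_mul_inv, le_div_iff₀ hp, Complex.norm_real, Real.norm_eq_abs]
    calc (1 + (n : ℝ) ^ 2) * |cosInt W n| ^ 2 * (1 + (n : ℝ) ^ 2)
        = ((1 + (n : ℝ) ^ 2) * |cosInt W n|) ^ 2 := by ring
      _ ≤ M ^ 2 := pow_le_pow_left₀ (by positivity) (hM n) 2
  let u : Ell2 := ⟨fun n => (cosInt W n : ℂ), memℓp_of_sq_le (M := M ^ 2) fun n =>
    le_trans (by nlinarith [sq_nonneg ‖(cosInt W n : ℂ)‖, sq_nonneg (n : ℝ)]) (hsq n)⟩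
  let du : Ell2 := ⟨fun n => (n : ℂ) * (cosInt W n : ℂ), memℓp_of_sq_le (M := M ^ 2) fun n =>
    le_trans (by
      rw [norm_mul, mul_pow, Complex.norm_intCast, sq_abs]
      nlinarith [sq_nonneg ‖(cosInt W n : ℂ)‖]) (hsq n)⟩
  have hu : ∀ n, u n = (cosInt W n : ℂ) := fun _ => rfl
  have hdu : ∀ n, du n = (n : ℂ) * (cosInt W n : ℂ) := fun _ => rfl
  obtain ⟨y, hy⟩ := m.QL_DL_surjective ((4 : ℂ)⁻¹ • (m.rL du -
    (m.lam : ℂ) • m.kL (m.QL (m.QL u)) + (h : ℂ) • m.QL (m.QL u)))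
  have hy' : (4 : ℂ) • m.QL (m.DL y) = m.rL du -
    (m.lam : ℂ) • m.kL (m.QL (m.QL u)) + (h : ℂ) • m.QL (m.QL u) := by
    rw [show m.QL (m.DL y) = _ from hy, smul_smul]; norm_num
  have hyn : ∀ n, y n = (n : ℂ) ^ 2 * cosInt W n := by
    have hQ : ∀ n, m.QL (m.QL u) n = (cosInt (fun τ => m.qf τ * (m.qf τ * W τ)) n : ℂ) := fun n => by
      rw [cosInt_qf (by fun_prop), cosInt_qf hW, cosInt_qf hW, cosInt_qf hW]
      simp only [QL_apply, hu]
      push_cast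
      rfl
    have hK : ∀ n, m.kL (m.QL (m.QL u)) n =
        (cosInt (fun τ => m.kf τ * (m.qf τ * (m.qf τ * W τ))) n : ℂ) := fun n => by
      rw [cosInt_kf (by fun_prop), kL_apply, hQ, hQ, hQ]
      push_cast
      rfl
    have hy₁ : ∀ n, 4 * m.QL (m.DL y) n =
        (-cosInt (fun τ => m.qf τ * (m.df τ * V τ)) n : ℝ) := fun n => by
      have e : 4 * m.QL (m.DL y) n = m.rL du n - m.lam * m.kL (m.QL (m.QL u)) n +
        h * m.QL (m.QL u) n := congrArg (fun z : Ell2 => z n) hy'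
      rw [e, hrec, hQ, hK, rL_apply, hdu, hdu]
      push_cast
      ring
    -- The difference z is bounded and is annihilated by Q D; x = D z vanishes first, then z.
    let z : ℤ → ℂ := fun n => y n - (n : ℂ) ^ 2 * cosInt W n
    let x : ℤ → ℂ := fun n => m.C * z n - m.E * (1 / 2 * (z (n - 1) + z (n + 1)))
    have hzM : ∀ n, ‖z n‖ ≤ ‖y‖ + M := fun n => by
      refine (norm_sub_le _ _).trans (add_le_add (lp.norm_apply_le_norm two_ne_zero y n) ?_)
      rw [norm_mul, norm_pow, Complex.norm_intCast, sq_abs, Complex.norm_real, Real.norm_eq_abs]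
      linarith [hM n, abs_nonneg (cosInt W n)]
    have hxM : ∀ n, ‖x n‖ ≤ m.C * (‖y‖ + M) + m.E * (‖y‖ + M) := fun n => by
      refine (norm_sub_le _ _).trans ?_
      rw [norm_mul, norm_mul, Complex.norm_real, Complex.norm_real,
        Real.norm_of_nonneg m.C_pos.le, Real.norm_of_nonneg m.E_pos.le, norm_mul]
      have h1 : ‖(1 / 2 : ℂ)‖ = 1 / 2 := by norm_num
      have h2 := (norm_add_le (z (n - 1)) (z (n + 1))).trans (add_le_add (hzM _) (hzM _))
      rw [h1]
      refine add_le_add (mul_le_mul_of_nonneg_left (hzM n) m.C_pos.le)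
        (mul_le_mul_of_nonneg_left ?_ m.E_pos.le)
      linarith
    have hx0 : ∀ n, x n = 0 := eq_zero_of_mul_eq_average m.B_pos.le m.B_lt hxM fun n => by
      have e := hy₁ n
      rw [cosInt_qf (by fun_prop), cosInt_df hV, cosInt_df hV, cosInt_df hV] at e
      simp only [hVW, QL_apply, DL_apply] at e
      simp only [x, z]
      push_cast at e ⊢
      linear_combination e / 4
    intro n
    refine sub_eq_zero.1 (eq_zero_of_mul_eq_average (x := z) m.E_pos.le m.E_lt hzM (fun n => ?_) n)
    exact sub_eq_zero.1 (hx0 n)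
  refine ⟨y + u, ?_, ?_, ?_⟩
  · refine mem_evenSeq.2 fun n => ?_
    change y (-n) + u (-n) = y n + u n
    rw [hyn, hyn, hu, hu, cosInt_neg]; push_cast; ring
  · intro h0
    refine hne (eq_zero_of_cosInt_eq_zero hW (fun n => ?_) τ₀ hτ₀)
    have e : y n + u n = 0 := congrArg (fun z : Ell2 => z n) h0
    have e' : (1 + (n : ℂ) ^ 2) * cosInt W n = 0 := by rw [← e, hyn, hu]; ring
    exact_mod_cast (mul_eq_zero.1 e').resolve_left (one_add_sq_ne_zero n)
  · have e1 : invL (y + u) = u := by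
      ext n
      rw [invL_apply]
      change _ * (y n + u n) = u n
      rw [hyn, hu]
      field_simp [one_add_sq_ne_zero n]
      ring
    have e2 : invDerivL (y + u) = du := by
      ext n
      rw [invDerivL_apply]
      change _ * (y n + u n) = du n
      rw [hyn, hu, hdu]
      field_simp [one_add_sq_ne_zero n]
      ring
    rw [pencil_T_apply, e1, e2, add_sub_cancel_right, hy']
    abel

end Coeffs

/-! ### The system has infinitely many eigenvalues -/

theorem exists_primitive_on_Icc {T : ℝ} (hT : 0 ≤ T) {f : ℝ → ℝ}
    (hf : ContinuousOn f (Set.Icc 0 T)) :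
    ∃ G : ℝ → ℝ, ∀ τ ∈ Set.Icc 0 T, HasDerivWithinAt G (f τ) (Set.Icc 0 T) τ := by
  have hc : Continuous (Set.IccExtend hT (Set.domRestrict (Set.Icc 0 T) f)) :=
    (continuousOn_iff_continuous_domRestrict.1 hf).Icc_extend'
  refine ⟨fun x => ∫ t in (0 : ℝ)..x, Set.IccExtend hT (Set.domRestrict (Set.Icc 0 T) f) t,
    fun τ hτ => ?_⟩
  have := (intervalIntegral.integral_hasDerivAt_right (hc.intervalIntegrable 0 τ)
    (hc.stronglyMeasurableAtFilter _ _) hc.continuousAt).hasDerivWithinAt (s := Set.Icc 0 T)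
  rwa [Set.IccExtend_of_mem hT _ hτ] at this

theorem abs_cos_sq_sub_cos_sq_le (x y : ℝ) :
    |Real.cos x ^ 2 - Real.cos y ^ 2| ≤ 2 * |x - y| := by
  have h1 : |Real.cos x - Real.cos y| ≤ |x - y| := Real.abs_cos_sub_cos_le x y
  have h2 : |Real.cos x + Real.cos y| ≤ 2 :=
    (abs_add_le _ _).trans (by linarith [Real.abs_cos_le_one x, Real.abs_cos_le_one y])
  rw [sq_sub_sq, abs_mul]
  exact mul_le_mul h2 h1 (abs_nonneg _) two_pos.le

namespace Coeffs

variable (m : Coeffs)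

theorem exists_gam_bounds : ∃ g₀ g₁ : ℝ, 0 < g₀ ∧ ∀ τ, g₀ ≤ m.gam τ ∧ m.gam τ ≤ g₁ := by
  have h1 := m.B_pos
  have h2 := m.B_lt
  have h3 := m.E_pos
  have h4 := m.E_lt
  refine ⟨Real.sqrt ((m.A - m.B) / (m.C + m.E)), Real.sqrt ((m.A + m.B) / (m.C - m.E)),
    Real.sqrt_pos.2 (div_pos (by linarith) (by linarith)), fun τ => ?_⟩
  have c1 := Real.cos_le_one (2 * τ)
  have c2 := Real.neg_one_le_cos (2 * τ)
  have d := m.df_pos τ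
  constructor <;> refine Real.sqrt_le_sqrt (div_le_div₀ ?_ ?_ ?_ ?_) <;>
    simp only [qf, df] at * <;> nlinarith

theorem kf_nonneg (τ : ℝ) : 0 ≤ m.kf τ :=
  mul_nonneg m.E_pos.le (by linarith [Real.neg_one_le_cos (2 * τ)])

theorem kf_le (τ : ℝ) : m.kf τ ≤ 2 * m.E := by
  have := Real.cos_le_one (2 * τ)
  have := m.E_pos
  rw [kf]; nlinarith

/-- The right-hand side of the equation for the Prüfer angle. -/
def angleField (ω τ θ : ℝ) : ℝ :=
  m.gam τ * ω - m.gam τ * m.lam * m.kf τ / ω * Real.cos θ ^ 2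

theorem exists_weight_bound : ∃ D : ℝ, 0 ≤ D ∧ ∀ τ, |m.gam τ * m.lam * m.kf τ| ≤ D := by
  obtain ⟨g₀, g₁, hg₀, hg⟩ := m.exists_gam_bounds
  have hg₁ : 0 ≤ g₁ := hg₀.le.trans ((hg 0).1.trans (hg 0).2)
  have hE := m.E_pos
  refine ⟨g₁ * |m.lam| * (2 * m.E), by positivity, fun τ => ?_⟩
  rw [abs_mul, abs_mul, abs_of_pos (m.gam_pos τ), abs_of_nonneg (m.kf_nonneg τ)]
  exact mul_le_mul (mul_le_mul_of_nonneg_right (hg τ).2 (abs_nonneg _)) (m.kf_le τ)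
    (m.kf_nonneg τ) (by positivity)

theorem exists_lipschitzWith_angleField {ω : ℝ} (hω : 0 < ω) :
    ∃ K : NNReal, ∀ τ, LipschitzWith K (m.angleField ω τ) := by
  obtain ⟨D, hD₀, hD⟩ := m.exists_weight_bound
  refine ⟨⟨D / ω * 2, by positivity⟩, fun τ => LipschitzWith.of_dist_le_mul fun x y => ?_⟩
  rw [Real.dist_eq, Real.dist_eq]
  change _ ≤ D / ω * 2 * |x - y|
  rw [show m.angleField ω τ x - m.angleField ω τ y = -(m.gam τ * m.lam * m.kf τ / ω *
    (Real.cos x ^ 2 - Real.cos y ^ 2)) by simp only [angleField]; ring, abs_neg, abs_mul, abs_div,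
    abs_of_pos hω, mul_assoc (D / ω)]
  exact mul_le_mul (div_le_div_of_nonneg_right (hD τ) hω.le) (abs_cos_sq_sub_cos_sq_le x y)
    (abs_nonneg _) (by positivity)

/-- The field is bounded and globally Lipschitz in θ, so Picard–Lindelöf applies on the whole
interval at once. -/
theorem exists_angle {ω : ℝ} (hω : 0 < ω) : ∃ θ : ℝ → ℝ, θ 0 = 0 ∧
    ∀ τ ∈ Set.Icc 0 (Real.pi / 2),
      HasDerivWithinAt θ (m.angleField ω τ (θ τ)) (Set.Icc 0 (Real.pi / 2)) τ := by
  obtain ⟨K, hK⟩ := m.exists_lipschitzWith_angleField hω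
  obtain ⟨D, hD₀, hD⟩ := m.exists_weight_bound
  obtain ⟨g₀, g₁, hg₀, hg⟩ := m.exists_gam_bounds
  have hg₁ : 0 ≤ g₁ := hg₀.le.trans ((hg 0).1.trans (hg 0).2)
  have hgc := m.continuous_gam
  have hkc := m.continuous_kf
  have hL : 0 ≤ g₁ * ω + D / ω := by positivity
  have hp := half_pi_nonneg
  have hPL : IsPicardLindelof (m.angleField ω) (tmin := 0) (tmax := Real.pi / 2)
      ⟨0, Set.left_mem_Icc.2 hp⟩ 0 ⟨(g₁ * ω + D / ω) * (Real.pi / 2), by positivity⟩ 0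
      ⟨g₁ * ω + D / ω, hL⟩ K :=
    { lipschitzOnWith := fun t _ => (hK t).lipschitzOnWith
      continuousOn := fun x _ => by
        simp only [angleField]
        fun_prop
      norm_le := fun t _ x _ => by
        change _ ≤ g₁ * ω + D / ω
        refine (norm_sub_le _ _).trans (add_le_add ?_ ?_)
        · rw [Real.norm_of_nonneg (mul_nonneg (m.gam_pos t).le hω.le)]
          exact mul_le_mul_of_nonneg_right (hg t).2 hω.le
        · rw [Real.norm_eq_abs, abs_mul, abs_div, abs_of_pos hω,
            abs_of_nonneg (sq_nonneg (Real.cos x))]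
          calc |m.gam t * m.lam * m.kf t| / ω * Real.cos x ^ 2
              ≤ D / ω * 1 := mul_le_mul (div_le_div_of_nonneg_right (hD t) hω.le)
                (Real.cos_sq_le_one x) (sq_nonneg _) (by positivity)
            _ = D / ω := mul_one _
      mul_max_le := by
        change (g₁ * ω + D / ω) * max (Real.pi / 2 - 0) (0 - 0) ≤
          (g₁ * ω + D / ω) * (Real.pi / 2) - 0
        rw [sub_zero, sub_zero, sub_zero, max_eq_left hp] }
  obtain ⟨θ, h0, hθ⟩ := hPL.exists_eq_forall_mem_Icc_hasDerivWithinAt₀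
  exact ⟨θ, h0, hθ⟩

/-- The Prüfer angle with initial value `0`. -/
def angle (ω : ℝ) : ℝ → ℝ := if hω : 0 < ω then (m.exists_angle hω).choose else 0

theorem angle_zero {ω : ℝ} (hω : 0 < ω) : m.angle ω 0 = 0 := by
  rw [angle, dif_pos hω]; exact (m.exists_angle hω).choose_spec.1

theorem hasDerivWithinAt_angle {ω : ℝ} (hω : 0 < ω) : ∀ τ ∈ Set.Icc 0 (Real.pi / 2),
    HasDerivWithinAt (m.angle ω) (m.angleField ω τ (m.angle ω τ)) (Set.Icc 0 (Real.pi / 2)) τ := by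
  rw [angle, dif_pos hω]; exact (m.exists_angle hω).choose_spec.2

theorem continuousOn_angle {ω : ℝ} (hω : 0 < ω) :
    ContinuousOn (m.angle ω) (Set.Icc 0 (Real.pi / 2)) := fun τ hτ =>
  (m.hasDerivWithinAt_angle hω τ hτ).continuousWithinAt

/-- Prüfer substitution W = e^G cos θ, Z = -ω e^G sin θ with h = ω². The angle equation does not
involve G, which is a primitive found afterwards; the boundary conditions become sin θ = 0 at both
ends. -/
theorem isSystemEigenvalue_of_angle {ω : ℝ} (hω : 0 < ω)
    (h : Real.sin (m.angle ω (Real.pi / 2)) = 0) : m.IsSystemEigenvalue (ω ^ 2) := by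
  have hgc := m.continuous_gam
  have hkc := m.continuous_kf
  have hθc := m.continuousOn_angle hω
  obtain ⟨G, hG⟩ := exists_primitive_on_Icc half_pi_nonneg
    (f := fun τ => -(m.gam τ * m.lam * m.kf τ / ω) *
      (Real.sin (m.angle ω τ) * Real.cos (m.angle ω τ)))
    (by fun_prop)
  refine ⟨fun τ => Real.exp (G τ) * Real.cos (m.angle ω τ),
    fun τ => -ω * (Real.exp (G τ) * Real.sin (m.angle ω τ)), ⟨fun τ hτ => ?_, fun τ hτ => ?_, ?_, ?_⟩,
    0, Set.left_mem_Icc.2 half_pi_nonneg, ?_⟩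
  · refine ((hG τ hτ).exp.mul (m.hasDerivWithinAt_angle hω τ hτ).cos).congr_deriv ?_
    simp only [angleField]
    ring
  · refine (((hG τ hτ).exp.mul (m.hasDerivWithinAt_angle hω τ hτ).sin).const_mul (-ω)).congr_deriv ?_
    simp only [angleField]
    have hs := Real.sin_sq_add_cos_sq (m.angle ω τ)
    field_simp
    linear_combination (m.gam τ * m.lam * m.kf τ * Real.cos (m.angle ω τ)) * hs
  · simp [m.angle_zero hω]
  · simp [h]
  · simp [m.angle_zero hω]

/-- Gronwall's inequality: the angle for μ solves the equation for ω up to an error that tends to 0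
as μ tends to ω. -/
theorem continuousOn_angle_right :
    ContinuousOn (fun ω => m.angle ω (Real.pi / 2)) (Set.Ioi 0) := by
  intro ω hω
  refine ContinuousAt.continuousWithinAt ?_
  have hω : 0 < ω := hω
  obtain ⟨K, hK⟩ := m.exists_lipschitzWith_angleField hω
  obtain ⟨D, hD₀, hD⟩ := m.exists_weight_bound
  obtain ⟨g₀, g₁, hg₀, hg⟩ := m.exists_gam_bounds
  have hg₁ : 0 ≤ g₁ := hg₀.le.trans ((hg 0).1.trans (hg 0).2)
  have hderiv : ∀ {μ : ℝ}, 0 < μ → ∀ τ ∈ Set.Ico 0 (Real.pi / 2),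
      HasDerivWithinAt (m.angle μ) (m.angleField μ τ (m.angle μ τ)) (Set.Ici τ) τ :=
    fun hμ τ hτ => (m.hasDerivWithinAt_angle hμ τ (Set.Ico_subset_Icc_self hτ)).mono_of_mem_nhdsWithin
      (Icc_mem_nhdsGE_of_mem hτ)
  let ε : ℝ → ℝ := fun μ => g₁ * |μ - ω| + D * |μ⁻¹ - ω⁻¹|
  have hε : Tendsto ε (𝓝 ω) (𝓝 0) := by
    have : ContinuousAt ε ω := by
      have hinv : ContinuousAt (fun μ : ℝ => μ⁻¹) ω := continuousAt_inv₀ hω.ne'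
      fun_prop
    simpa [ε] using this.tendsto
  have hb : ∀ᶠ μ in 𝓝 ω, dist (m.angle μ (Real.pi / 2)) (m.angle ω (Real.pi / 2)) ≤
      gronwallBound 0 K (0 + ε μ) (Real.pi / 2 - 0) := by
    filter_upwards [lt_mem_nhds hω] with μ hμ
    rw [dist_comm]
    refine dist_le_of_approx_trajectories_ODE hK (m.continuousOn_angle hω) (hderiv hω)
      (fun τ _ => by rw [dist_self]) (m.continuousOn_angle hμ) (hderiv hμ) (fun τ _ => ?_)
      (by rw [m.angle_zero hω, m.angle_zero hμ, dist_self]) _ (Set.right_mem_Icc.2 half_pi_nonneg)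
    rw [Real.dist_eq]
    set c := Real.cos (m.angle μ τ) ^ 2 with hc
    have e : m.angleField μ τ (m.angle μ τ) - m.angleField ω τ (m.angle μ τ) =
        m.gam τ * (μ - ω) - m.gam τ * m.lam * m.kf τ * (μ⁻¹ - ω⁻¹) * c := by
      simp only [angleField, ← hc, div_eq_mul_inv]; ring
    rw [e]
    refine (abs_sub _ _).trans (add_le_add ?_ ?_)
    · rw [abs_mul, abs_of_pos (m.gam_pos τ)]
      exact mul_le_mul_of_nonneg_right (hg τ).2 (abs_nonneg _)
    · rw [abs_mul, abs_mul, hc, abs_of_nonneg (sq_nonneg (Real.cos _))]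
      calc _ ≤ D * |μ⁻¹ - ω⁻¹| * 1 := mul_le_mul (mul_le_mul_of_nonneg_right (hD τ) (abs_nonneg _))
            (Real.cos_sq_le_one _) (sq_nonneg _) (by positivity)
        _ = _ := mul_one _
  refine tendsto_iff_dist_tendsto_zero.2 (squeeze_zero' (.of_forall fun _ => dist_nonneg) hb ?_)
  have h1 := (gronwallBound_continuous_ε 0 K (Real.pi / 2 - 0)).tendsto 0
  rw [gronwallBound_ε0_δ0] at h1
  exact h1.comp (by simpa using hε)

/-- For ω ≥ 1 the angle has slope at least g₀ ω - D. -/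
theorem tendsto_angle_right : Tendsto (fun ω => m.angle ω (Real.pi / 2)) atTop atTop := by
  obtain ⟨D, hD₀, hD⟩ := m.exists_weight_bound
  obtain ⟨g₀, g₁, hg₀, hg⟩ := m.exists_gam_bounds
  have hp : 0 < Real.pi / 2 := by positivity
  have hlow : ∀ᶠ ω in atTop, (g₀ * ω - D) * (Real.pi / 2) ≤ m.angle ω (Real.pi / 2) := by
    filter_upwards [eventually_ge_atTop 1] with ω hω1
    have hω : 0 < ω := by linarith
    have hmono : MonotoneOn (fun τ => m.angle ω τ - (g₀ * ω - D) * τ) (Set.Icc 0 (Real.pi / 2)) := by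
      have hd : ∀ τ ∈ Set.Icc 0 (Real.pi / 2), HasDerivWithinAt
          (fun τ => m.angle ω τ - (g₀ * ω - D) * τ)
          (m.angleField ω τ (m.angle ω τ) - (g₀ * ω - D) * 1) (Set.Icc 0 (Real.pi / 2)) τ :=
        fun τ hτ => (m.hasDerivWithinAt_angle hω τ hτ).sub ((hasDerivWithinAt_id τ _).const_mul _)
      refine monotoneOn_of_hasDerivWithinAt_nonneg (convex_Icc _ _)
        (fun τ hτ => (hd τ hτ).continuousWithinAt)
        (fun τ hτ => (hd τ (interior_subset hτ)).mono interior_subset) fun τ _ => ?_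
      have h1 : g₀ * ω ≤ m.gam τ * ω := mul_le_mul_of_nonneg_right (hg τ).1 hω.le
      have h2 : m.gam τ * m.lam * m.kf τ / ω * Real.cos (m.angle ω τ) ^ 2 ≤ D := by
        refine (le_abs_self _).trans ?_
        rw [abs_mul, abs_div, abs_of_pos hω, abs_of_nonneg (sq_nonneg (Real.cos _))]
        calc _ ≤ D * 1 := mul_le_mul ((div_le_self (abs_nonneg _) hω1).trans (hD τ))
              (Real.cos_sq_le_one _) (sq_nonneg _) hD₀
          _ = D := mul_one _
      simp only [angleField]
      linarith
    have := hmono (Set.left_mem_Icc.2 hp.le) (Set.right_mem_Icc.2 hp.le) hp.le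
    simp only [m.angle_zero hω] at this
    linarith
  refine tendsto_atTop_mono' _ hlow ?_
  exact (tendsto_atTop_add_const_right _ (-D) (tendsto_id.const_mul_atTop hg₀)).atTop_mul_const hp

/-- By the intermediate value theorem the final angle attains every multiple of π beyond its value
at ω = 1, and different multiples require different ω. -/
theorem infinite_isSystemEigenvalue : {h : ℝ | m.IsSystemEigenvalue h}.Infinite := by
  obtain ⟨k, hk⟩ := exists_nat_ge (m.angle 1 (Real.pi / 2) / Real.pi)
  rw [div_le_iff₀ Real.pi_pos] at hk
  have hex : ∀ j : ℕ, ∃ ω : ℝ, 0 < ω ∧ m.angle ω (Real.pi / 2) = (k + j : ℕ) * Real.pi := by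
    intro j
    obtain ⟨μ, hμ1, hμ⟩ := ((eventually_ge_atTop (1 : ℝ)).and
      (m.tendsto_angle_right.eventually_ge_atTop ((k + j : ℕ) * Real.pi))).exists
    have hle : m.angle 1 (Real.pi / 2) ≤ (k + j : ℕ) * Real.pi := hk.trans (by
      refine mul_le_mul_of_nonneg_right ?_ Real.pi_pos.le
      push_cast; linarith [(Nat.cast_nonneg j : (0 : ℝ) ≤ j)])
    obtain ⟨ω, hω, h⟩ := intermediate_value_Icc hμ1 (m.continuousOn_angle_right.mono fun x hx =>
      lt_of_lt_of_le one_pos hx.1) ⟨hle, hμ⟩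
    exact ⟨ω, lt_of_lt_of_le one_pos hω.1, h⟩
  choose ω hω hang using hex
  refine Set.infinite_of_injective_forall_mem (f := fun j => ω j ^ 2) (fun i j hij => ?_) fun j =>
    m.isSystemEigenvalue_of_angle (hω j) (by rw [hang]; exact Real.sin_nat_mul_pi _)
  have h1 : ω i = ω j := (pow_left_inj₀ (hω i).le (hω j).le two_ne_zero).1 hij
  have h2 := hang i
  rw [h1, hang j] at h2
  have h3 := mul_right_cancel₀ Real.pi_pos.ne' h2
  have h4 : k + j = k + i := by exact_mod_cast h3
  omega

end Coeffs

/-! ### The change of variables `τ = π / 2 - am t` -/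

theorem one_sub_sq_mul_sin_sq_pos {k : ℝ} (hk : k ^ 2 < 1) (φ : ℝ) :
    0 < 1 - k ^ 2 * Real.sin φ ^ 2 := by
  nlinarith [Real.sin_sq_le_one φ, sq_nonneg (Real.sin φ), sq_nonneg k]

theorem hasDerivAt_ellipticF {k : ℝ} (hk : k ^ 2 < 1) (φ : ℝ) :
    HasDerivAt (ellipticF k) (1 / Real.sqrt (1 - k ^ 2 * Real.sin φ ^ 2)) φ := by
  have hc : Continuous fun θ : ℝ => 1 / Real.sqrt (1 - k ^ 2 * Real.sin θ ^ 2) :=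
    Continuous.div (by fun_prop) (by fun_prop) fun θ =>
      (Real.sqrt_pos.2 (one_sub_sq_mul_sin_sq_pos hk θ)).ne'
  exact intervalIntegral.integral_hasDerivAt_right (hc.intervalIntegrable 0 φ)
    (hc.stronglyMeasurableAtFilter _ _) hc.continuousAt

theorem ellipticF_zero (k : ℝ) : ellipticF k 0 = 0 := intervalIntegral.integral_same

theorem continuous_ellipticF {k : ℝ} (hk : k ^ 2 < 1) : Continuous (ellipticF k) :=
  continuous_iff_continuousAt.2 fun φ => (hasDerivAt_ellipticF hk φ).continuousAt

theorem strictMono_ellipticF {k : ℝ} (hk : k ^ 2 < 1) : StrictMono (ellipticF k) :=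
  strictMono_of_hasDerivAt_pos (hasDerivAt_ellipticF hk) fun φ =>
    div_pos one_pos (Real.sqrt_pos.2 (one_sub_sq_mul_sin_sq_pos hk φ))

/-- The integrand is at least 1. The resulting linear growth gives the surjectivity of F. -/
theorem monotone_ellipticF_sub {k : ℝ} (hk : k ^ 2 < 1) :
    Monotone fun φ => ellipticF k φ - φ := by
  refine monotone_of_hasDerivAt_nonneg
    (fun φ => (hasDerivAt_ellipticF hk φ).sub (hasDerivAt_id φ)) fun φ => ?_
  have h := Real.sqrt_pos.2 (one_sub_sq_mul_sin_sq_pos hk φ)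
  have h1 : Real.sqrt (1 - k ^ 2 * Real.sin φ ^ 2) ≤ 1 :=
    Real.sqrt_le_one.2 (by nlinarith [mul_nonneg (sq_nonneg k) (sq_nonneg (Real.sin φ))])
  have := (one_le_div h).2 h1
  simpa using this

theorem surjective_ellipticF {k : ℝ} (hk : k ^ 2 < 1) : Function.Surjective (ellipticF k) := by
  have hm := monotone_ellipticF_sub hk
  refine (continuous_ellipticF hk).surjective ?_ ?_
  · refine tendsto_atTop_mono' _ ?_ tendsto_id
    filter_upwards [eventually_ge_atTop 0] with φ hφ
    have := hm hφ
    simp only [ellipticF_zero] at this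
    simp only [id]; linarith
  · refine tendsto_atBot_mono' _ ?_ tendsto_id
    filter_upwards [eventually_le_atBot 0] with φ hφ
    have := hm hφ
    simp only [ellipticF_zero] at this
    simp only [id]; linarith

theorem jacobiAm_ellipticF {k : ℝ} (hk : k ^ 2 < 1) (φ : ℝ) : jacobiAm (ellipticF k φ) k = φ :=
  Function.leftInverse_invFun (strictMono_ellipticF hk).injective φ

theorem ellipticF_jacobiAm {k : ℝ} (hk : k ^ 2 < 1) (t : ℝ) : ellipticF k (jacobiAm t k) = t :=
  Function.rightInverse_invFun (surjective_ellipticF hk) t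

theorem continuous_jacobiAm {k : ℝ} (hk : k ^ 2 < 1) : Continuous fun t => jacobiAm t k := by
  let e := (strictMono_ellipticF hk).orderIsoOfSurjective _ (surjective_ellipticF hk)
  have : (fun t => jacobiAm t k) = e.symm := by
    ext t
    rw [OrderIso.eq_symm_apply]
    exact ellipticF_jacobiAm hk t
  rw [this]
  exact e.symm.continuous

theorem hasDerivAt_jacobiAm {k : ℝ} (hk : k ^ 2 < 1) (t : ℝ) :
    HasDerivAt (fun t => jacobiAm t k) (Real.sqrt (1 - k ^ 2 * jacobiSn t k ^ 2)) t := by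
  have h := Real.sqrt_pos.2 (one_sub_sq_mul_sin_sq_pos hk (jacobiAm t k))
  have := HasDerivAt.of_local_left_inverse (continuous_jacobiAm hk).continuousAt
    (hasDerivAt_ellipticF hk (jacobiAm t k)) (div_pos one_pos h).ne'
    (.of_forall fun s => ellipticF_jacobiAm hk s)
  simpa [jacobiSn] using this

theorem jacobiAm_mem_Icc {k : ℝ} (hk : k ^ 2 < 1) {t : ℝ} (ht : t ∈ Set.Icc 0 (ellipticK k)) :
    jacobiAm t k ∈ Set.Icc 0 (Real.pi / 2) := by
  have hm := strictMono_ellipticF hk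
  rw [← ellipticF_jacobiAm hk t] at ht
  refine ⟨hm.le_iff_le.1 ?_, hm.le_iff_le.1 ht.2⟩
  rw [ellipticF_zero]; exact ht.1

theorem ellipticF_mem_Icc {k : ℝ} (hk : k ^ 2 < 1) {φ : ℝ} (hφ : φ ∈ Set.Icc 0 (Real.pi / 2)) :
    ellipticF k φ ∈ Set.Icc 0 (ellipticK k) := by
  have hm := (strictMono_ellipticF hk).monotone
  exact ⟨(ellipticF_zero k).ge.trans (hm hφ.1), hm hφ.2⟩

theorem modulus_sq {a b c : ℝ} (hab : b < a) (hbc : c < b) (hc : 0 < c) :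
    modulus a b c ^ 2 = kSq a b c := Real.sq_sqrt (kSq_pos hab hbc hc).le

theorem modulus_sq_lt_one {a b c : ℝ} (hab : b < a) (hbc : c < b) (hc : 0 < c) :
    modulus a b c ^ 2 < 1 := (modulus_sq hab hbc hc).trans_lt (kSq_lt_one hab hbc hc)

theorem half_pi_sub_mem {τ : ℝ} (hτ : τ ∈ Set.Icc 0 (Real.pi / 2)) :
    Real.pi / 2 - τ ∈ Set.Icc 0 (Real.pi / 2) := ⟨by linarith [hτ.2], by linarith [hτ.1]⟩

theorem axesCoeffs_qf (a b c lam : ℝ) (hab : b < a) (hbc : c < b) (hc : 0 < c) (φ : ℝ) :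
    (axesCoeffs a b c lam hab hbc hc).qf (Real.pi / 2 - φ) =
      a ^ 2 * Real.cos φ ^ 2 + b ^ 2 * Real.sin φ ^ 2 := by
  change (a ^ 2 + b ^ 2) / 2 - (a ^ 2 - b ^ 2) / 2 * Real.cos (2 * (Real.pi / 2 - φ)) = _
  rw [Real.cos_two_mul, Real.cos_pi_div_two_sub]
  linear_combination (-a ^ 2) * Real.sin_sq_add_cos_sq φ

theorem axesCoeffs_df (a b c lam : ℝ) (hab : b < a) (hbc : c < b) (hc : 0 < c) (φ : ℝ) :
    (axesCoeffs a b c lam hab hbc hc).df (Real.pi / 2 - φ) =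
      1 - modulus a b c ^ 2 * Real.sin φ ^ 2 := by
  change 1 - kSq a b c / 2 - kSq a b c / 2 * Real.cos (2 * (Real.pi / 2 - φ)) = _
  rw [Real.cos_two_mul, Real.cos_pi_div_two_sub, modulus_sq hab hbc hc]
  ring

theorem axesCoeffs_kf (a b c lam : ℝ) (hab : b < a) (hbc : c < b) (hc : 0 < c) (φ : ℝ) :
    (axesCoeffs a b c lam hab hbc hc).kf (Real.pi / 2 - φ) =
      modulus a b c ^ 2 * Real.sin φ ^ 2 := by
  change kSq a b c / 2 * (1 + Real.cos (2 * (Real.pi / 2 - φ))) = _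
  rw [Real.cos_two_mul, Real.cos_pi_div_two_sub, modulus_sq hab hbc hc]
  ring

/-- The denominator is dn t, the derivative of am. Under τ = π/2 - am t this says γ dτ = -q dt, so
both systems are the same up to orientation. -/
theorem axesCoeffs_gam (a b c lam : ℝ) (hab : b < a) (hbc : c < b) (hc : 0 < c) (t : ℝ) :
    (axesCoeffs a b c lam hab hbc hc).gam (Real.pi / 2 - jacobiAm t (modulus a b c)) =
      q a b c t / Real.sqrt (1 - modulus a b c ^ 2 * jacobiSn t (modulus a b c) ^ 2) := by
  rw [Coeffs.gam, Real.sqrt_div (Coeffs.qf_pos _ _).le, axesCoeffs_qf, axesCoeffs_df]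
  rfl

theorem q_pos {a b c : ℝ} (hab : b < a) (hbc : c < b) (hc : 0 < c) (t : ℝ) : 0 < q a b c t := by
  have := (axesCoeffs a b c 0 hab hbc hc).qf_pos (Real.pi / 2 - jacobiAm t (modulus a b c))
  rw [axesCoeffs_qf] at this
  exact Real.sqrt_pos.2 this

/-- The solution is W = w, Z = -w'/q along the substitution. The sign comes from the reversed
orientation, which also exchanges the two boundary conditions. -/
theorem isSystemEigenvalue_of_isSLEigenvalue {a b c lam h : ℝ} (hab : b < a) (hbc : c < b)
    (hc : 0 < c) (hh : IsSLEigenvalue a b c lam h) :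
    (axesCoeffs a b c lam hab hbc hc).IsSystemEigenvalue h := by
  obtain ⟨w, w', hw, hw', h0, hK, t₀, ht₀, hne⟩ := hh
  have hk := modulus_sq_lt_one hab hbc hc
  set k := modulus a b c with hkdef
  set m := axesCoeffs a b c lam hab hbc hc with hm
  let T : ℝ → ℝ := fun τ => ellipticF k (Real.pi / 2 - τ)
  have hT : Set.MapsTo T (Set.Icc 0 (Real.pi / 2)) (Set.Icc 0 (ellipticK k)) := fun τ hτ =>
    ellipticF_mem_Icc hk (half_pi_sub_mem hτ)
  have hAm : ∀ τ, jacobiAm (T τ) k = Real.pi / 2 - τ := fun τ => jacobiAm_ellipticF hk _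
  have hdT : ∀ τ, HasDerivAt T (-(1 / Real.sqrt (1 - k ^ 2 * jacobiSn (T τ) k ^ 2))) τ := fun τ => by
    have h1 : HasDerivAt (fun x : ℝ => Real.pi / 2 - x) (-1) τ := (hasDerivAt_id τ).const_sub _
    have h2 := (hasDerivAt_ellipticF hk (Real.pi / 2 - τ)).comp τ h1
    rw [jacobiSn, hAm]
    exact h2.congr_deriv (by ring)
  have hgam : ∀ τ, m.gam τ = q a b c (T τ) / Real.sqrt (1 - k ^ 2 * jacobiSn (T τ) k ^ 2) := by
    intro τ
    have := axesCoeffs_gam a b c lam hab hbc hc (T τ)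
    rwa [← hkdef, hAm, sub_sub_cancel] at this
  have hkf : ∀ τ, m.kf τ = k ^ 2 * jacobiSn (T τ) k ^ 2 := fun τ => by
    have := axesCoeffs_kf a b c lam hab hbc hc (jacobiAm (T τ) k)
    rwa [hAm, sub_sub_cancel, ← hAm] at this
  refine ⟨fun τ => w (T τ), fun τ => -(1 / q a b c (T τ) * w' (T τ)), ⟨fun τ hτ => ?_, fun τ hτ => ?_,
    ?_, ?_⟩, Real.pi / 2 - jacobiAm t₀ k, half_pi_sub_mem (jacobiAm_mem_Icc hk ht₀), ?_⟩
  · refine ((hw (T τ) (hT hτ)).comp τ (hdT τ).hasDerivWithinAt hT).congr_deriv ?_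
    rw [hgam]
    have := (q_pos hab hbc hc (T τ)).ne'
    field_simp
  · refine ((hw' (T τ) (hT hτ)).comp τ (hdT τ).hasDerivWithinAt hT).neg.congr_deriv ?_
    rw [hgam, hkf, show m.lam = lam from rfl]
    ring
  · have : T 0 = ellipticK k := by simp only [T, sub_zero]; rfl
    simp [this, hK]
  · have : T (Real.pi / 2) = 0 := by simp only [T, sub_self, ellipticF_zero]
    simp [this, h0]
  · simp only [T, sub_sub_cancel, ellipticF_jacobiAm hk]
    exact hne

theorem isSLEigenvalue_of_isSystemEigenvalue {a b c lam h : ℝ} (hab : b < a) (hbc : c < b)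
    (hc : 0 < c) (hh : (axesCoeffs a b c lam hab hbc hc).IsSystemEigenvalue h) :
    IsSLEigenvalue a b c lam h := by
  obtain ⟨W, Z, hs, τ₀, hτ₀, hne⟩ := hh
  have hk := modulus_sq_lt_one hab hbc hc
  have hgam := axesCoeffs_gam a b c lam hab hbc hc
  have hkf := axesCoeffs_kf a b c lam hab hbc hc
  have hdT := hasDerivAt_jacobiAm hk
  rw [IsSLEigenvalue]
  set k := modulus a b c with hkdef
  set m := axesCoeffs a b c lam hab hbc hc with hm
  have hT : Set.MapsTo (fun t => Real.pi / 2 - jacobiAm t k) (Set.Icc 0 (ellipticK k))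
      (Set.Icc 0 (Real.pi / 2)) := fun t ht => half_pi_sub_mem (jacobiAm_mem_Icc hk ht)
  have hd : ∀ t, Real.sqrt (1 - k ^ 2 * jacobiSn t k ^ 2) ≠ 0 := fun t =>
    (Real.sqrt_pos.2 (one_sub_sq_mul_sin_sq_pos hk _)).ne'
  have hq := q_pos hab hbc hc
  have hZ : (fun t => 1 / q a b c t * (-(q a b c t * Z (Real.pi / 2 - jacobiAm t k)))) =
      fun t => -Z (Real.pi / 2 - jacobiAm t k) := by
    ext t
    have := (hq t).ne'
    field_simp
  have h0 : jacobiAm 0 k = 0 := by simpa [ellipticF_zero] using jacobiAm_ellipticF hk 0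
  have hK : jacobiAm (ellipticK k) k = Real.pi / 2 := jacobiAm_ellipticF hk _
  refine ⟨fun t => W (Real.pi / 2 - jacobiAm t k),
    fun t => -(q a b c t * Z (Real.pi / 2 - jacobiAm t k)), fun t ht => ?_, fun t ht => ?_, ?_, ?_,
    ellipticF k (Real.pi / 2 - τ₀), ellipticF_mem_Icc hk (half_pi_sub_mem hτ₀), ?_⟩
  · refine ((hs.deriv_W _ (hT ht)).comp t ((hdT t).const_sub _).hasDerivWithinAt hT).congr_deriv ?_
    rw [hgam]
    have := hd t
    field_simp
  · rw [hZ]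
    refine ((hs.deriv_Z _ (hT ht)).comp t
      ((hdT t).const_sub _).hasDerivWithinAt hT).neg.congr_deriv ?_
    rw [hgam, hkf]
    have := hd t
    change _ = -(q a b c t * (h - lam * k ^ 2 * Real.sin (jacobiAm t k) ^ 2) * _)
    rw [show m.lam = lam from rfl]
    field_simp
  · simp [h0, hs.right]
  · simp [hK, hs.left]
  · simpa [jacobiAm_ellipticF hk] using hne

theorem isSLEigenvalue_iff_isEigenvalue {a b c lam h : ℝ} (hab : b < a) (hbc : c < b)
    (hc : 0 < c) : IsSLEigenvalue a b c lam h ↔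
      (axesCoeffs a b c lam hab hbc hc).pencil.IsEigenvalue (h : ℂ) := by
  refine ⟨fun hh => Coeffs.isEigenvalue_of_isSystemEigenvalue
    (isSystemEigenvalue_of_isSLEigenvalue hab hbc hc hh), fun hh => ?_⟩
  obtain ⟨x, hx, hsys⟩ := Coeffs.isSystemEigenvalue_of_isEigenvalue hh
  rw [Complex.ofReal_inj.1 hx]
  exact isSLEigenvalue_of_isSystemEigenvalue hab hbc hc hsys

/-! ### Enumeration of the eigenvalues and convergence -/

theorem exists_isLeast_of_finite_inter_Iic {S : Set ℝ} (hne : S.Nonempty)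
    (hfin : ∀ M, (S ∩ Set.Iic M).Finite) : ∃ x, IsLeast S x := by
  obtain ⟨s, hs⟩ := hne
  obtain ⟨x, hx, hmin⟩ := Set.exists_min_image (S ∩ Set.Iic s) id (hfin s)
    ⟨s, hs, Set.mem_Iic.2 le_rfl⟩
  refine ⟨x, hx.1, fun y hy => ?_⟩
  rcases le_total y s with h | h
  · exact hmin y ⟨hy, h⟩
  · exact le_trans hx.2 h

/-- An infinite set of reals with finite initial segments is the range of a strictly increasing
sequence tending to infinity. -/
theorem exists_strictMono_range_eq {S : Set ℝ} (hinf : S.Infinite)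
    (hfin : ∀ M, (S ∩ Set.Iic M).Finite) :
    ∃ h : ℕ → ℝ, StrictMono h ∧ Set.range h = S ∧ Tendsto h atTop atTop := by
  obtain ⟨x₀, hx₀⟩ := exists_isLeast_of_finite_inter_Iic hinf.nonempty hfin
  have hnext : ∀ x : ℝ, ∃ y, IsLeast (S ∩ Set.Ioi x) y := fun x => by
    refine exists_isLeast_of_finite_inter_Iic ?_ fun M =>
      (hfin M).subset (Set.inter_subset_inter_left _ Set.inter_subset_left)
    by_contra hemp
    rw [Set.not_nonempty_iff_eq_empty] at hemp
    refine hinf ((hfin x).subset fun y hy => ⟨hy, Set.mem_Iic.2 (not_lt.1 fun h => ?_)⟩)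
    exact (hemp.le ⟨hy, h⟩ : y ∈ (∅ : Set ℝ))
  choose next hnext using hnext
  let h : ℕ → ℝ := fun n => Nat.rec x₀ (fun _ x => next x) n
  have hsucc : ∀ n, h (n + 1) = next (h n) := fun _ => rfl
  have hmem : ∀ n, h n ∈ S := fun n => by
    cases n with
    | zero => exact hx₀.1
    | succ n => exact (hnext (h n)).1.1
  have hmono : StrictMono h := strictMono_nat_of_lt_succ fun n => (hnext (h n)).1.2
  have htop : Tendsto h atTop atTop := by
    refine tendsto_atTop_atTop_of_monotone hmono.monotone fun M => ?_
    by_contra hcon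
    have hlt : ∀ n, h n < M := fun n => not_le.1 fun h' => hcon ⟨n, h'⟩
    exact Set.infinite_of_injective_forall_mem hmono.injective
      (fun n => (⟨hmem n, (hlt n).le⟩ : h n ∈ S ∩ Set.Iic M)) (hfin M)
  refine ⟨h, hmono, Set.Subset.antisymm (Set.range_subset_iff.2 hmem) fun x hx => ?_, htop⟩
  have hex : ∃ n, x ≤ h n := (htop.eventually_ge_atTop x).exists
  obtain ⟨n, hspec, hmin⟩ : ∃ n, x ≤ h n ∧ ∀ k < n, h k < x := by
    classical
    exact ⟨Nat.find hex, Nat.find_spec hex, fun k hk => not_le.1 (Nat.find_min hex hk)⟩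
  refine ⟨n, le_antisymm ?_ hspec⟩
  cases n with
  | zero => exact hx₀.2 hx
  | succ n => exact (hnext (h n)).2 ⟨hx, hmin n n.lt_succ_self⟩

/-- Convergence of ordered lists of numbers to the points of an increasing sequence. -/
theorem tendsto_of_ordered_lists {h : ℕ → ℝ} (hmono : StrictMono h) {g : ℕ → ℕ → ℂ}
    (hord : ∀ N m n, m ≤ n → n ≤ N → (g N m).re ≤ (g N n).re) {K : ℝ}
    (hsec : ∀ N n, n ≤ N → ‖g N n + K‖ ≤ 5 * (g N n + K).re)
    (hlim : ∀ (n : ℕ) (N : ℕ → ℕ) (x : ℂ), Tendsto N atTop atTop → (∀ i, n ≤ N i) →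
      Tendsto (fun i => g (N i) n) atTop (𝓝 x) → ∃ j, x = h j)
    (hnear : ∀ j, ∀ ε > 0, ∀ᶠ N in atTop, ∃ i ≤ N, g N i ∈ Metric.ball (h j : ℂ) ε)
    (hsep : ∀ j, ∃ ε > 0, ∀ᶠ N in atTop, ∀ m ≤ N, ∀ n ≤ N, m ≠ n →
      g N m ∈ Metric.ball (h j : ℂ) ε → g N n ∉ Metric.ball (h j : ℂ) ε) (n : ℕ) :
    Tendsto (fun N => g N n) atTop (𝓝 (h n : ℂ)) := by
  induction n using Nat.strong_induction_on with
  | _ n ih =>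
  -- The entries with index j < n are already close to h j, away from h n. An entry close to h n
  -- must then have index at least n, and the ordering bounds the n-th real part.
  have hup : ∀ ε > 0, ∀ᶠ N in atTop, (g N n).re ≤ h n + ε := by
    intro ε hε
    obtain ⟨δ, hδ, hδε, hgap⟩ : ∃ δ > 0, δ ≤ ε ∧ ∀ j < n, h j + 2 * δ ≤ h n := by
      rcases n.eq_zero_or_pos with rfl | hn
      · exact ⟨ε, hε, le_rfl, fun j hj => absurd hj j.not_lt_zero⟩
      · have hlt : h (n - 1) < h n := hmono (by omega)
        refine ⟨min ε ((h n - h (n - 1)) / 2), lt_min hε (by linarith), min_le_left _ _,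
          fun j hj => ?_⟩
        have h1 : h j ≤ h (n - 1) := hmono.monotone (by omega)
        linarith [min_le_right ε ((h n - h (n - 1)) / 2)]
    have hall : ∀ᶠ N in atTop, ∀ j < n, g N j ∈ Metric.ball (h j : ℂ) δ :=
      (Set.finite_lt_nat n).eventually_all.2 fun j hj =>
        (ih j hj).eventually (Metric.ball_mem_nhds _ hδ)
    filter_upwards [hall, hnear n δ hδ] with N hN ⟨i, hiN, hi⟩
    have hre : |(g N i).re - h n| < δ := by
      have := (Complex.abs_re_le_norm (g N i - h n)).trans_lt (by simpa [dist_eq_norm] using hi)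
      simpa using this
    have hni : n ≤ i := by
      by_contra! hlt
      have h1 : |(g N i).re - h i| < δ := by
        have := (Complex.abs_re_le_norm (g N i - h i)).trans_lt
          (by simpa [dist_eq_norm] using hN i hlt)
        simpa using this
      linarith [hgap i hlt, (abs_lt.1 h1).2, (abs_lt.1 hre).1]
    linarith [hord N n i hni hiN, (abs_lt.1 hre).2]
  refine tendsto_of_subseq_tendsto fun ns hns => ?_
  -- The sector turns the upper bound on the real part into a bound on the modulus, so subsequences
  -- converge.
  have hbd : ∀ᶠ i in atTop, g (ns i) n ∈ Metric.closedBall (-K : ℂ) (5 * (h n + 1 + K)) := by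
    filter_upwards [hns.eventually (hup 1 one_pos), hns.eventually_ge_atTop n] with i h1 h2
    rw [Metric.mem_closedBall, dist_eq_norm, sub_neg_eq_add]
    refine (hsec _ _ h2).trans ?_
    rw [Complex.add_re, Complex.ofReal_re]
    linarith
  obtain ⟨x, -, φ, hφ, hx⟩ := (isCompact_closedBall _ _).tendsto_subseq' hbd.frequently
  refine ⟨φ, ?_⟩
  have hNtop : Tendsto (fun i => ns (φ i)) atTop atTop := hns.comp hφ.tendsto_atTop
  obtain ⟨i₀, hi₀⟩ := eventually_atTop.1 (hNtop.eventually_ge_atTop n)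
  obtain ⟨j, rfl⟩ := hlim n (fun i => ns (φ (i + i₀))) x (hNtop.comp (tendsto_add_atTop_nat i₀))
    (fun i => hi₀ _ (Nat.le_add_left _ _)) (hx.comp (tendsto_add_atTop_nat i₀))
  have hjn : h j ≤ h n := by
    refine le_of_forall_pos_le_add fun ε hε => ?_
    have hre : Tendsto (fun i => (g (ns (φ i)) n).re) atTop (𝓝 (h j)) := by
      simpa using! (Complex.continuous_re.tendsto (h j : ℂ)).comp hx
    exact le_of_tendsto hre (hNtop.eventually (hup ε hε))
  have hjn' : j ≤ n := hmono.le_iff_le.1 hjn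
  rcases hjn'.eq_or_lt with rfl | hlt
  · exact hx
  -- If the limit were h j with j < n, the entries with indices j and n would both approach h j,
  -- against the separation of the list near h j.
  · exfalso
    obtain ⟨ε, hε, hs⟩ := hsep j
    obtain ⟨i, h1, h2, h3, h4⟩ := ((hNtop.eventually hs).and
      ((hx.eventually (Metric.ball_mem_nhds _ hε)).and
      (((ih j hlt).comp hNtop).eventually (Metric.ball_mem_nhds _ hε) |>.and
        (hNtop.eventually_ge_atTop n)))).exists
    exact h1 n h4 j (by omega) hlt.ne' h2 h3

/-- Near a given point there is at most one root of the characteristic polynomial of the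
truncated problem, counted with multiplicity, if the truncation is fine. -/
theorem exists_ball_forall_not_le_roots {a b c : ℝ} (lam : ℝ) (hab : b < a) (hbc : c < b)
    (hc : 0 < c) (x : ℂ) : ∃ ε > 0, ∀ᶠ N in atTop, ∀ μ ∈ Metric.ball x ε, ∀ ν ∈ Metric.ball x ε,
      ¬ ({μ, ν} : Multiset ℂ) ≤ (pencilPoly a b c lam N).roots := by
  obtain ⟨ε, hε, N₀, hN₀⟩ :=
    ((axesCoeffs a b c lam hab hbc hc).isSimpleAt x).exists_ball isApproximating_cosSpan
  refine ⟨ε, hε, eventually_atTop.2 ⟨N₀, fun N hN μ hμ ν hν hle => ?_⟩⟩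
  obtain ⟨v, hv, w, hw, κ, hv0, hTv, hTw, hr⟩ := exists_chain_of_roots hab hbc hc N hle
  obtain ⟨r, hr'⟩ := hN₀ N hN μ hμ ν hν v hv w hw κ hv0 hTv hTw
  exact hr r hr'

theorem eventually_exists_mem_roots {a b c lam h : ℝ} (hab : b < a) (hbc : c < b) (hc : 0 < c)
    (hh : IsSLEigenvalue a b c lam h) {ε : ℝ} (hε : 0 < ε) :
    ∀ᶠ N in atTop, ∃ μ ∈ Metric.ball (h : ℂ) ε, μ ∈ (pencilPoly a b c lam N).roots := by
  have he := (isSLEigenvalue_iff_isEigenvalue hab hbc hc).1 hh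
  obtain ⟨r, hr, hiso⟩ := ((axesCoeffs a b c lam hab hbc hc).isSimpleAt h).exists_isolating he
  filter_upwards [CompactPencil.eventually_exists_isProjEigenvalue _ isApproximating_cosSpan he hr
    hiso hε] with N ⟨μ, hμ, hev⟩
  exact ⟨μ, hμ, (isProjEigenvalue_iff hab hbc hc N μ).1 hev⟩

theorem exists_sector_roots {a b c : ℝ} (lam : ℝ) (hab : b < a) (hbc : c < b) (hc : 0 < c) :
    ∃ K : ℝ, ∀ N, ∀ μ ∈ (pencilPoly a b c lam N).roots, ‖μ + K‖ ≤ 5 * (μ + K).re := by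
  obtain ⟨K, hK⟩ := (axesCoeffs a b c lam hab hbc hc).exists_sector
  exact ⟨K, fun N μ hμ => hK (cosSpan N) (invL_mem_cosSpan N) μ
    ((isProjEigenvalue_iff hab hbc hc N μ).2 hμ)⟩

/-- The sector bounds eigenvalues from below. An accumulation point, whether or not it is an
eigenvalue, would have two distinct eigenvalues nearby, each approached by truncated ones, hence two
roots where only one is allowed. -/
theorem finite_isSLEigenvalue_inter_Iic {a b c lam : ℝ} (hab : b < a) (hbc : c < b) (hc : 0 < c)
    (M : ℝ) : ({x | IsSLEigenvalue a b c lam x} ∩ Set.Iic M).Finite := by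
  obtain ⟨K, hK⟩ := exists_sector_roots lam hab hbc hc
  have hlow : ∀ x, IsSLEigenvalue a b c lam x → -K - 1 ≤ x := by
    intro x hx
    obtain ⟨N, μ, hμ, hr⟩ := (eventually_exists_mem_roots hab hbc hc hx one_pos).exists
    have h1 := (norm_nonneg _).trans (hK N μ hr)
    have h2 := (Complex.abs_re_le_norm (μ - x)).trans_lt (by simpa [dist_eq_norm] using hμ)
    simp only [Complex.add_re, Complex.sub_re, Complex.ofReal_re] at h1 h2
    linarith [(abs_lt.1 h2).2]
  by_contra hinf
  obtain ⟨x, -, hx⟩ := Set.Infinite.exists_accPt_of_subset_isCompact hinf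
    (isCompact_Icc (a := -K - 1) (b := M)) fun y hy => ⟨hlow y hy.1, hy.2⟩
  obtain ⟨ε, hε, hsep⟩ := exists_ball_forall_not_le_roots lam hab hbc hc (x : ℂ)
  rw [accPt_iff_nhds] at hx
  obtain ⟨y, ⟨hyb, hyS⟩, hyx⟩ := hx _ (Metric.ball_mem_nhds x hε)
  have hxy : 0 < dist y x := dist_pos.2 hyx
  obtain ⟨z, ⟨hzb, hzS⟩, hzx⟩ := hx _ (Metric.ball_mem_nhds x hxy)
  have hzy : dist z x < dist y x := hzb
  have hyε : dist y x < ε := hyb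
  have hd : 0 < dist z y := dist_pos.2 fun h => by rw [h] at hzy; exact lt_irrefl _ hzy
  -- The balls of radius δ around y and z lie inside the ball of radius ε around x, as z is closer
  -- to x than y, and they are disjoint.
  obtain ⟨δ, hδ, hδ'⟩ := exists_between (lt_min (sub_pos.2 hyε) (half_pos hd))
  have hδ1 := hδ'.trans_le (min_le_left _ _)
  have hδ2 := hδ'.trans_le (min_le_right _ _)
  have hcast : ∀ s t : ℝ, dist (s : ℂ) (t : ℂ) = dist s t := fun s t => by
    rw [dist_eq_norm, dist_eq_norm, ← Complex.ofReal_sub, Complex.norm_real]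
  obtain ⟨N, hN, ⟨μ, hμ, hμr⟩, ν, hν, hνr⟩ := (hsep.and
    ((eventually_exists_mem_roots hab hbc hc hyS.1 hδ).and
      (eventually_exists_mem_roots hab hbc hc hzS.1 hδ))).exists
  rw [Metric.mem_ball] at hμ hν
  refine hN μ ?_ ν ?_ ?_
  · rw [Metric.mem_ball]
    have := dist_triangle μ (y : ℂ) x
    rw [hcast] at this
    linarith
  · rw [Metric.mem_ball]
    have := dist_triangle ν (z : ℂ) x
    rw [hcast] at this
    linarith
  · have hne : μ ≠ ν := by
      rintro rfl
      have := dist_triangle_left (z : ℂ) y μ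
      rw [hcast] at this
      linarith
    rw [Multiset.le_iff_subset (by simpa using hne)]
    intro w hw
    simp only [Multiset.insert_eq_cons, Multiset.mem_cons, Multiset.mem_singleton] at hw
    rcases hw with rfl | rfl
    · exact hμr
    · exact hνr

theorem exists_isSLEigenvalueSequence {a b c lam : ℝ} (hab : b < a) (hbc : c < b) (hc : 0 < c) :
    ∃ h : ℕ → ℝ, IsSLEigenvalueSequence a b c lam h := by
  refine exists_strictMono_range_eq ?_ (finite_isSLEigenvalue_inter_Iic hab hbc hc)
  exact (axesCoeffs a b c lam hab hbc hc).infinite_isSystemEigenvalue.mono fun x hx =>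
    isSLEigenvalue_of_isSystemEigenvalue hab hbc hc hx

section

variable {a b c lam : ℝ} {N : ℕ} {g : ℕ → ℂ}

theorem IsPencilEigenvalueList.mem_roots_iff (hg : IsPencilEigenvalueList a b c lam N g) {μ : ℂ} :
    μ ∈ (pencilPoly a b c lam N).roots ↔ ∃ n ≤ N, g n = μ := by
  rw [← hg.1]
  simp only [Multiset.mem_map, Multiset.mem_range, Nat.lt_succ_iff]

theorem IsPencilEigenvalueList.pair_le_roots (hg : IsPencilEigenvalueList a b c lam N g) {m n : ℕ}
    (hm : m ≤ N) (hn : n ≤ N) (hmn : m ≠ n) :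
    ({g m, g n} : Multiset ℂ) ≤ (pencilPoly a b c lam N).roots := by
  rw [← hg.1]
  have h : ({m, n} : Multiset ℕ) ≤ Multiset.range (N + 1) := by
    rw [Multiset.le_iff_subset (by simpa using hmn)]
    intro k hk
    simp only [Multiset.insert_eq_cons, Multiset.mem_cons, Multiset.mem_singleton] at hk
    rw [Multiset.mem_range]
    omega
  simpa using Multiset.map_le_map (f := g) h

end

theorem tendsto_pencilEigenvalue {a b c lam : ℝ} (hab : b < a) (hbc : c < b) (hc : 0 < c)
    {h : ℕ → ℝ} (hh : IsSLEigenvalueSequence a b c lam h) {hhat : ℕ → ℕ → ℂ}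
    (hhat_list : ∀ N, IsPencilEigenvalueList a b c lam N (hhat N)) (n : ℕ) :
    Tendsto (fun N => hhat N n) atTop (𝓝 (h n : ℂ)) := by
  obtain ⟨K, hK⟩ := exists_sector_roots lam hab hbc hc
  have hev : ∀ x, IsSLEigenvalue a b c lam x ↔ ∃ j, h j = x := fun x => by
    rw [← Set.mem_range, hh.2.1]; rfl
  refine tendsto_of_ordered_lists hh.1 (fun N => (hhat_list N).2) (K := K)
    (fun N n hn => hK N _ ((hhat_list N).mem_roots_iff.2 ⟨n, hn, rfl⟩)) ?_ ?_ ?_ n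
  · intro n N x hN hnN hx
    have he := CompactPencil.isEigenvalue_of_tendsto_isProjEigenvalue
      (axesCoeffs a b c lam hab hbc hc).pencil isApproximating_cosSpan hN hx fun i =>
      (isProjEigenvalue_iff hab hbc hc _ _).2 ((hhat_list _).mem_roots_iff.2 ⟨n, hnN i, rfl⟩)
    obtain ⟨y, rfl, -⟩ := Coeffs.isSystemEigenvalue_of_isEigenvalue he
    obtain ⟨j, rfl⟩ := (hev y).1 ((isSLEigenvalue_iff_isEigenvalue hab hbc hc).2 he)
    exact ⟨j, rfl⟩
  · intro j ε hε
    filter_upwards [eventually_exists_mem_roots hab hbc hc ((hev _).2 ⟨j, rfl⟩) hε] with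
      N ⟨μ, hμ, hr⟩
    obtain ⟨i, hi, rfl⟩ := (hhat_list N).mem_roots_iff.1 hr
    exact ⟨i, hi, hμ⟩
  · intro j
    obtain ⟨ε, hε, hs⟩ := exists_ball_forall_not_le_roots lam hab hbc hc (h j : ℂ)
    refine ⟨ε, hε, hs.mono fun N hN m hm n hn hmn h1 h2 => ?_⟩
    exact hN _ h1 _ h2 ((hhat_list N).pair_le_roots hm hn hmn)

end EllipsoidSL

end

theorem mainTheorem5 (a b c lam : ℝ) (hab : b < a) (hbc : c < b) (hc : 0 < c) (hlam : 0 < lam) :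
    ∃ h : ℕ → ℝ, EllipsoidSL.IsSLEigenvalueSequence a b c lam h ∧
      (∀ N : ℕ, ∃ g : ℕ → ℂ, EllipsoidSL.IsPencilEigenvalueList a b c lam N g) ∧
      ∀ hhat : ℕ → ℕ → ℂ,
        (∀ N : ℕ, EllipsoidSL.IsPencilEigenvalueList a b c lam N (hhat N)) →
        ∀ n : ℕ, Filter.Tendsto (fun N : ℕ => hhat N n) Filter.atTop (nhds ((h n : ℝ) : ℂ)) := by
  obtain ⟨h, hh⟩ := EllipsoidSL.exists_isSLEigenvalueSequence (lam := lam) hab hbc hc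
  exact ⟨h, hh, EllipsoidSL.exists_isPencilEigenvalueList hab hbc hc, fun _ hhat_list =>
    EllipsoidSL.tendsto_pencilEigenvalue hab hbc hc hh hhat_list⟩
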